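/- For a number field $k$ let $E_k$ denote the unit group of its ring of integers. For a positive integer $d$ that is not a perfect square let $\varepsilon_d>1$ denote the fundamental unit of $\mathbb{Q}(\sqrt d)\subset\mathbb{R}$, i.e. its smallest unit greater than $1$. For a real multiquadratic field $k$ with quadratic subfields $k_1,\dots,k_t$ let $q(k)=[E_k:\prod_{i=1}^{t}E_{k_i}]$ be its unit index. Let $\nu\in\{1,2\}$, let $\rho\in\{1,2\}$ with $\rho\neq\nu$, and put $\delta_{\nu,2}=1$ if $\nu=2$ and $\delta_{\nu,2}=0$ if $\nu=1$. Let $q\equiv 7\pmod 8$ and $r\equiv s\equiv 3\pmod 8$ be three distinct prime numbers such that $$\left(\frac{q}{s}\right)=\left(\frac{q}{r}\right)=(-1)^{\delta_{\nu,2}}\quad\text{and}\quad \left(\frac{s}{r}\right)=1 .$$ Write $\varepsilon_{\nu qrs}=a+b\sqrt{\nu qrs}$ with integers $a,b$, and assume that $2^{\delta_{\nu,2}}q(a-1)$ is not the square of a natural number. Let $K_{\nu}=\mathbb{Q}(\sqrt{\nu q},\sqrt{rs})$ and let $K_{\nu,1}$ be the first layer of its cyclotomic $\mathbb{Z}_2$-extension,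 i.e. the compositum of $K_\nu$ and $\mathbb{Q}(2\cos(2\pi/2^{3}))$. Then: 1. $K_{\nu,1}=\mathbb{Q}(\sqrt2,\sqrt q,\sqrt{rs})$. 2. The seven real numbers $$\varepsilon_2,\ \varepsilon_{rs},\ \sqrt{\varepsilon_q},\ \sqrt{\varepsilon_{2q}},\ \sqrt{\varepsilon_{2rs}},\ \sqrt{\varepsilon_{rs}\,\varepsilon_{\nu qrs}},\ \sqrt{\varepsilon_{\rho qrs}}$$ form a fundamental system of units of $K_{\nu,1}$ (every unit of $K_{\nu,1}$ is in exactly one way a root of unity of $K_{\nu,1}$ times a product of integral powers of them), and $$E_{K_{\nu,1}}=\left\langle -1,\ \varepsilon_2,\ \varepsilon_{rs},\ \sqrt{\varepsilon_q},\ \sqrt{\varepsilon_{2q}},\ \sqrt{\varepsilon_{2rs}},\ \sqrt{\varepsilon_{rs}\,\varepsilon_{\nu qrs}},\ \sqrt{\varepsilon_{\rho qrs}}\right\rangle .$$ 3. $q(K_{\nu,1})=[E_{K_{\nu,1}}:\prod_i E_{k_i}]=2^5$, where $k_i$ runs over the quadratic subfields of $K_{\nu,1}$. -/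

import Mathlib

open NumberField

noncomputable section

namespace RealUnits

/-- The unit group `E_k` of (the ring of integers of) a subfield `k` of `ℝ`,
viewed as a group of nonzero real numbers. -/
def unitGroup (k : IntermediateField ℚ ℝ) : Subgroup ℝˣ :=
  (Units.map (algebraMap (𝓞 k) ℝ : 𝓞 k →* ℝ)).range

/-- The quadratic field `ℚ(√d)` inside `ℝ`. -/
def quadField (d : ℕ) : IntermediateField ℚ ℝ :=
  IntermediateField.adjoin ℚ {√(d : ℝ)}

/-- `u` is the fundamental unit of `ℚ(√d)`: its smallest unit greater than `1`. -/
def IsFundamentalUnit (d : ℕ) (u : ℝˣ) : Prop :=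
  u ∈ unitGroup (quadField d) ∧ 1 < (u : ℝ) ∧
    ∀ v ∈ unitGroup (quadField d), 1 < (v : ℝ) → (u : ℝ) ≤ (v : ℝ)

open Classical in
/-- The fundamental unit `ε_d > 1` of `ℚ(√d)`, for `d` not a perfect square
(in the remaining cases `ℚ(√d) = ℚ` has no unit greater than `1`, and the value is `1`). -/
def fundUnit (d : ℕ) : ℝˣ :=
  if h : ∃ u, IsFundamentalUnit d u then h.choose else 1

/-- `u` is a fundamental system of units of `k`: every unit of `k` is, in exactly one way, a root
of unity of `k` times a product of integral powers of the units `u i` of `k`. -/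
def IsFundamentalSystem (k : IntermediateField ℚ ℝ) {n : ℕ} (u : Fin n → ℝˣ) : Prop :=
  (∀ i, u i ∈ unitGroup k) ∧
    ∀ x ∈ unitGroup k, ∃! p : ℝˣ × (Fin n → ℤ),
      p.1 ∈ unitGroup k ∧ IsOfFinOrder p.1 ∧ x = p.1 * ∏ i, u i ^ p.2 i

/-- The unit index `q(k) = [E_k : ∏ E_{k_i}]` of a real multiquadratic field `k`, where `k_i` runs
over the quadratic subfields of `k` (`0` if this index is infinite). -/
def unitIndex (k : IntermediateField ℚ ℝ) : ℕ :=
  (⨆ F ∈ {F : IntermediateField ℚ ℝ | F ≤ k ∧ Module.finrank ℚ F = 2},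
    unitGroup F).relIndex (unitGroup k)

/-- The `n`-th layer `k · ℚ(2 cos (2π / 2 ^ (n + 2)))` of the cyclotomic `ℤ₂`-extension of `k`. -/
def cyclotomicLayer (k : IntermediateField ℚ ℝ) (n : ℕ) : IntermediateField ℚ ℝ :=
  k ⊔ IntermediateField.adjoin ℚ {2 * Real.cos (2 * Real.pi / 2 ^ (n + 2))}

/-- The field `K_ν = ℚ(√(νq), √(rs))`. -/
def fieldK (ν q r s : ℕ) : IntermediateField ℚ ℝ :=
  IntermediateField.adjoin ℚ {√((ν * q : ℕ) : ℝ), √((r * s : ℕ) : ℝ)}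

end RealUnits

end

/-! Let `K = ℚ(√2, √q, √(rs))`, which is the first layer because `2 cos(2π/8) = √2`. The proof rests
on three ideas.

Square classes. When a prime `≡ 3 (mod 4)` divides `d`, the unit `ε_d = x + y√d` satisfies `x² - 1 =
d y²`. Splitting `x ± 1` into coprime parts (`pell_factor`) gives `d = m n` with `m u² - n v²` equal
to `1` or `2`, and then `ε_d` is `m` or `2m` times a square of `ℚ(√d)`. Legendre symbols at `q, r,
s` rule out most factorizations. The units `ε_q` and `ε_{2q}` have class `2`, `ε_{rs}` has class
`s`, while `ε_{2rs}` and `ε_{ρqrs}` have class `rs`. For `ε_{νqrs}` the assumption on `a - 1`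
removes the one surviving class in which `r` and `s` both occur, so exactly one of them occurs.
Hence the five square roots lie in `K`; in `√(ε_{rs} ε_{νqrs})` the unpaired factors combine.

Bounding the units. The product of the norms of a unit `η` to the seven fields `ℚ(√d)` is `η⁴
N(η)³`, because a nontrivial automorphism fixes exactly three of the seven square roots
(`fixProd_identity`). So `η⁴` lies in the group `H` generated by `-1` and the seven proposed units
(`pow_four_mem`).

Saturation. Suppose a product of the seven units with exponents `0, 1` is `η²` with `η ∈ K`. For an
involution `σ` whose fixed field is biquadratic, `η σ(η)` lies in that fixed field, and the relation
becomes a statement about square classes there. Kummer theory turns it into parity conditions on the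
exponents (`norm_step`). A few choices of `σ` kill the exponents of the square roots; `ε₂` is
excluded because its norm is `-1`, and `ε_{rs}` because `√s ∉ K` (`exponents_eq_zero`). Therefore
`H` is closed under square roots in `K`, so it contains every unit, and the seven units are
independent. The units of the quadratic subfields generate the part of `H` where the last five
exponents are even, which has index `2⁵`. -/

namespace RealUnits

/-! ### Units as real numbers, and quadratic extensions inside `ℝ`. -/

section Basic

/-- Reduces units of a ring of integers to conditions on real numbers in which only the membership
part depends on the field. -/
theorem mem_unitGroup_iff {k : IntermediateField ℚ ℝ} {x : ℝˣ} :
    x ∈ unitGroup k ↔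
      (x : ℝ) ∈ k ∧ IsIntegral ℤ (x : ℝ) ∧ IsIntegral ℤ ((x⁻¹ : ℝˣ) : ℝ) := by
  constructor
  · rintro ⟨u, rfl⟩
    refine ⟨((u : 𝓞 k) : k).2, ?_, ?_⟩
    · exact (RingOfIntegers.isIntegral_coe (u : 𝓞 k)).map (k.val.restrictScalars ℤ)
    · rw [← map_inv]
      exact (RingOfIntegers.isIntegral_coe ((u⁻¹ : (𝓞 k)ˣ) : 𝓞 k)).map (k.val.restrictScalars ℤ)
  · rintro ⟨h1, h2, h3⟩
    have h4 : ((x⁻¹ : ℝˣ) : ℝ) ∈ k := by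
      rw [Units.val_inv_eq_inv_val]; exact k.inv_mem h1
    have i1 : IsIntegral ℤ (⟨x, h1⟩ : k) :=
      (isIntegral_algHom_iff (k.val.restrictScalars ℤ) Subtype.val_injective).1 h2
    have i2 : IsIntegral ℤ (⟨_, h4⟩ : k) :=
      (isIntegral_algHom_iff (k.val.restrictScalars ℤ) Subtype.val_injective).1 h3
    refine ⟨⟨⟨_, i1⟩, ⟨_, i2⟩, ?_, ?_⟩, ?_⟩
    · apply Subtype.ext; apply Subtype.ext; exact x.mul_inv
    · apply Subtype.ext; apply Subtype.ext; exact x.inv_mul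
    · apply Units.ext; rfl

theorem unitGroup_mono {k l : IntermediateField ℚ ℝ} (h : k ≤ l) : unitGroup k ≤ unitGroup l :=
  fun _ hx => by
    rw [mem_unitGroup_iff] at hx ⊢
    exact ⟨h hx.1, hx.2⟩

theorem neg_one_mem_unitGroup (k : IntermediateField ℚ ℝ) : (-1 : ℝˣ) ∈ unitGroup k := by
  rw [mem_unitGroup_iff]
  refine ⟨?_, ?_, ?_⟩
  · simp
  · simpa using (isIntegral_one (R := ℤ) (B := ℝ)).neg
  · simpa using (isIntegral_one (R := ℤ) (B := ℝ)).neg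

/-- Integrality of `x` and `x⁻¹` follows from that of their squares, so a square root of a unit is a
unit of any field containing it; the field `l` of the square may differ from `k`. -/
theorem mem_unitGroup_of_sq_mem {k : IntermediateField ℚ ℝ} {x : ℝˣ} (hx : (x : ℝ) ∈ k)
    {l : IntermediateField ℚ ℝ} (h : x ^ 2 ∈ unitGroup l) : x ∈ unitGroup k := by
  rw [mem_unitGroup_iff] at h ⊢
  refine ⟨hx, IsIntegral.of_pow two_pos ?_, IsIntegral.of_pow two_pos ?_⟩
  · simpa using h.2.1
  · simpa using h.2.2

theorem sqrt_mem_quadField (d : ℕ) : √(d : ℝ) ∈ quadField d :=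
  IntermediateField.mem_adjoin_simple_self ℚ _

/-- The field `F(√d)`, described by its elements `x + y√d`. -/
def quadExt (F : IntermediateField ℚ ℝ) (d : ℕ) : IntermediateField ℚ ℝ where
  carrier := {z | ∃ x ∈ F, ∃ y ∈ F, z = x + y * √(d : ℝ)}
  mul_mem' := by
    rintro _ _ ⟨x, hx, y, hy, rfl⟩ ⟨x', hx', y', hy', rfl⟩
    refine ⟨x * x' + d * (y * y'), F.add_mem (F.mul_mem hx hx')
      (F.mul_mem (natCast_mem F d) (F.mul_mem hy hy')),
      x * y' + x' * y, F.add_mem (F.mul_mem hx hy') (F.mul_mem hx' hy), ?_⟩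
    have := Real.mul_self_sqrt (Nat.cast_nonneg (α := ℝ) d)
    linear_combination (y * y') * this
  add_mem' := by
    rintro _ _ ⟨x, hx, y, hy, rfl⟩ ⟨x', hx', y', hy', rfl⟩
    exact ⟨x + x', F.add_mem hx hx', y + y', F.add_mem hy hy', by ring⟩
  algebraMap_mem' r := ⟨_, F.algebraMap_mem r, 0, F.zero_mem, by simp⟩
  inv_mem' := by
    rintro _ ⟨x, hx, y, hy, rfl⟩
    have hs := Real.mul_self_sqrt (Nat.cast_nonneg (α := ℝ) d)
    have hn : x ^ 2 - d * y ^ 2 ∈ F :=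
      F.sub_mem (F.pow_mem hx 2) (F.mul_mem (natCast_mem F d) (F.pow_mem hy 2))
    -- The norm form can vanish on a nonzero element because `√d ∈ F` is allowed; the element is
    -- then `0` or `2x`.
    by_cases h : x ^ 2 - d * y ^ 2 = 0
    · have hz : (x + y * √(d : ℝ)) * (x - y * √(d : ℝ)) = 0 := by
        linear_combination h - y ^ 2 * hs
      rcases mul_eq_zero.1 hz with h1 | h1
      · exact ⟨0, F.zero_mem, 0, F.zero_mem, by rw [h1]; simp⟩
      · refine ⟨(x + x)⁻¹, F.inv_mem (F.add_mem hx hx), 0, F.zero_mem, ?_⟩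
        rw [← sub_eq_zero.1 h1]; simp
    · refine ⟨x / (x ^ 2 - d * y ^ 2), F.div_mem hx hn, -y / (x ^ 2 - d * y ^ 2),
        F.div_mem (F.neg_mem hy) hn, ?_⟩
      have hz : (x + y * √(d : ℝ)) * (x - y * √(d : ℝ)) = x ^ 2 - d * y ^ 2 := by
        linear_combination - y ^ 2 * hs
      refine inv_eq_of_mul_eq_one_right ?_
      have : (x + y * √(d : ℝ)) *
          (x / (x ^ 2 - d * y ^ 2) + -y / (x ^ 2 - d * y ^ 2) * √(d : ℝ))
          = ((x + y * √(d : ℝ)) * (x - y * √(d : ℝ))) / (x ^ 2 - d * y ^ 2) := by ring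
      rw [this, hz, div_self h]

theorem sup_quadField_eq (F : IntermediateField ℚ ℝ) (d : ℕ) :
    F ⊔ quadField d = quadExt F d := by
  apply le_antisymm
  · refine sup_le (fun x hx => ⟨x, hx, 0, F.zero_mem, by simp⟩) ?_
    refine IntermediateField.adjoin_le_iff.2 ?_
    rintro _ rfl
    exact ⟨0, F.zero_mem, 1, F.one_mem, by simp⟩
  · rintro _ ⟨x, hx, y, hy, rfl⟩
    exact add_mem (le_sup_left (a := F) hx)
      (mul_mem (le_sup_left (a := F) hy) (le_sup_right (a := F) (sqrt_mem_quadField d)))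

theorem mem_quadField_iff {d : ℕ} {z : ℝ} :
    z ∈ quadField d ↔ ∃ x y : ℚ, z = x + y * √(d : ℝ) := by
  rw [← bot_sup_eq (quadField d), sup_quadField_eq]
  constructor
  · rintro ⟨_, hx, _, hy, rfl⟩
    obtain ⟨x, rfl⟩ := IntermediateField.mem_bot.1 hx
    obtain ⟨y, rfl⟩ := IntermediateField.mem_bot.1 hy
    exact ⟨x, y, rfl⟩
  · rintro ⟨x, y, rfl⟩
    exact ⟨x, IntermediateField.mem_bot.2 ⟨x, rfl⟩, y, IntermediateField.mem_bot.2 ⟨y, rfl⟩, rfl⟩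

/-- A rational number that becomes a square in `F(√a)` is a square in `F`, or is so after
multiplication by `a`. -/
theorem exists_sq_eq_of_mem_sup_quadField {F : IntermediateField ℚ ℝ} {a : ℕ} {z : ℝ}
    (hz : z ∈ F ⊔ quadField a) (hz2 : z ^ 2 ∈ F) :
    (∃ y ∈ F, y ^ 2 = z ^ 2) ∨ ∃ y ∈ F, y ^ 2 = a * z ^ 2 := by
  rw [sup_quadField_eq] at hz
  obtain ⟨x, hx, y, hy, rfl⟩ := hz
  have hs := Real.sq_sqrt (Nat.cast_nonneg (α := ℝ) a)
  by_cases ha : √(a : ℝ) ∈ F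
  · exact .inl ⟨_, F.add_mem hx (F.mul_mem hy ha), rfl⟩
  -- The cross term `2xy√a` of the square lies in `F`, so `xy ≠ 0` would put `√a` in `F`.
  · have hxy : x * y = 0 := by
      by_contra h
      apply ha
      have h2 : √(a : ℝ) = ((x + y * √(a : ℝ)) ^ 2 - x ^ 2 - a * y ^ 2) / (2 * (x * y)) := by
        rw [eq_div_iff (mul_ne_zero two_ne_zero h)]
        linear_combination -y ^ 2 * hs
      rw [h2]
      exact F.div_mem (F.sub_mem (F.sub_mem hz2 (F.pow_mem hx 2))
        (F.mul_mem (natCast_mem F a) (F.pow_mem hy 2)))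
        (F.mul_mem (ofNat_mem F 2) (F.mul_mem hx hy))
    rcases mul_eq_zero.1 hxy with rfl | rfl
    · exact .inr ⟨a * y, F.mul_mem (natCast_mem F a) hy, by
        linear_combination -a * y ^ 2 * hs⟩
    · exact .inl ⟨x, hx, by ring⟩

end Basic

end RealUnits

namespace RealUnits

/-! ### Integral coordinates of units of `ℚ(√d)`. -/

section Quadratic

open Polynomial in
-- For `c ≠ 0` the minimal polynomial over `ℚ` is `X² - 2pX + (p² - dc²)`, and by integral
-- closedness it comes from the one over `ℤ`.
theorem trace_norm_of_isIntegral {d : ℕ} (hd : ¬ IsSquare d) {p c : ℚ}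
    (h : IsIntegral ℤ ((p : ℝ) + c * √(d : ℝ))) :
    ∃ T n : ℤ, 2 * p = T ∧ p ^ 2 - d * c ^ 2 = n := by
  have hs := Real.sq_sqrt (Nat.cast_nonneg (α := ℝ) d)
  by_cases hc : c = 0
  · subst hc
    have h1 : IsIntegral ℤ p := by
      refine (isIntegral_algebraMap_iff (A := ℚ) (B := ℝ) (algebraMap ℚ ℝ).injective).1 ?_
      simpa using h
    obtain ⟨m, rfl⟩ := IsIntegrallyClosed.isIntegral_iff.1 h1
    exact ⟨2 * m, m ^ 2, by simp, by simp⟩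
  · set z : ℝ := (p : ℝ) + c * √(d : ℝ) with hz
    have hirr : Irrational z := by
      have := irrational_sqrt_natCast_iff.2 hd
      exact (this.ratCast_mul hc).ratCast_add p
    obtain ⟨e, he⟩ : ∃ e, p ^ 2 - d * c ^ 2 = e := ⟨_, rfl⟩
    obtain ⟨t, ht⟩ : ∃ t, 2 * p = t := ⟨_, rfl⟩
    set P : ℚ[X] := X ^ 2 - C t * X + C e with hP
    have hPm : P.Monic := by rw [hP]; monicity!
    have hPd : P.natDegree = 2 := by rw [hP]; compute_degree!
    have hPz : aeval z P = 0 := by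
      simp only [hP, map_add, map_sub, map_mul, map_pow, aeval_X, aeval_C, eq_ratCast, ← he, ← ht]
      push_cast
      linear_combination (c : ℝ) ^ 2 * hs
    have hzint : IsIntegral ℚ z := ⟨P, hPm, hPz⟩
    have hdeg : 2 ≤ (minpoly ℚ z).natDegree := by
      rw [minpoly.two_le_natDegree_iff hzint]
      rintro ⟨y, hy⟩
      exact hirr ⟨y, hy⟩
    have heq : minpoly ℚ z = P :=
      (eq_of_monic_of_dvd_of_natDegree_le (minpoly.monic hzint) hPm
        (minpoly.dvd ℚ z hPz) (by omega)).symm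
    have h2 := minpoly.isIntegrallyClosed_eq_field_fractions' ℚ h
    rw [heq] at h2
    have c1 := congrArg (fun Q => Polynomial.coeff Q 1) h2
    have c0 := congrArg (fun Q => Polynomial.coeff Q 0) h2
    simp [hP, coeff_X, coeff_C, coeff_X_pow] at c1 c0
    exact ⟨-(minpoly ℤ z).coeff 1, (minpoly ℤ z).coeff 0, by push_cast; linarith, by rw [he, c0]⟩

/-- The square of the denominator of `y` divides `d`. -/
theorem exists_int_of_squarefree_mul_sq {d : ℕ} (hd : Squarefree d) {y : ℚ} {N : ℤ}
    (h : d * y ^ 2 = N) : ∃ Y : ℤ, y = Y := by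
  have hden : (y.den : ℚ) ≠ 0 := by exact_mod_cast y.den_nz
  have h1 : (d : ℤ) * y.num ^ 2 = N * (y.den : ℤ) ^ 2 := by
    have h2 : (d : ℚ) * (y.num : ℚ) ^ 2 = N * (y.den : ℚ) ^ 2 := by
      rw [← h]
      nth_rewrite 2 [← Rat.num_div_den y]
      field_simp
    exact_mod_cast h2
  have h3 : y.den ^ 2 ∣ d * y.num.natAbs ^ 2 := by
    have := congrArg Int.natAbs h1
    rw [Int.natAbs_mul, Int.natAbs_mul, Int.natAbs_pow, Int.natAbs_pow, Int.natAbs_natCast,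
      Int.natAbs_natCast] at this
    exact ⟨N.natAbs, by rw [this, mul_comm]⟩
  have h4 : y.den ^ 2 ∣ d :=
    (Nat.Coprime.pow 2 2 y.reduced.symm).dvd_of_dvd_mul_right h3
  have h5 : IsUnit y.den := hd _ (by rwa [← sq])
  exact ⟨y.num, (Rat.den_eq_one_iff y).1 (Nat.isUnit_iff.1 h5) |>.symm⟩

/-- Units of `ℚ(√d)` have integral coordinates and norm `±1`. -/
theorem exists_int_of_mem_unitGroup {d : ℕ} (hd : Squarefree d) (hd1 : ¬ IsSquare d)
    (h5 : d % 8 ≠ 5) {u : ℝˣ} (hu : u ∈ unitGroup (quadField d)) :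
    ∃ x y : ℤ, (u : ℝ) = x + y * √(d : ℝ) ∧
      (x ^ 2 - d * y ^ 2 = 1 ∨ x ^ 2 - d * y ^ 2 = -1) := by
  obtain ⟨h1, h2, h3⟩ := mem_unitGroup_iff.1 hu
  obtain ⟨p, c, hpc⟩ := mem_quadField_iff.1 h1
  have hs := Real.sq_sqrt (Nat.cast_nonneg (α := ℝ) d)
  rw [hpc] at h2
  obtain ⟨T, n, hT, hn⟩ := trace_norm_of_isIntegral hd1 h2
  have hnR : (p : ℝ) ^ 2 - d * (c : ℝ) ^ 2 = n := by exact_mod_cast hn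
  have hmul : (u : ℝ) * (p - c * √(d : ℝ)) = n := by
    rw [hpc]; linear_combination hnR - (c : ℝ) ^ 2 * hs
  have hn0 : n ≠ 0 := by
    rintro rfl
    have h0 : (p : ℝ) - c * √(d : ℝ) = 0 := by
      rcases mul_eq_zero.1 (hmul.trans Int.cast_zero) with h | h
      · exact absurd h u.ne_zero
      · exact h
    have hirr := irrational_sqrt_natCast_iff.2 hd1
    by_cases hc : c = 0
    · subst hc
      apply u.ne_zero
      rw [hpc]; simp at h0 ⊢; exact h0
    · exact ((hirr.ratCast_mul hc).ratCast_sub p).ne_zero h0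
  have hn0' : (n : ℚ) ≠ 0 := by exact_mod_cast hn0
  have hinv : ((u⁻¹ : ℝˣ) : ℝ) = ((p / n : ℚ) : ℝ) + ((-c / n : ℚ) : ℝ) * √(d : ℝ) := by
    rw [Units.val_inv_eq_inv_val]
    refine inv_eq_of_mul_eq_one_right ?_
    have hn0R : (n : ℝ) ≠ 0 := by exact_mod_cast hn0
    have : (u : ℝ) * (((p / n : ℚ) : ℝ) + ((-c / n : ℚ) : ℝ) * √(d : ℝ))
      = ((u : ℝ) * (p - c * √(d : ℝ))) / n := by push_cast; ring
    rw [this, hmul, div_self hn0R]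
  rw [hinv] at h3
  obtain ⟨T', n', -, hn'⟩ := trace_norm_of_isIntegral hd1 h3
  have hnn : n * n' = 1 := by
    have : (n : ℚ) * n' = 1 := by
      rw [← hn']
      field_simp
      linear_combination hn
    exact_mod_cast this
  have hn1 : n = 1 ∨ n = -1 := Int.eq_one_or_neg_one_of_mul_eq_one hnn
  -- Here `d (2c)² = T² - 4n` is an integer.
  obtain ⟨Y, hY⟩ : ∃ Y : ℤ, 2 * c = Y := by
    refine exists_int_of_squarefree_mul_sq hd (N := T ^ 2 - 4 * n) ?_
    push_cast
    rw [← hT, ← hn]; ring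
  have hTY : T ^ 2 - d * Y ^ 2 = 4 * n := by
    have : (T : ℚ) ^ 2 - d * Y ^ 2 = 4 * n := by
      rw [← hT, ← hn, ← hY]; ring
    exact_mod_cast this
  have hd4 : d % 4 ≠ 0 := by
    intro h
    have := hd 2 (by omega)
    exact absurd (Nat.isUnit_iff.1 this) (by norm_num)
  -- Since `n = ±1`, `T² - dY² ≡ 4 (mod 8)`. With `4 ∤ d`, an odd coordinate would force both to be
  -- odd and `d ≡ 5 (mod 8)`.
  have hev : T % 2 = 0 ∧ Y % 2 = 0 := by
    have hdm : (d : ℤ) % 8 = 1 ∨ (d : ℤ) % 8 = 2 ∨ (d : ℤ) % 8 = 3 ∨ (d : ℤ) % 8 = 6 ∨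
        (d : ℤ) % 8 = 7 := by omega
    have hmod : (T ^ 2 - d * Y ^ 2) % 8 = 4 := by rw [hTY]; omega
    have hT8 : T % 8 = 0 ∨ T % 8 = 1 ∨ T % 8 = 2 ∨ T % 8 = 3 ∨ T % 8 = 4 ∨ T % 8 = 5 ∨
      T % 8 = 6 ∨ T % 8 = 7 := by omega
    have hY8 : Y % 8 = 0 ∨ Y % 8 = 1 ∨ Y % 8 = 2 ∨ Y % 8 = 3 ∨ Y % 8 = 4 ∨ Y % 8 = 5 ∨
      Y % 8 = 6 ∨ Y % 8 = 7 := by omega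
    have key : ((T % 8) ^ 2 - ((d : ℤ) % 8) * (Y % 8) ^ 2) % 8 = 4 := by
      rw [← hmod]
      exact (((Int.mod_modEq T 8).pow 2).sub
        ((Int.mod_modEq (d : ℤ) 8).mul ((Int.mod_modEq Y 8).pow 2)))
    clear hmod hTY hT hY hn hnR hmul
    rcases hdm with h | h | h | h | h <;> rcases hT8 with h' | h' | h' | h' | h' | h' | h' | h' <;>
      rcases hY8 with h'' | h'' | h'' | h'' | h'' | h'' | h'' | h'' <;>
      rw [h, h', h''] at key <;> omega
  obtain ⟨x, rfl⟩ := Int.dvd_of_emod_eq_zero hev.1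
  obtain ⟨y, rfl⟩ := Int.dvd_of_emod_eq_zero hev.2
  have hp : p = x := by push_cast at hT; linarith
  have hc : c = y := by push_cast at hY; linarith
  refine ⟨x, y, by rw [hpc, hp, hc]; simp, ?_⟩
  have : x ^ 2 - d * y ^ 2 = n :=
    mul_left_cancel₀ (four_ne_zero (α := ℤ)) (by linear_combination hTY)
  rwa [this]

theorem mem_unitGroup_of_int {d : ℕ} {x y : ℤ} {u : ℝˣ} (hu : (u : ℝ) = x + y * √(d : ℝ))
    (h : x ^ 2 - d * y ^ 2 = 1 ∨ x ^ 2 - d * y ^ 2 = -1) : u ∈ unitGroup (quadField d) := by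
  have hs := Real.sq_sqrt (Nat.cast_nonneg (α := ℝ) d)
  have hsi : IsIntegral ℤ √(d : ℝ) := by
    refine IsIntegral.of_pow two_pos ?_
    rw [hs]; exact_mod_cast isIntegral_algebraMap (R := ℤ) (A := ℝ) (x := (d : ℤ))
  have hzint : ∀ m n : ℤ, IsIntegral ℤ ((m : ℝ) + n * √(d : ℝ)) := fun m n =>
    (isIntegral_algebraMap (R := ℤ) (A := ℝ) (x := m)).add
      ((isIntegral_algebraMap (R := ℤ) (A := ℝ) (x := n)).mul hsi)
  rw [mem_unitGroup_iff]
  refine ⟨mem_quadField_iff.2 ⟨x, y, by simpa using hu⟩, hu ▸ hzint x y, ?_⟩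
  rw [Units.val_inv_eq_inv_val]
  rcases h with h | h
  · have hR : (x : ℝ) ^ 2 - d * (y : ℝ) ^ 2 = 1 := by exact_mod_cast h
    have : (u : ℝ)⁻¹ = (x : ℤ) + (-y : ℤ) * √(d : ℝ) := by
      refine inv_eq_of_mul_eq_one_right ?_
      rw [hu]; push_cast; linear_combination hR - (y : ℝ) ^ 2 * hs
    rw [this]; exact hzint _ _
  · have hR : (x : ℝ) ^ 2 - d * (y : ℝ) ^ 2 = -1 := by exact_mod_cast h
    have : (u : ℝ)⁻¹ = (-x : ℤ) + (y : ℤ) * √(d : ℝ) := by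
      refine inv_eq_of_mul_eq_one_right ?_
      rw [hu]; push_cast; linear_combination -hR + (y : ℝ) ^ 2 * hs
    rw [this]; exact hzint _ _

theorem int_coords_unique {d : ℕ} (hd1 : ¬ IsSquare d) {x y x' y' : ℤ}
    (h : (x : ℝ) + y * √(d : ℝ) = x' + y' * √(d : ℝ)) : x = x' ∧ y = y' := by
  have hirr := irrational_sqrt_natCast_iff.2 hd1
  have hy : y = y' := by
    by_contra hne
    have h0 : y - y' ≠ 0 := sub_ne_zero.2 hne
    refine ((hirr.intCast_mul h0).intCast_add (x - x')).ne_zero ?_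
    push_cast; linear_combination h
  subst hy
  exact ⟨by exact_mod_cast add_right_cancel h, rfl⟩

end Quadratic

end RealUnits

namespace RealUnits

/-! ### Existence and basic properties of fundamental units. -/

section FundamentalUnit

/-- `d` is squarefree, not a square and not congruent to `5` modulo `8`, so that the units of
`ℚ(√d)` lie in `ℤ[√d]`. -/
structure Admissible (d : ℕ) : Prop where
  squarefree : Squarefree d
  not_isSquare : ¬ IsSquare d
  mod_ne : d % 8 ≠ 5

theorem Admissible.pos {d : ℕ} (hd : Admissible d) : 0 < d :=
  Nat.pos_of_ne_zero fun h => hd.not_isSquare (h ▸ IsSquare.zero)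

/-- The conjugate times the unit is `±1`, so the conjugate has absolute value below `1`; adding and
subtracting the two gives the signs. -/
theorem pos_coords_of_one_lt {d : ℕ} (hd : Admissible d) {x y : ℤ}
    (h : x ^ 2 - d * y ^ 2 = 1 ∨ x ^ 2 - d * y ^ 2 = -1)
    (h1 : 1 < (x : ℝ) + y * √(d : ℝ)) : 0 < x ∧ 0 < y := by
  have hs := Real.sq_sqrt (Nat.cast_nonneg (α := ℝ) d)
  have hs0 : 0 < √(d : ℝ) := Real.sqrt_pos.2 (by exact_mod_cast hd.pos)
  have hprod : ((x : ℝ) + y * √(d : ℝ)) * (x - y * √(d : ℝ)) = 1 ∨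
      ((x : ℝ) + y * √(d : ℝ)) * (x - y * √(d : ℝ)) = -1 := by
    have e : ((x : ℝ) + y * √(d : ℝ)) * (x - y * √(d : ℝ)) = ((x ^ 2 - d * y ^ 2 : ℤ) : ℝ) := by
      push_cast; linear_combination -(y : ℝ) ^ 2 * hs
    rw [e]
    rcases h with h | h <;> simp [h]
  have hc : |(x : ℝ) - y * √(d : ℝ)| < 1 := by
    have h2 : |(x : ℝ) + y * √(d : ℝ)| * |(x : ℝ) - y * √(d : ℝ)| = 1 := by
      rw [← abs_mul]; rcases hprod with h | h <;> simp [h]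
    have h3 : 1 < |(x : ℝ) + y * √(d : ℝ)| := lt_of_lt_of_le h1 (le_abs_self _)
    by_contra! h4
    nlinarith
  rw [abs_lt] at hc
  constructor
  · have : (0 : ℝ) < x := by linarith
    exact_mod_cast this
  · have : 0 < (y : ℝ) * √(d : ℝ) := by linarith
    exact_mod_cast pos_of_mul_pos_left this hs0.le

/-- Pell's equation supplies a unit `u₀ > 1`. Units in `(1, u₀]` have positive integer coordinates
bounded by `u₀`, so there are finitely many and a smallest one exists. -/
theorem exists_isFundamentalUnit {d : ℕ} (hd : Admissible d) : ∃ u, IsFundamentalUnit d u := by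
  have hs := Real.sq_sqrt (Nat.cast_nonneg (α := ℝ) d)
  have hs1 : 1 ≤ √(d : ℝ) := by
    rw [Real.one_le_sqrt]; exact_mod_cast hd.pos
  obtain ⟨x, y, hxy, hy⟩ := Pell.exists_of_not_isSquare (d := (d : ℤ))
    (by exact_mod_cast hd.pos) (by rw [Int.isSquare_natCast_iff]; exact hd.not_isSquare)
  have hxy' : |x| ^ 2 - d * |y| ^ 2 = 1 := by rw [sq_abs, sq_abs]; exact hxy
  have hx1 : 1 ≤ |x| := by
    by_contra! h
    have h0 : |x| = 0 := by have := abs_nonneg x; omega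
    rw [h0] at hxy'
    have : (0 : ℤ) ≤ d * |y| ^ 2 := by positivity
    linarith
  have hy1 : 1 ≤ |y| := Int.one_le_abs hy
  have hx1' : (1 : ℝ) ≤ (|x| : ℤ) := by exact_mod_cast hx1
  have hy1' : (1 : ℝ) ≤ (|y| : ℤ) := by exact_mod_cast hy1
  have hgt : 1 < ((|x| : ℤ) : ℝ) + (|y| : ℤ) * √(d : ℝ) := by nlinarith
  set u₀ : ℝˣ := Units.mk0 (((|x| : ℤ) : ℝ) + (|y| : ℤ) * √(d : ℝ)) (by linarith) with hu₀
  have hmem : u₀ ∈ unitGroup (quadField d) := mem_unitGroup_of_int (x := |x|) (y := |y|) rfl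
    (.inl hxy')
  set S : Set ℝˣ := {u | u ∈ unitGroup (quadField d) ∧ 1 < (u : ℝ) ∧ (u : ℝ) ≤ u₀} with hS
  have hfin : S.Finite := by
    set B : ℤ := ⌈(u₀ : ℝ)⌉
    have hfin2 : (((fun p : ℤ × ℤ => (p.1 : ℝ) + p.2 * √(d : ℝ)) ''
        (Set.Icc 0 B ×ˢ Set.Icc 0 B))).Finite :=
      ((Set.finite_Icc 0 B).prod (Set.finite_Icc 0 B)).image _
    refine Set.Finite.subset (hfin2.preimage (f := fun u : ℝˣ => (u : ℝ))
      (Units.val_injective.injOn)) ?_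
    rintro u ⟨hu, h1, h2⟩
    obtain ⟨a, b, hab, hn⟩ := exists_int_of_mem_unitGroup hd.squarefree hd.not_isSquare
      hd.mod_ne hu
    rw [hab] at h1 h2
    obtain ⟨ha, hb⟩ := pos_coords_of_one_lt hd hn h1
    have ha' : (0 : ℝ) < a := by exact_mod_cast ha
    have hb' : (0 : ℝ) < b := by exact_mod_cast hb
    have hB := Int.le_ceil (u₀ : ℝ)
    refine ⟨(a, b), ⟨⟨ha.le, ?_⟩, ⟨hb.le, ?_⟩⟩, hab.symm⟩
    · have : (a : ℝ) ≤ B := by nlinarith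
      exact_mod_cast this
    · have : (b : ℝ) ≤ B := by nlinarith
      exact_mod_cast this
  obtain ⟨u, ⟨hu1, hu2, hu3⟩, hmin⟩ := Set.exists_min_image S (fun u : ℝˣ => (u : ℝ)) hfin
    ⟨u₀, hmem, hgt, le_rfl⟩
  refine ⟨u, hu1, hu2, fun v hv hv1 => ?_⟩
  by_cases h : (v : ℝ) ≤ u₀
  · exact hmin v ⟨hv, hv1, h⟩
  · linarith

theorem isFundamentalUnit_fundUnit {d : ℕ} (hd : Admissible d) :
    IsFundamentalUnit d (fundUnit d) := by
  have h := exists_isFundamentalUnit hd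
  rw [fundUnit, dif_pos h]
  exact h.choose_spec

theorem fundUnit_mem {d : ℕ} (hd : Admissible d) : fundUnit d ∈ unitGroup (quadField d) :=
  (isFundamentalUnit_fundUnit hd).1

theorem one_lt_fundUnit {d : ℕ} (hd : Admissible d) : 1 < (fundUnit d : ℝ) :=
  (isFundamentalUnit_fundUnit hd).2.1

theorem fundUnit_pos {d : ℕ} (hd : Admissible d) : 0 < (fundUnit d : ℝ) :=
  one_pos.trans (one_lt_fundUnit hd)

theorem exists_zpow_of_mem_unitGroup {d : ℕ} (hd : Admissible d) {v : ℝˣ}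
    (hv : v ∈ unitGroup (quadField d)) :
    ∃ n : ℤ, v = fundUnit d ^ n ∨ v = -1 * fundUnit d ^ n := by
  obtain ⟨h1, h2, h3⟩ := isFundamentalUnit_fundUnit hd
  have pos_case : ∀ w : ℝˣ, w ∈ unitGroup (quadField d) → 0 < (w : ℝ) →
      ∃ n : ℤ, w = fundUnit d ^ n := by
    intro w hw hw0
    obtain ⟨n, hn1, hn2⟩ := exists_mem_Ico_zpow hw0 h2
    have hεn : (0 : ℝ) < (fundUnit d : ℝ) ^ n := zpow_pos (by linarith) n
    have hmem : w * (fundUnit d ^ n)⁻¹ ∈ unitGroup (quadField d) :=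
      mul_mem hw (inv_mem (zpow_mem h1 n))
    have hval : ((w * (fundUnit d ^ n)⁻¹ : ℝˣ) : ℝ) = (w : ℝ) / (fundUnit d : ℝ) ^ n := by
      push_cast; rw [div_eq_mul_inv]
    refine ⟨n, ?_⟩
    by_contra hne
    have hlt : (fundUnit d : ℝ) ^ n < w := lt_of_le_of_ne hn1 fun h => hne <| by
      apply Units.ext; rw [← h]; push_cast; rfl
    -- The quotient `w / ε^n` would be a unit strictly between `1` and `ε`.
    have h4 := h3 _ hmem (by rw [hval, one_lt_div hεn]; exact hlt)
    rw [hval, le_div_iff₀ hεn] at h4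
    rw [zpow_add_one₀ (fundUnit d).ne_zero] at hn2
    linarith
  rcases lt_or_gt_of_ne v.ne_zero with h | h
  · obtain ⟨n, hn⟩ := pos_case (-1 * v) (mul_mem (neg_one_mem_unitGroup _) hv) (by
      push_cast; linarith)
    exact ⟨n, .inr (by rw [← hn, ← mul_assoc]; simp)⟩
  · obtain ⟨n, hn⟩ := pos_case v hv h
    exact ⟨n, .inl hn⟩

/-- If a prime `p ≡ 3 (mod 4)` divides `d`, then `ε_d` is given by a solution of Pell's equation. -/
theorem fundUnit_coords {d : ℕ} (hd : Admissible d) {p : ℕ} [Fact p.Prime] (hp : p % 4 = 3)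
    (hpd : p ∣ d) : ∃ x y : ℕ, (fundUnit d : ℝ) = x + y * √(d : ℝ) ∧ x ^ 2 = d * y ^ 2 + 1 ∧
      0 < x ∧ 0 < y := by
  obtain ⟨a, b, hab, hn⟩ := exists_int_of_mem_unitGroup hd.squarefree hd.not_isSquare
      hd.mod_ne (fundUnit_mem hd)
  obtain ⟨ha, hb⟩ := pos_coords_of_one_lt hd hn (hab ▸ one_lt_fundUnit hd)
  have hn1 : a ^ 2 - d * b ^ 2 = 1 := by
    -- Norm `-1` would make `-1` a square modulo `p ≡ 3 (mod 4)`.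
    refine hn.resolve_right fun h => ?_
    have h1 : ((a : ZMod p)) ^ 2 = -1 := by
      have := congrArg (Int.cast : ℤ → ZMod p) h
      push_cast at this
      rw [(ZMod.natCast_eq_zero_iff d p).2 hpd] at this
      simpa using this
    exact ZMod.mod_four_ne_three_of_sq_eq_neg_one h1 hp
  lift a to ℕ using ha.le
  lift b to ℕ using hb.le
  refine ⟨a, b, by exact_mod_cast hab, ?_, by exact_mod_cast ha, by exact_mod_cast hb⟩
  zify; linarith

/-- The fundamental unit is not a square in `ℚ(√d)`. -/
theorem fundUnit_ne_sq {d : ℕ} (hd : Admissible d) {w : ℝˣ} (hw : w ∈ unitGroup (quadField d)) :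
    fundUnit d ≠ w ^ 2 := by
  intro h
  have h1 := one_lt_fundUnit hd
  have pos_case : ∀ w : ℝˣ, w ∈ unitGroup (quadField d) → 0 < (w : ℝ) → fundUnit d ≠ w ^ 2 := by
    intro w hw hw0 h
    have h2 : (fundUnit d : ℝ) = (w : ℝ) ^ 2 := by rw [h]; simp
    have h3 : 1 < (w : ℝ) := by nlinarith
    have := (isFundamentalUnit_fundUnit hd).2.2 w hw h3
    nlinarith
  rcases lt_or_gt_of_ne w.ne_zero with h' | h'
  · exact pos_case (-1 * w) (mul_mem (neg_one_mem_unitGroup _) hw) (by push_cast; linarith)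
      (by rw [h, mul_pow]; simp)
  · exact pos_case w hw h' h

theorem admissible_two : Admissible 2 :=
  ⟨Nat.prime_two.squarefree, Nat.prime_two.prime.not_isSquare, by norm_num⟩

/-- `ε₂` has norm `-1`. -/
theorem fundUnit_two_coords : ∃ x y : ℤ, (fundUnit 2 : ℝ) = x + y * √2 ∧
    x ^ 2 - 2 * y ^ 2 = -1 := by
  obtain ⟨a, b, hab, hn⟩ := exists_int_of_mem_unitGroup admissible_two.squarefree
    admissible_two.not_isSquare admissible_two.mod_ne (fundUnit_mem admissible_two)
  push_cast at hab hn
  -- If the norm were `1`, comparison with the unit `1 + √2` would force `a = 1`, hence `b = 0`,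
  -- contradicting `b > 0`.
  refine ⟨a, b, hab, hn.resolve_left fun h => ?_⟩
  have hs := Real.sq_sqrt (show (0 : ℝ) ≤ 2 by norm_num)
  have h0 : (1 : ℝ) + √2 ≠ 0 := by positivity
  have hmem : Units.mk0 _ h0 ∈ unitGroup (quadField 2) :=
    mem_unitGroup_of_int (x := 1) (y := 1) (by simp) (by norm_num)
  have hle := (isFundamentalUnit_fundUnit admissible_two).2.2 _ hmem (by simp)
  obtain ⟨ha, hb⟩ := pos_coords_of_one_lt admissible_two (.inl (by exact_mod_cast h))
    (by rw [← Nat.cast_ofNat] at hab; exact hab ▸ one_lt_fundUnit admissible_two)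
  have ha' : (1 : ℝ) ≤ a := by exact_mod_cast ha
  have hb' : (1 : ℝ) ≤ b := by exact_mod_cast hb
  have hs0 : 0 < √(2 : ℝ) := by positivity
  rw [hab, Units.val_mk0] at hle
  have h1 : a = 1 := by
    have : (a : ℝ) ≤ 1 := by nlinarith
    have : a ≤ 1 := by exact_mod_cast this
    omega
  subst h1
  have : b ^ 2 = 0 := by linarith
  nlinarith

end FundamentalUnit

end RealUnits

namespace RealUnits

/-! ### Square classes of fundamental units from Pell's equation. -/

section SquareClass

/-- The fundamental unit `ε_d` lies in the class of `m` modulo squares of `ℚ(√d)`. -/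
def HasClass (d m : ℕ) : Prop := ∃ w ∈ quadField d, (m : ℝ) * fundUnit d = w ^ 2

/-- Take `m = gcd(d, A)` and `n = gcd(d, B)`. The cofactors of `A` and `B` are coprime with product
`w²`, hence both are squares. -/
theorem exists_of_coprime_mul_eq {A B d w : ℕ} (hAB : A.Coprime B) (hd : d ≠ 0)
    (h : A * B = d * w ^ 2) :
    ∃ m n u v, d = m * n ∧ A = m * u ^ 2 ∧ B = n * v ^ 2 ∧ w = u * v := by
  have hdAB : d = d.gcd A * d.gcd B := by
    rw [← hAB.gcd_mul, h]; simp
  obtain ⟨A', hA'⟩ := Nat.gcd_dvd_right d A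
  obtain ⟨B', hB'⟩ := Nat.gcd_dvd_right d B
  set m := d.gcd A
  set n := d.gcd B
  have h1 : A' * B' = w ^ 2 := by
    refine Nat.eq_of_mul_eq_mul_left (Nat.pos_of_ne_zero hd) ?_
    rw [← h, hA', hB']
    nth_rewrite 1 [hdAB]
    ring
  have hc : A'.Coprime B' := by
    refine Nat.Coprime.of_dvd ?_ ?_ hAB
    · exact ⟨m, by rw [hA']; ring⟩
    · exact ⟨n, by rw [hB']; ring⟩
  obtain ⟨u, hu⟩ := exists_eq_pow_of_mul_eq_pow (Nat.isUnit_iff.2 hc) h1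
  obtain ⟨v, hv⟩ := exists_eq_pow_of_mul_eq_pow (Nat.isUnit_iff.2 hc.symm) (by rw [mul_comm, h1])
  refine ⟨m, n, u, v, hdAB, by rw [hA', hu], by rw [hB', hv], ?_⟩
  have : w ^ 2 = (u * v) ^ 2 := by rw [← h1, hu, hv]; ring
  exact Nat.pow_left_injective two_ne_zero this

/-- For odd `x = 2k + 1` one splits `k(k + 1)`; for even `x` the coprime numbers `x + 1` and `x -
1`. The second case needs `d y² ≡ 3 (mod 4)`, hence `d ≡ 3 (mod 4)`. -/
theorem pell_factor {d x y : ℕ} (h : x ^ 2 = d * y ^ 2 + 1) (hd : d ≠ 0) (hd8 : d % 8 ≠ 0)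
    (hy : 0 < y) :
    (∃ m n u v, d = m * n ∧ m * u ^ 2 = n * v ^ 2 + 1 ∧ x = 2 * (n * v ^ 2) + 1 ∧
      y = 2 * (u * v)) ∨
    (d % 4 = 3 ∧ ∃ m n u v, d = m * n ∧ m * u ^ 2 = n * v ^ 2 + 2 ∧ x = n * v ^ 2 + 1 ∧
      y = u * v) := by
  rcases Nat.even_or_odd' x with ⟨k, rfl | rfl⟩
  · right
    have hk : k ≠ 0 := by
      rintro rfl
      simp at h
    constructor
    · have h4 : (d * y ^ 2) % 4 = 3 := by
        have : (2 * k) ^ 2 = 4 * k ^ 2 := by ring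
        omega
      have hy4 : y % 4 = 0 ∨ y % 4 = 1 ∨ y % 4 = 2 ∨ y % 4 = 3 := by omega
      have hd4 : d % 4 = 0 ∨ d % 4 = 1 ∨ d % 4 = 2 ∨ d % 4 = 3 := by omega
      rw [Nat.mul_mod, Nat.pow_mod] at h4
      rcases hy4 with e | e | e | e <;> rcases hd4 with e' | e' | e' | e' <;>
        rw [e, e'] at h4 <;> omega
    · have hcop : (2 * k + 1).Coprime (2 * k - 1) := by
        have h1 : 2 * k + 1 = (2 * k - 1) + 2 := by omega
        rw [h1, Nat.coprime_self_add_left]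
        rw [Nat.coprime_two_left, Nat.odd_iff]
        omega
      obtain ⟨m, n, u, v, h1, h2, h3, h4⟩ := exists_of_coprime_mul_eq hcop hd (w := y) (by
        obtain ⟨j, rfl⟩ := Nat.exists_eq_succ_of_ne_zero hk
        have : 2 * (j.succ) - 1 = 2 * j + 1 := by omega
        rw [this]
        have : (2 * j.succ) ^ 2 = (2 * j.succ + 1) * (2 * j + 1) + 1 := by
          rw [Nat.succ_eq_add_one]; ring
        omega)
      exact ⟨m, n, u, v, h1, by omega, by omega, h4⟩
  · left
    -- As `x` is odd, `8` divides `x² - 1 = d y²`; an odd `y` would give `8 ∣ d`.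
    have hy2 : y % 2 = 0 := by
      by_contra hy2
      have hy8 : y ^ 2 % 8 = 1 := by
        have : y % 8 = 1 ∨ y % 8 = 3 ∨ y % 8 = 5 ∨ y % 8 = 7 := by omega
        rw [Nat.pow_mod]
        rcases this with e | e | e | e <;> rw [e]
      have h8 : (d * y ^ 2) % 8 = 0 := by
        have h1 : (2 * k + 1) ^ 2 = 4 * (k * (k + 1)) + 1 := by ring
        have h2 : (k * (k + 1)) % 2 = 0 := Nat.even_iff.1 (Nat.even_mul_succ_self k)
        omega
      rw [Nat.mul_mod, hy8] at h8
      omega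
    obtain ⟨w, rfl⟩ := Nat.dvd_of_mod_eq_zero hy2
    have hkk : (k + 1) * k = d * w ^ 2 := by
      have h1 : (2 * k + 1) ^ 2 = 4 * ((k + 1) * k) + 1 := by ring
      have h2 : d * (2 * w) ^ 2 = 4 * (d * w ^ 2) := by ring
      omega
    obtain ⟨m, n, u, v, h1, h2, h3, h4⟩ := exists_of_coprime_mul_eq (by simp) hd hkk
    exact ⟨m, n, u, v, h1, by omega, by omega, by rw [h4]⟩

/-- If `m n = d`, then `(mu + v√d)² = m (mu² + nv² + 2uv√d)`, and the bracket is `ε_d` or `2 ε_d` in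
the two cases. The explicit rational part of `ε_d` is kept for comparison with `a`. -/
theorem fundUnit_class_cases {d : ℕ} (hd : Admissible d) {p : ℕ} [Fact p.Prime] (hp : p % 4 = 3)
    (hpd : p ∣ d) :
    (∃ m n u v : ℕ, m * n = d ∧ m * u ^ 2 = n * v ^ 2 + 1 ∧ m ≠ 1 ∧ HasClass d m ∧
      ∃ y : ℕ, (fundUnit d : ℝ) = (2 * (n * v ^ 2) + 1 : ℕ) + y * √(d : ℝ)) ∨
    (d % 4 = 3 ∧ ∃ m n u v : ℕ, m * n = d ∧ m * u ^ 2 = n * v ^ 2 + 2 ∧ HasClass d (2 * m) ∧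
      ∃ y : ℕ, (fundUnit d : ℝ) = (n * v ^ 2 + 1 : ℕ) + y * √(d : ℝ)) := by
  obtain ⟨x, y, hε, hxy, hx, hy⟩ := fundUnit_coords hd hp hpd
  have hs := Real.sq_sqrt (Nat.cast_nonneg (α := ℝ) d)
  have hd8 : d % 8 ≠ 0 := fun h => by
    have := hd.squarefree 2 (by omega)
    exact absurd (Nat.isUnit_iff.1 this) (by norm_num)
  rcases pell_factor hxy hd.pos.ne' hd8 hy with ⟨m, n, u, v, h1, h2, h3, h4⟩ |
    ⟨hd4, m, n, u, v, h1, h2, h3, h4⟩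
  · left
    have h1R : (d : ℝ) = m * n := by exact_mod_cast h1
    have h2R : (m : ℝ) * u ^ 2 = n * v ^ 2 + 1 := by exact_mod_cast h2
    have hcl : (m : ℝ) * fundUnit d = (m * u + v * √(d : ℝ)) ^ 2 := by
      rw [hε, h3, h4]; push_cast
      linear_combination -(v : ℝ) ^ 2 * hs - (v : ℝ) ^ 2 * h1R - (m : ℝ) * h2R
    refine ⟨m, n, u, v, h1.symm, h2, ?_, ⟨_, ?_, hcl⟩, y, by rw [hε, h3]⟩
    -- With `m = 1` the fundamental unit would be the square of the unit `u + v√d`.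
    · rintro rfl
      have hne : (u : ℝ) + v * √(d : ℝ) ≠ 0 := fun h => by
        have : (fundUnit d : ℝ) = 0 := by
          have h5 := hcl
          simp only [Nat.cast_one, one_mul, h] at h5
          simp at h5
        exact (fundUnit d).ne_zero this
      refine fundUnit_ne_sq hd (w := Units.mk0 _ hne)
        (mem_unitGroup_of_int (x := u) (y := v) (by simp) (.inl ?_)) ?_
      · zify at h1 h2
        rw [h1]; linear_combination h2
      · apply Units.ext
        simpa using hcl
    · exact mem_quadField_iff.2 ⟨m * u, v, by push_cast; rfl⟩
  · right
    have h1R : (d : ℝ) = m * n := by exact_mod_cast h1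
    have h2R : (m : ℝ) * u ^ 2 = n * v ^ 2 + 2 := by exact_mod_cast h2
    have hcl : ((2 * m : ℕ) : ℝ) * fundUnit d = (m * u + v * √(d : ℝ)) ^ 2 := by
      rw [hε, h3, h4]; push_cast
      linear_combination -(v : ℝ) ^ 2 * hs - (v : ℝ) ^ 2 * h1R - (m : ℝ) * h2R
    exact ⟨hd4, m, n, u, v, h1.symm, h2,
      ⟨_, mem_quadField_iff.2 ⟨m * u, v, by push_cast; rfl⟩, hcl⟩, y, by rw [hε, h3]⟩

/-- Modulo a prime dividing `n` the equation gives `c m = (m u)²`. -/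
theorem legendreSym_ne_of_dvd {p : ℕ} [Fact p.Prime] {m n u v c : ℤ}
    (h : m * u ^ 2 = n * v ^ 2 + c) (hp : (p : ℤ) ∣ n) (hl : legendreSym p (c * m) = -1) :
    False := by
  rw [legendreSym.eq_neg_one_iff] at hl
  apply hl
  refine ⟨m * u, ?_⟩
  have h1 := congrArg (Int.cast : ℤ → ZMod p) h
  push_cast at h1 ⊢
  rw [(ZMod.intCast_zmod_eq_zero_iff_dvd n p).2 hp] at h1
  linear_combination -(m : ZMod p) * h1

theorem false_of_legendreSym_left {p : ℕ} [Fact p.Prime] {m n u v c : ℕ}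
    (h : m * u ^ 2 = n * v ^ 2 + c) (hp : p ∣ n) (hl : legendreSym p ((c * m : ℕ) : ℤ) = -1) :
    False :=
  legendreSym_ne_of_dvd (m := m) (n := n) (u := u) (v := v) (c := c) (by exact_mod_cast h)
    (by exact_mod_cast hp) (by exact_mod_cast hl)

theorem false_of_legendreSym_right {p : ℕ} [Fact p.Prime] {m n u v c : ℕ}
    (h : m * u ^ 2 = n * v ^ 2 + c) (hp : p ∣ m)
    (hl : legendreSym p (-1 * (c * n : ℕ)) = -1) : False := by
  refine legendreSym_ne_of_dvd (p := p) (m := -n) (n := -m) (u := v) (v := u) (c := c) ?_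
    ((Int.natCast_dvd_natCast.2 hp).neg_right) (by rw [← hl]; push_cast; ring_nf)
  zify at h; linear_combination h

theorem split_of_prime_mul_eq {p m n k : ℕ} (hp : p.Prime) (h : m * n = p * k) :
    (∃ m', m = p * m' ∧ m' * n = k) ∨ (∃ n', n = p * n' ∧ m * n' = k) := by
  rcases hp.dvd_mul.1 ⟨k, h⟩ with ⟨m', rfl⟩ | ⟨n', rfl⟩
  · exact .inl ⟨m', rfl, Nat.eq_of_mul_eq_mul_left hp.pos (by rw [← h]; ring)⟩
  · exact .inr ⟨n', rfl, Nat.eq_of_mul_eq_mul_left hp.pos (by rw [← h]; ring)⟩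

end SquareClass

end RealUnits

namespace RealUnits

/-! ### Elimination of factorizations by Legendre symbols. -/

section PrimeTriple

/-- The arithmetic hypotheses on `q, r, s`, with `e` the common value of `(q/r)` and `(q/s)`. -/
structure PrimeTriple (e : ℤ) (q r s : ℕ) [Fact q.Prime] [Fact r.Prime] [Fact s.Prime] :
    Prop where
  hq : q % 8 = 7
  hr : r % 8 = 3
  hs : s % 8 = 3
  qr : q ≠ r
  qs : q ≠ s
  rs : r ≠ s
  leg_r_q : legendreSym r q = e
  leg_s_q : legendreSym s q = e
  leg_r_s : legendreSym r s = 1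

theorem legendreSym_two_of_mod_eight {p : ℕ} [Fact p.Prime] (h : p % 8 = 3 ∨ p % 8 = 7) :
    legendreSym p 2 = if p % 8 = 7 then 1 else -1 := by
  rw [legendreSym.at_two (by rintro rfl; omega), ZMod.χ₈_nat_eq_if_mod_eight]
  rcases h with h | h <;> simp [h] <;> omega

theorem legendreSym_neg_one_of_mod_four {p : ℕ} [Fact p.Prime] (h : p % 4 = 3) :
    legendreSym p (-1) = -1 := by
  rw [legendreSym.at_neg_one (by rintro rfl; omega), ZMod.χ₄_nat_three_mod_four h]

theorem admissible_of_squarefree {d : ℕ} (h : Squarefree d) (h1 : d ≠ 1) (h5 : d % 8 ≠ 5) :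
    Admissible d := by
  refine ⟨h, ?_, h5⟩
  rintro ⟨a, rfl⟩
  have := Nat.isUnit_iff.1 (h a dvd_rfl)
  subst this
  exact h1 rfl

variable {e : ℤ} {q r s : ℕ} [Fact q.Prime] [Fact r.Prime] [Fact s.Prime]

namespace PrimeTriple

theorem prime_q (_ : PrimeTriple e q r s) : q.Prime := Fact.out
theorem prime_r (_ : PrimeTriple e q r s) : r.Prime := Fact.out
theorem prime_s (_ : PrimeTriple e q r s) : s.Prime := Fact.out

theorem leg_q_two (h : PrimeTriple e q r s) : legendreSym q 2 = 1 := by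
  rw [legendreSym_two_of_mod_eight (.inr h.hq), if_pos h.hq]
theorem leg_r_two (h : PrimeTriple e q r s) : legendreSym r 2 = -1 := by
  rw [legendreSym_two_of_mod_eight (.inl h.hr), if_neg (by have := h.hr; omega)]
theorem leg_s_two (h : PrimeTriple e q r s) : legendreSym s 2 = -1 := by
  rw [legendreSym_two_of_mod_eight (.inl h.hs), if_neg (by have := h.hs; omega)]
theorem leg_q_neg (h : PrimeTriple e q r s) : legendreSym q (-1) = -1 :=
  legendreSym_neg_one_of_mod_four (by have := h.hq; omega)
theorem leg_r_neg (h : PrimeTriple e q r s) : legendreSym r (-1) = -1 :=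
  legendreSym_neg_one_of_mod_four (by have := h.hr; omega)
theorem leg_s_neg (h : PrimeTriple e q r s) : legendreSym s (-1) = -1 :=
  legendreSym_neg_one_of_mod_four (by have := h.hs; omega)
theorem leg_s_r (h : PrimeTriple e q r s) : legendreSym s r = -1 := by
  rw [legendreSym.quadratic_reciprocity_three_mod_four (by have := h.hr; omega)
    (by have := h.hs; omega), h.leg_r_s]
theorem leg_q_r (h : PrimeTriple e q r s) : legendreSym q r = -e := by
  rw [legendreSym.quadratic_reciprocity_three_mod_four (by have := h.hr; omega)
    (by have := h.hq; omega), h.leg_r_q]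
theorem leg_q_s (h : PrimeTriple e q r s) : legendreSym q s = -e := by
  rw [legendreSym.quadratic_reciprocity_three_mod_four (by have := h.hs; omega)
    (by have := h.hq; omega), h.leg_s_q]

theorem two_ne_q (h : PrimeTriple e q r s) : 2 ≠ q := by rintro rfl; have := h.hq; omega
theorem two_ne_r (h : PrimeTriple e q r s) : 2 ≠ r := by rintro rfl; have := h.hr; omega
theorem two_ne_s (h : PrimeTriple e q r s) : 2 ≠ s := by rintro rfl; have := h.hs; omega

theorem squarefree_two_qrs (h : PrimeTriple e q r s) : Squarefree (2 * q * r * s) := by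
  have c := fun {a b : ℕ} (ha : a.Prime) (hb : b.Prime) (hne : a ≠ b) =>
    (Nat.coprime_primes ha hb).2 hne
  have h2q := c Nat.prime_two h.prime_q h.two_ne_q
  have h2r := c Nat.prime_two h.prime_r h.two_ne_r
  have h2s := c Nat.prime_two h.prime_s h.two_ne_s
  have hqr := c h.prime_q h.prime_r h.qr
  have hqs := c h.prime_q h.prime_s h.qs
  have hrs := c h.prime_r h.prime_s h.rs
  rw [Nat.squarefree_mul ((h2s.mul_left hqs).mul_left hrs), Nat.squarefree_mul (h2r.mul_left hqr),
    Nat.squarefree_mul h2q]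
  exact ⟨⟨⟨Nat.prime_two.squarefree, h.prime_q.squarefree⟩, h.prime_r.squarefree⟩,
    h.prime_s.squarefree⟩

theorem admissible_of_dvd (h : PrimeTriple e q r s) {d : ℕ} (hd : d ∣ 2 * q * r * s) (h1 : d ≠ 1)
    (h5 : d % 8 ≠ 5) : Admissible d :=
  admissible_of_squarefree (h.squarefree_two_qrs.squarefree_of_dvd hd) h1 h5

theorem admissible_q (h : PrimeTriple e q r s) : Admissible q :=
  h.admissible_of_dvd ⟨2 * r * s, by ring⟩ h.prime_q.one_lt.ne' (by have := h.hq; omega)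

theorem admissible_two_q (h : PrimeTriple e q r s) : Admissible (2 * q) :=
  h.admissible_of_dvd ⟨r * s, by ring⟩ (by omega) (by omega)

theorem admissible_rs (h : PrimeTriple e q r s) : Admissible (r * s) :=
  h.admissible_of_dvd ⟨2 * q, by ring⟩
    (fun h' => h.prime_r.one_lt.ne' (Nat.eq_one_of_mul_eq_one_right h'))
    (by simp [Nat.mul_mod, h.hr, h.hs])

theorem admissible_two_rs (h : PrimeTriple e q r s) : Admissible (2 * r * s) :=
  h.admissible_of_dvd ⟨q, by ring⟩ (by rw [mul_assoc]; omega) (by rw [mul_assoc]; omega)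

theorem admissible_qrs (h : PrimeTriple e q r s) : Admissible (1 * q * r * s) :=
  h.admissible_of_dvd ⟨2, by ring⟩
    (fun h' => h.prime_s.one_lt.ne' (Nat.eq_one_of_mul_eq_one_left h'))
    (by simp [Nat.mul_mod, h.hq, h.hr, h.hs])

theorem admissible_two_qrs (h : PrimeTriple e q r s) : Admissible (2 * q * r * s) :=
  h.admissible_of_dvd dvd_rfl (by simp only [mul_assoc]; omega) (by simp only [mul_assoc]; omega)

set_option linter.unusedSimpArgs false

/-- For a solution of `m u² - n v² = c`, no Legendre symbol at `q`, `r` or `s` obstructs. -/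
theorem legendre_obstruction (q r s : ℕ) [Fact q.Prime] [Fact r.Prime] [Fact s.Prime]
    {m n u v c : ℕ} (h1 : m * u ^ 2 = n * v ^ 2 + c) :
    (q ∣ n → legendreSym q ((c * m : ℕ) : ℤ) ≠ -1) ∧
    (q ∣ m → legendreSym q (-1 * (c * n : ℕ)) ≠ -1) ∧
    (r ∣ n → legendreSym r ((c * m : ℕ) : ℤ) ≠ -1) ∧
    (r ∣ m → legendreSym r (-1 * (c * n : ℕ)) ≠ -1) ∧
    (s ∣ n → legendreSym s ((c * m : ℕ) : ℤ) ≠ -1) ∧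
    (s ∣ m → legendreSym s (-1 * (c * n : ℕ)) ≠ -1) :=
  ⟨fun a b => false_of_legendreSym_left h1 a b, fun a b => false_of_legendreSym_right h1 a b,
    fun a b => false_of_legendreSym_left h1 a b, fun a b => false_of_legendreSym_right h1 a b,
    fun a b => false_of_legendreSym_left h1 a b, fun a b => false_of_legendreSym_right h1 a b⟩

/-- This and the following factor lemmas share one scheme: run through all divisors `m` of `d` and
discard those for which some symbol at `q`, `r` or `s` is `-1`; what survives is the conclusion. -/
theorem factor_q_one (h : PrimeTriple e q r s) {m n u v : ℕ} (hmn : m * n = q)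
    (h1 : m * u ^ 2 = n * v ^ 2 + 1) : m = 1 := by
  have ob := legendre_obstruction q r s h1
  rw [← mul_one q] at hmn
  rcases split_of_prime_mul_eq h.prime_q hmn with ⟨m, rfl, hmn₁⟩ | ⟨n, rfl, hmn₁⟩ <;>
  obtain ⟨rfl, rfl⟩ := mul_eq_one.1 hmn₁ <;>
  simp only [Nat.cast_mul, Nat.cast_ofNat, Nat.cast_one, legendreSym.mul, legendreSym.at_one,
    h.leg_q_two, h.leg_r_two, h.leg_s_two, h.leg_q_neg, h.leg_r_neg, h.leg_s_neg, h.leg_q_r,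
    h.leg_q_s, h.leg_r_q, h.leg_r_s, h.leg_s_q, h.leg_s_r] at ob <;>
  first | (norm_num [Dvd.dvd.mul_left] at ob; done) | norm_num

theorem factor_q_two (h : PrimeTriple e q r s) {m n u v : ℕ} (hmn : m * n = q)
    (h1 : m * u ^ 2 = n * v ^ 2 + 2) : m = 1 := by
  have ob := legendre_obstruction q r s h1
  rw [← mul_one q] at hmn
  rcases split_of_prime_mul_eq h.prime_q hmn with ⟨m, rfl, hmn₁⟩ | ⟨n, rfl, hmn₁⟩ <;>
  obtain ⟨rfl, rfl⟩ := mul_eq_one.1 hmn₁ <;>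
  simp only [Nat.cast_mul, Nat.cast_ofNat, Nat.cast_one, legendreSym.mul, legendreSym.at_one,
    h.leg_q_two, h.leg_r_two, h.leg_s_two, h.leg_q_neg, h.leg_r_neg, h.leg_s_neg, h.leg_q_r,
    h.leg_q_s, h.leg_r_q, h.leg_r_s, h.leg_s_q, h.leg_s_r] at ob <;>
  first | (norm_num [Dvd.dvd.mul_left] at ob; done) | norm_num

theorem factor_two_q (h : PrimeTriple e q r s) {m n u v : ℕ} (hmn : m * n = 2 * q)
    (h1 : m * u ^ 2 = n * v ^ 2 + 1)
    (h2 : m ≠ 1) : m = 2 := by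
  have ob := legendre_obstruction q r s h1
  rw [← mul_one q] at hmn
  rcases split_of_prime_mul_eq Nat.prime_two hmn with ⟨m, rfl, hmn₁⟩ | ⟨n, rfl, hmn₁⟩ <;>
  rcases split_of_prime_mul_eq h.prime_q hmn₁ with ⟨m, rfl, hmn₂⟩ | ⟨n, rfl, hmn₂⟩ <;>
  obtain ⟨rfl, rfl⟩ := mul_eq_one.1 hmn₂ <;>
  simp only [Nat.cast_mul, Nat.cast_ofNat, Nat.cast_one, legendreSym.mul, legendreSym.at_one,
    h.leg_q_two, h.leg_r_two, h.leg_s_two, h.leg_q_neg, h.leg_r_neg, h.leg_s_neg, h.leg_q_r,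
    h.leg_q_s, h.leg_r_q, h.leg_r_s, h.leg_s_q, h.leg_s_r] at ob <;>
  first | (norm_num [Dvd.dvd.mul_left] at ob; done) | (norm_num at h2; done) | norm_num

theorem factor_rs (h : PrimeTriple e q r s) {m n u v : ℕ} (hmn : m * n = r * s)
    (h1 : m * u ^ 2 = n * v ^ 2 + 1)
    (h2 : m ≠ 1) : m = s := by
  have ob := legendre_obstruction q r s h1
  rw [← mul_one s] at hmn
  rcases split_of_prime_mul_eq h.prime_r hmn with ⟨m, rfl, hmn₁⟩ | ⟨n, rfl, hmn₁⟩ <;>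
  rcases split_of_prime_mul_eq h.prime_s hmn₁ with ⟨m, rfl, hmn₂⟩ | ⟨n, rfl, hmn₂⟩ <;>
  obtain ⟨rfl, rfl⟩ := mul_eq_one.1 hmn₂ <;>
  simp only [Nat.cast_mul, Nat.cast_ofNat, Nat.cast_one, legendreSym.mul, legendreSym.at_one,
    h.leg_q_two, h.leg_r_two, h.leg_s_two, h.leg_q_neg, h.leg_r_neg, h.leg_s_neg, h.leg_q_r,
    h.leg_q_s, h.leg_r_q, h.leg_r_s, h.leg_s_q, h.leg_s_r] at ob <;>
  first | (norm_num [Dvd.dvd.mul_left] at ob; done) | (norm_num at h2; done) | norm_num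

theorem factor_two_rs (h : PrimeTriple e q r s) {m n u v : ℕ} (hmn : m * n = 2 * r * s)
    (h1 : m * u ^ 2 = n * v ^ 2 + 1)
    (h2 : m ≠ 1) : m = r * s := by
  have ob := legendre_obstruction q r s h1
  rw [mul_assoc, ← mul_one s] at hmn
  rcases split_of_prime_mul_eq Nat.prime_two hmn with ⟨m, rfl, hmn₁⟩ | ⟨n, rfl, hmn₁⟩ <;>
  rcases split_of_prime_mul_eq h.prime_r hmn₁ with ⟨m, rfl, hmn₂⟩ | ⟨n, rfl, hmn₂⟩ <;>
  rcases split_of_prime_mul_eq h.prime_s hmn₂ with ⟨m, rfl, hmn₃⟩ | ⟨n, rfl, hmn₃⟩ <;>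
  obtain ⟨rfl, rfl⟩ := mul_eq_one.1 hmn₃ <;>
  simp only [Nat.cast_mul, Nat.cast_ofNat, Nat.cast_one, legendreSym.mul, legendreSym.at_one,
    h.leg_q_two, h.leg_r_two, h.leg_s_two, h.leg_q_neg, h.leg_r_neg, h.leg_s_neg, h.leg_q_r,
    h.leg_q_s, h.leg_r_q, h.leg_r_s, h.leg_s_q, h.leg_s_r] at ob <;>
  first | (norm_num [Dvd.dvd.mul_left] at ob; done) | (norm_num at h2; done) | norm_num

theorem factor_two_qrs_pos (h : PrimeTriple 1 q r s) {m n u v : ℕ} (hmn : m * n = 2 * q * r * s)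
    (h1 : m * u ^ 2 = n * v ^ 2 + 1)
    (h2 : m ≠ 1) : m = r * s := by
  have ob := legendre_obstruction q r s h1
  rw [mul_assoc, mul_assoc, ← mul_one s] at hmn
  rcases split_of_prime_mul_eq Nat.prime_two hmn with ⟨m, rfl, hmn₁⟩ | ⟨n, rfl, hmn₁⟩ <;>
  rcases split_of_prime_mul_eq h.prime_q hmn₁ with ⟨m, rfl, hmn₂⟩ | ⟨n, rfl, hmn₂⟩ <;>
  rcases split_of_prime_mul_eq h.prime_r hmn₂ with ⟨m, rfl, hmn₃⟩ | ⟨n, rfl, hmn₃⟩ <;>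
  rcases split_of_prime_mul_eq h.prime_s hmn₃ with ⟨m, rfl, hmn₄⟩ | ⟨n, rfl, hmn₄⟩ <;>
  obtain ⟨rfl, rfl⟩ := mul_eq_one.1 hmn₄ <;>
  simp only [Nat.cast_mul, Nat.cast_ofNat, Nat.cast_one, legendreSym.mul, legendreSym.at_one,
    h.leg_q_two, h.leg_r_two, h.leg_s_two, h.leg_q_neg, h.leg_r_neg, h.leg_s_neg, h.leg_q_r,
    h.leg_q_s, h.leg_r_q, h.leg_r_s, h.leg_s_q, h.leg_s_r] at ob <;>
  first | (norm_num [Dvd.dvd.mul_left] at ob; done) | (norm_num at h2; done) | norm_num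

theorem factor_qrs_neg_one (h : PrimeTriple (-1) q r s) {m n u v : ℕ} (hmn : m * n = q * r * s)
    (h1 : m * u ^ 2 = n * v ^ 2 + 1)
    (h2 : m ≠ 1) : m = r * s := by
  have ob := legendre_obstruction q r s h1
  rw [mul_assoc, ← mul_one s] at hmn
  rcases split_of_prime_mul_eq h.prime_q hmn with ⟨m, rfl, hmn₁⟩ | ⟨n, rfl, hmn₁⟩ <;>
  rcases split_of_prime_mul_eq h.prime_r hmn₁ with ⟨m, rfl, hmn₂⟩ | ⟨n, rfl, hmn₂⟩ <;>
  rcases split_of_prime_mul_eq h.prime_s hmn₂ with ⟨m, rfl, hmn₃⟩ | ⟨n, rfl, hmn₃⟩ <;>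
  obtain ⟨rfl, rfl⟩ := mul_eq_one.1 hmn₃ <;>
  simp only [Nat.cast_mul, Nat.cast_ofNat, Nat.cast_one, legendreSym.mul, legendreSym.at_one,
    h.leg_q_two, h.leg_r_two, h.leg_s_two, h.leg_q_neg, h.leg_r_neg, h.leg_s_neg, h.leg_q_r,
    h.leg_q_s, h.leg_r_q, h.leg_r_s, h.leg_s_q, h.leg_s_r] at ob <;>
  first | (norm_num [Dvd.dvd.mul_left] at ob; done) | (norm_num at h2; done) | norm_num

theorem factor_qrs_neg_two (h : PrimeTriple (-1) q r s) {m n u v : ℕ} (hmn : m * n = q * r * s)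
    (h1 : m * u ^ 2 = n * v ^ 2 + 2) : False := by
  have ob := legendre_obstruction q r s h1
  rw [mul_assoc, ← mul_one s] at hmn
  rcases split_of_prime_mul_eq h.prime_q hmn with ⟨m, rfl, hmn₁⟩ | ⟨n, rfl, hmn₁⟩ <;>
  rcases split_of_prime_mul_eq h.prime_r hmn₁ with ⟨m, rfl, hmn₂⟩ | ⟨n, rfl, hmn₂⟩ <;>
  rcases split_of_prime_mul_eq h.prime_s hmn₂ with ⟨m, rfl, hmn₃⟩ | ⟨n, rfl, hmn₃⟩ <;>
  obtain ⟨rfl, rfl⟩ := mul_eq_one.1 hmn₃ <;>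
  simp only [Nat.cast_mul, Nat.cast_ofNat, Nat.cast_one, legendreSym.mul, legendreSym.at_one,
    h.leg_q_two, h.leg_r_two, h.leg_s_two, h.leg_q_neg, h.leg_r_neg, h.leg_s_neg, h.leg_q_r,
    h.leg_q_s, h.leg_r_q, h.leg_r_s, h.leg_s_q, h.leg_s_r] at ob <;>
  norm_num [Dvd.dvd.mul_left] at ob

theorem factor_qrs_pos_one (h : PrimeTriple 1 q r s) {m n u v : ℕ} (hmn : m * n = q * r * s)
    (h1 : m * u ^ 2 = n * v ^ 2 + 1)
    (h2 : m ≠ 1) : m = q * s := by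
  have ob := legendre_obstruction q r s h1
  rw [mul_assoc, ← mul_one s] at hmn
  rcases split_of_prime_mul_eq h.prime_q hmn with ⟨m, rfl, hmn₁⟩ | ⟨n, rfl, hmn₁⟩ <;>
  rcases split_of_prime_mul_eq h.prime_r hmn₁ with ⟨m, rfl, hmn₂⟩ | ⟨n, rfl, hmn₂⟩ <;>
  rcases split_of_prime_mul_eq h.prime_s hmn₂ with ⟨m, rfl, hmn₃⟩ | ⟨n, rfl, hmn₃⟩ <;>
  obtain ⟨rfl, rfl⟩ := mul_eq_one.1 hmn₃ <;>
  simp only [Nat.cast_mul, Nat.cast_ofNat, Nat.cast_one, legendreSym.mul, legendreSym.at_one,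
    h.leg_q_two, h.leg_r_two, h.leg_s_two, h.leg_q_neg, h.leg_r_neg, h.leg_s_neg, h.leg_q_r,
    h.leg_q_s, h.leg_r_q, h.leg_r_s, h.leg_s_q, h.leg_s_r] at ob <;>
  first | (norm_num [Dvd.dvd.mul_left] at ob; done) | (norm_num at h2; done) | norm_num

/-- Two factorizations pass all symbols. In the one with `n = q`, `r` and `s` both divide `m`; the
cofactor is recorded because it is what the assumption on `a - 1` excludes. -/
theorem factor_qrs_pos_two (h : PrimeTriple 1 q r s) {m n u v : ℕ} (hmn : m * n = q * r * s)
    (h1 : m * u ^ 2 = n * v ^ 2 + 2) : (m = r * s ∧ n = q) ∨ m = q * r := by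
  have ob := legendre_obstruction q r s h1
  rw [mul_assoc, ← mul_one s] at hmn
  rcases split_of_prime_mul_eq h.prime_q hmn with ⟨m, rfl, hmn₁⟩ | ⟨n, rfl, hmn₁⟩ <;>
  rcases split_of_prime_mul_eq h.prime_r hmn₁ with ⟨m, rfl, hmn₂⟩ | ⟨n, rfl, hmn₂⟩ <;>
  rcases split_of_prime_mul_eq h.prime_s hmn₂ with ⟨m, rfl, hmn₃⟩ | ⟨n, rfl, hmn₃⟩ <;>
  obtain ⟨rfl, rfl⟩ := mul_eq_one.1 hmn₃ <;>
  simp only [Nat.cast_mul, Nat.cast_ofNat, Nat.cast_one, legendreSym.mul, legendreSym.at_one,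
    h.leg_q_two, h.leg_r_two, h.leg_s_two, h.leg_q_neg, h.leg_r_neg, h.leg_s_neg, h.leg_q_r,
    h.leg_q_s, h.leg_r_q, h.leg_r_s, h.leg_s_q, h.leg_s_r] at ob <;>
  first | (norm_num [Dvd.dvd.mul_left] at ob; done) | norm_num

/-- Again the unwanted survivor is the one with `n = q`, so its cofactor is recorded. -/
theorem factor_two_qrs_neg (h : PrimeTriple (-1) q r s) {m n u v : ℕ} (hmn : m * n = 2 * q * r * s)
    (h1 : m * u ^ 2 = n * v ^ 2 + 1)
    (h2 : m ≠ 1) : m = 2 * r ∨ m = s ∨ (m = 2 * (r * s) ∧ n = q) := by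
  have ob := legendre_obstruction q r s h1
  rw [mul_assoc, mul_assoc, ← mul_one s] at hmn
  rcases split_of_prime_mul_eq Nat.prime_two hmn with ⟨m, rfl, hmn₁⟩ | ⟨n, rfl, hmn₁⟩ <;>
  rcases split_of_prime_mul_eq h.prime_q hmn₁ with ⟨m, rfl, hmn₂⟩ | ⟨n, rfl, hmn₂⟩ <;>
  rcases split_of_prime_mul_eq h.prime_r hmn₂ with ⟨m, rfl, hmn₃⟩ | ⟨n, rfl, hmn₃⟩ <;>
  rcases split_of_prime_mul_eq h.prime_s hmn₃ with ⟨m, rfl, hmn₄⟩ | ⟨n, rfl, hmn₄⟩ <;>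
  obtain ⟨rfl, rfl⟩ := mul_eq_one.1 hmn₄ <;>
  simp only [Nat.cast_mul, Nat.cast_ofNat, Nat.cast_one, legendreSym.mul, legendreSym.at_one,
    h.leg_q_two, h.leg_r_two, h.leg_s_two, h.leg_q_neg, h.leg_r_neg, h.leg_s_neg, h.leg_q_r,
    h.leg_q_s, h.leg_r_q, h.leg_r_s, h.leg_s_q, h.leg_s_r] at ob <;>
  first | (norm_num [Dvd.dvd.mul_left] at ob; done) | (norm_num at h2; done) | norm_num

theorem hasClass_q (h : PrimeTriple e q r s) : HasClass q 2 := by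
  rcases fundUnit_class_cases h.admissible_q (p := q) (by have := h.hq; omega) dvd_rfl with
    ⟨m, n, u, v, hmn, h1, h2, -⟩ | ⟨-, m, n, u, v, hmn, h1, h3, -⟩
  · exact absurd (h.factor_q_one hmn h1) h2
  · rwa [h.factor_q_two hmn h1] at h3

theorem hasClass_two_q (h : PrimeTriple e q r s) : HasClass (2 * q) 2 := by
  rcases fundUnit_class_cases h.admissible_two_q (p := q) (by have := h.hq; omega)
    (dvd_mul_left q 2) with ⟨m, n, u, v, hmn, h1, h2, h3, -⟩ | ⟨hmod, -⟩
  · rwa [h.factor_two_q hmn h1 h2] at h3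
  · omega

theorem hasClass_rs (h : PrimeTriple e q r s) : HasClass (r * s) s := by
  rcases fundUnit_class_cases h.admissible_rs (p := r) (by have := h.hr; omega)
    (dvd_mul_right r s) with ⟨m, n, u, v, hmn, h1, h2, h3, -⟩ | ⟨hmod, -⟩
  · rwa [h.factor_rs hmn h1 h2] at h3
  · have : (r * s) % 8 = 1 := by simp [Nat.mul_mod, h.hr, h.hs]
    omega

theorem hasClass_two_rs (h : PrimeTriple e q r s) : HasClass (2 * r * s) (r * s) := by
  rcases fundUnit_class_cases h.admissible_two_rs (p := r) (by have := h.hr; omega)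
    ⟨2 * s, by ring⟩ with ⟨m, n, u, v, hmn, h1, h2, h3, -⟩ | ⟨hmod, -⟩
  · rwa [h.factor_two_rs hmn h1 h2] at h3
  · rw [mul_assoc] at hmod; omega

theorem hasClass_two_qrs_of_pos (h : PrimeTriple 1 q r s) :
    HasClass (2 * q * r * s) (r * s) := by
  rcases fundUnit_class_cases h.admissible_two_qrs (p := r) (by have := h.hr; omega)
    ⟨2 * q * s, by ring⟩ with ⟨m, n, u, v, hmn, h1, h2, h3, -⟩ | ⟨hmod, -⟩
  · rwa [h.factor_two_qrs_pos hmn h1 h2] at h3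
  · simp only [mul_assoc] at hmod; omega

theorem hasClass_qrs_of_neg (h : PrimeTriple (-1) q r s) :
    HasClass (1 * q * r * s) (r * s) := by
  rcases fundUnit_class_cases h.admissible_qrs (p := r) (by have := h.hr; omega)
    ⟨1 * q * s, by ring⟩ with ⟨m, n, u, v, hmn, h1, h2, h3, -⟩ | ⟨-, m, n, u, v, hmn, h1, -⟩
  · rwa [h.factor_qrs_neg_one (by rw [hmn, one_mul]) h1 h2] at h3
  · exact (h.factor_qrs_neg_two (by rw [hmn, one_mul]) h1).elim

/-- The oddness of `k + l` says that exactly one of `r, s` occurs in the class to an odd power, as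
it does in the class `s` of `ε_{rs}`; this is what makes `√(ε_{rs} ε_{qrs})` lie in the field. -/
theorem hasClass_qrs_of_pos (h : PrimeTriple 1 q r s) {a b : ℤ}
    (hab : (fundUnit (1 * q * r * s) : ℝ) = a + b * √((1 * q * r * s : ℕ) : ℝ))
    (hsq : ¬ ∃ m : ℕ, q * (a - 1) = (m : ℤ) ^ 2) :
    ∃ i j k l : ℕ, HasClass (1 * q * r * s) (2 ^ i * q ^ j * r ^ k * s ^ l) ∧ Odd (k + l) := by
  rcases fundUnit_class_cases h.admissible_qrs (p := r) (by have := h.hr; omega)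
    ⟨1 * q * s, by ring⟩ with ⟨m, n, u, v, hmn, h1, h2, h3, -⟩ |
      ⟨-, m, n, u, v, hmn, h1, h3, y, hy⟩
  · rw [h.factor_qrs_pos_one (by rw [hmn, one_mul]) h1 h2] at h3
    exact ⟨0, 1, 0, 1, by simpa using h3, by decide⟩
  · rcases h.factor_qrs_pos_two (by rw [hmn, one_mul]) h1 with ⟨-, rfl⟩ | rfl
    · have ha : a = (n * v ^ 2 + 1 : ℕ) := (int_coords_unique h.admissible_qrs.not_isSquare
        (x := a) (y := b) (x' := (n * v ^ 2 + 1 : ℕ)) (y' := y)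
        (by rw [← hab, hy]; push_cast; rfl)).1
      -- Here `a - 1 = q v²`, so `q (a - 1) = (q v)²`.
      exact (hsq ⟨n * v, by rw [ha]; push_cast; ring⟩).elim
    · exact ⟨1, 1, 1, 0, by simpa [mul_assoc] using h3, by decide⟩

theorem hasClass_two_qrs_of_neg (h : PrimeTriple (-1) q r s) {a b : ℤ}
    (hab : (fundUnit (2 * q * r * s) : ℝ) = a + b * √((2 * q * r * s : ℕ) : ℝ))
    (hsq : ¬ ∃ m : ℕ, 2 * q * (a - 1) = (m : ℤ) ^ 2) :
    ∃ i j k l : ℕ, HasClass (2 * q * r * s) (2 ^ i * q ^ j * r ^ k * s ^ l) ∧ Odd (k + l) := by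
  rcases fundUnit_class_cases h.admissible_two_qrs (p := r) (by have := h.hr; omega)
    ⟨2 * q * s, by ring⟩ with ⟨m, n, u, v, hmn, h1, h2, h3, y, hy⟩ | ⟨hmod, -⟩
  · rcases h.factor_two_qrs_neg hmn h1 h2 with rfl | rfl | ⟨-, rfl⟩
    · exact ⟨1, 0, 1, 0, by simpa using h3, by decide⟩
    · exact ⟨0, 0, 0, 1, by simpa using h3, by decide⟩
    · have ha : a = (2 * (n * v ^ 2) + 1 : ℕ) :=
        (int_coords_unique h.admissible_two_qrs.not_isSquare
        (x := a) (y := b) (x' := (2 * (n * v ^ 2) + 1 : ℕ)) (y' := y)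
        (by rw [← hab, hy]; push_cast; rfl)).1
      -- Here `a - 1 = 2 q v²`, so `2q (a - 1) = (2 q v)²`.
      exact (hsq ⟨2 * n * v, by rw [ha]; push_cast; ring⟩).elim
  · simp only [mul_assoc] at hmod; omega

end PrimeTriple

end PrimeTriple

end RealUnits

noncomputable section

namespace RealUnits

/-! ### Galois theory of `ℚ(√a, √b, √c)` and relative norms. -/

section Galois

open Polynomial in
theorem finrank_quadField {d : ℕ} (hd : ¬ IsSquare d) : Module.finrank ℚ (quadField d) = 2 := by
  have hs := Real.sq_sqrt (Nat.cast_nonneg (α := ℝ) d)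
  have hm : (X ^ 2 - C (d : ℚ)).Monic := monic_X_pow_sub_C _ two_ne_zero
  have hz : aeval √(d : ℝ) (X ^ 2 - C (d : ℚ)) = 0 := by simp
  have hzint : IsIntegral ℚ √(d : ℝ) := ⟨_, hm, hz⟩
  rw [quadField, IntermediateField.adjoin.finrank hzint]
  apply le_antisymm
  · have := natDegree_le_of_dvd (minpoly.dvd ℚ _ hz) hm.ne_zero
    rwa [natDegree_X_pow_sub_C] at this
  · rw [minpoly.two_le_natDegree_iff hzint]
    rintro ⟨y, hy⟩
    exact irrational_sqrt_natCast_iff.2 hd ⟨y, hy⟩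

/-- Makes the algebra structure of an intermediate field take precedence over the one that every
field of characteristic zero has. -/
local instance algebraRat (K : IntermediateField ℚ ℝ) : Algebra ℚ K := K.algebra'

theorem finiteDimensional_quadField {d : ℕ} (hd : ¬ IsSquare d) :
    FiniteDimensional ℚ (quadField d) :=
  FiniteDimensional.of_finrank_pos (by rw [finrank_quadField hd]; norm_num)

theorem normal_quadField {d : ℕ} (hd : ¬ IsSquare d) : Normal ℚ (quadField d) := by
  have : Algebra.IsQuadraticExtension ℚ (quadField d) := ⟨finrank_quadField hd⟩
  infer_instance

/-- The field `ℚ(√a, √b, √c)`. -/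
def triField (a b c : ℕ) : IntermediateField ℚ ℝ := quadField a ⊔ quadField b ⊔ quadField c

variable {a b c : ℕ}

theorem finiteDimensional_triField (ha : ¬ IsSquare a) (hb : ¬ IsSquare b) (hc : ¬ IsSquare c) :
    FiniteDimensional ℚ (triField a b c) := by
  have := finiteDimensional_quadField ha
  have := finiteDimensional_quadField hb
  have := finiteDimensional_quadField hc
  unfold triField
  infer_instance

theorem isGalois_triField (ha : ¬ IsSquare a) (hb : ¬ IsSquare b) (hc : ¬ IsSquare c) :
    IsGalois ℚ (triField a b c) := by
  have := normal_quadField ha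
  have := normal_quadField hb
  have := normal_quadField hc
  have := finiteDimensional_triField ha hb hc
  have : Normal ℚ (triField a b c) := by
    unfold triField
    have := IntermediateField.normal_sup ℚ ℝ (quadField a) (quadField b)
    exact IntermediateField.normal_sup ℚ ℝ _ (quadField c)
  exact ⟨⟩

variable {K : IntermediateField ℚ ℝ}

/-- The Galois correspondence in separating form: an element fixed by every automorphism over `M`
lies in `M`. -/
theorem exists_aut_ne [FiniteDimensional ℚ K] [IsGalois ℚ K] {M : IntermediateField ℚ ℝ}
    (hM : M ≤ K) {x : K} (hx : (x : ℝ) ∉ M) :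
    ∃ g : K ≃ₐ[ℚ] K, (∀ y : K, (y : ℝ) ∈ M → g y = y) ∧ g x ≠ x := by
  by_contra! h
  apply hx
  rw [← IntermediateField.mem_restrict hM,
    ← IsGalois.fixedField_fixingSubgroup (IntermediateField.restrict hM),
    IntermediateField.mem_fixedField_iff]
  intro g hg
  rw [IntermediateField.mem_fixingSubgroup_iff] at hg
  exact h g fun y hy => hg y ((IntermediateField.mem_restrict hM y).2 hy)

theorem aut_apply_eq_or (g : K ≃ₐ[ℚ] K) {x : K} {n : ℕ} (hx : x ^ 2 = n) :
    g x = x ∨ g x = -x := by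
  rw [← sq_eq_sq_iff_eq_or_eq_neg, ← map_pow, hx, map_natCast]

/-- The fixed field of `g'⁻¹ g` contains the three generators, hence is the whole field. -/
theorem aut_eq_of_eq {g g' : triField a b c ≃ₐ[ℚ] triField a b c} {x y z : triField a b c}
    (hx : (x : ℝ) = √(a : ℝ)) (hy : (y : ℝ) = √(b : ℝ)) (hz : (z : ℝ) = √(c : ℝ))
    (h1 : g x = g' x) (h2 : g y = g' y) (h3 : g z = g' z) : g = g' := by
  set F : IntermediateField ℚ (triField a b c) :=
    IntermediateField.fixedField (Subgroup.zpowers (g'⁻¹ * g)) with hF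
  have key : ∀ w, g w = g' w → w ∈ F := by
    intro w hw
    rw [hF, IntermediateField.mem_fixedField_iff]
    intro f hf
    have h0 : (g'⁻¹ * g) ∈ MulAction.stabilizer (triField a b c ≃ₐ[ℚ] triField a b c) w := by
      rw [MulAction.mem_stabilizer_iff]
      change g'.symm (g w) = w
      rw [hw, AlgEquiv.symm_apply_apply]
    exact (Subgroup.zpowers_le.2 h0) hf
  have hle : triField a b c ≤ IntermediateField.lift F := by
    refine sup_le (sup_le ?_ ?_) ?_ <;> refine IntermediateField.adjoin_le_iff.2 ?_ <;>
      rintro _ rfl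
    · rw [← hx]; exact (IntermediateField.mem_lift x).2 (key x h1)
    · rw [← hy]; exact (IntermediateField.mem_lift y).2 (key y h2)
    · rw [← hz]; exact (IntermediateField.mem_lift z).2 (key z h3)
  ext w
  have hw := (IntermediateField.mem_lift w).1 (hle w.2)
  rw [hF, IntermediateField.mem_fixedField_iff] at hw
  have := hw _ (Subgroup.mem_zpowers _)
  have h4 : g w = g' w := by
    change g'.symm (g w) = w at this
    rw [AlgEquiv.symm_apply_eq] at this
    exact this
  rw [h4]

open Classical in
/-- The product of the conjugates of `η` under the automorphisms that fix `x`. -/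
def fixProd [FiniteDimensional ℚ K] (x η : K) : K :=
  ∏ g : K ≃ₐ[ℚ] K, if g x = x then g η else 1

theorem fixProd_inv [FiniteDimensional ℚ K] (x η : K) : fixProd x η⁻¹ = (fixProd x η)⁻¹ := by
  rw [fixProd, fixProd, ← Finset.prod_inv_distrib]
  refine Finset.prod_congr rfl fun g _ => ?_
  split_ifs <;> simp

theorem isIntegral_fixProd [FiniteDimensional ℚ K] (x : K) {η : K} (h : IsIntegral ℤ η) :
    IsIntegral ℤ (fixProd x η) := by
  refine IsIntegral.prod _ fun g _ => ?_
  split_ifs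
  · exact h.map (g.toAlgHom.restrictScalars ℤ)
  · exact isIntegral_one

/-- Left multiplication by `f` permutes the automorphisms that fix `x`. -/
theorem apply_fixProd [FiniteDimensional ℚ K] {x : K} (η : K) {f : K ≃ₐ[ℚ] K} (hf : f x = x) :
    f (fixProd x η) = fixProd x η := by
  rw [fixProd, map_prod]
  refine Fintype.prod_equiv (Equiv.mulLeft f) _ _ fun g => ?_
  have : (f * g) x = x ↔ g x = x := by
    rw [AlgEquiv.mul_apply]
    constructor
    · intro h
      apply f.injective
      rw [h, hf]
    · intro h
      rw [h, hf]
  simp only [Equiv.coe_mulLeft, this]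
  split_ifs
  · rfl
  · exact map_one f

/-- Automorphisms that are trivial on `M` fix `x`, hence fix the product, so it lies in `M`. For `M
= ℚ(x)` it is the relative norm. -/
theorem fixProd_mem_unitGroup [FiniteDimensional ℚ K] [IsGalois ℚ K] {M : IntermediateField ℚ ℝ}
    (hM : M ≤ K) {x η : K} (hx : (x : ℝ) ∈ M) {u : ℝˣ} (hu : u ∈ unitGroup K)
    (hη : (η : ℝ) = u) : ∃ v ∈ unitGroup M, ((fixProd x η : K) : ℝ) = v := by
  obtain ⟨-, h2, h3⟩ := mem_unitGroup_iff.1 hu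
  have inj : Function.Injective (K.val.restrictScalars ℤ) := Subtype.val_injective
  have i1 : IsIntegral ℤ η := by
    refine (isIntegral_algHom_iff (K.val.restrictScalars ℤ) inj).1 ?_
    change IsIntegral ℤ (η : ℝ); rwa [hη]
  have i2 : IsIntegral ℤ η⁻¹ := by
    refine (isIntegral_algHom_iff (K.val.restrictScalars ℤ) inj).1 ?_
    change IsIntegral ℤ ((η⁻¹ : K) : ℝ)
    rw [IntermediateField.coe_inv, hη, ← Units.val_inv_eq_inv_val]; exact h3
  have hη0 : η ≠ 0 := by
    rintro rfl; exact u.ne_zero hη.symm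
  have h0 : fixProd x η ≠ 0 := by
    rw [fixProd]
    refine Finset.prod_ne_zero_iff.2 fun g _ => ?_
    split_ifs <;> simp [hη0]
  have hmem : ((fixProd x η : K) : ℝ) ∈ M := by
    by_contra hn
    obtain ⟨g, hg, hne⟩ := exists_aut_ne hM hn
    exact hne (apply_fixProd η (hg x hx))
  have h0R : ((fixProd x η : K) : ℝ) ≠ 0 := by exact_mod_cast h0
  refine ⟨Units.mk0 _ h0R, mem_unitGroup_iff.2 ⟨hmem, ?_, ?_⟩, rfl⟩
  · exact (isIntegral_fixProd x i1).map (K.val.restrictScalars ℤ)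
  · rw [Units.val_inv_eq_inv_val, Units.val_mk0, ← IntermediateField.coe_inv, ← fixProd_inv]
    exact (isIntegral_fixProd x i2).map (K.val.restrictScalars ℤ)

theorem eq_one_or_of_mem_unitGroup_bot {u : ℝˣ} (hu : u ∈ unitGroup ⊥) : u = 1 ∨ u = -1 := by
  obtain ⟨h1, h2, h3⟩ := mem_unitGroup_iff.1 hu
  obtain ⟨t, ht⟩ := IntermediateField.mem_bot.1 h1
  have inj := (algebraMap ℚ ℝ).injective
  have i1 : IsIntegral ℤ t := (isIntegral_algebraMap_iff inj).1 (by rwa [ht])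
  have i2 : IsIntegral ℤ t⁻¹ := (isIntegral_algebraMap_iff inj).1 (by
    rw [map_inv₀, ht, ← Units.val_inv_eq_inv_val]; exact h3)
  obtain ⟨m, rfl⟩ := IsIntegrallyClosed.isIntegral_iff.1 i1
  obtain ⟨n, hn⟩ := IsIntegrallyClosed.isIntegral_iff.1 i2
  have hm0 : (algebraMap ℤ ℚ) m ≠ 0 := by
    intro h0; rw [h0, map_zero] at ht; exact u.ne_zero ht.symm
  have hmn : m * n = 1 := by
    have : (algebraMap ℤ ℚ) (m * n) = 1 := by rw [map_mul, hn, mul_inv_cancel₀ hm0]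
    rw [eq_intCast] at this
    exact_mod_cast this
  rcases Int.eq_one_or_neg_one_of_mul_eq_one hmn with rfl | rfl
  · left; apply Units.ext; rw [← ht]; simp
  · right; apply Units.ext; rw [← ht]; simp

/-- Count how often `g η` occurs on the left: seven times for `g = 1`, and three times for any other
`g`, since a nontrivial sign pattern on `x, y, z` fixes exactly three of the seven monomials. Linear
independence of the square roots is not needed. -/
theorem fixProd_identity [FiniteDimensional ℚ (triField a b c)] {x y z : triField a b c}
    (hx : (x : ℝ) = √(a : ℝ)) (hy : (y : ℝ) = √(b : ℝ)) (hz : (z : ℝ) = √(c : ℝ))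
    (ha : a ≠ 0) (hb : b ≠ 0) (hc : c ≠ 0) (η : triField a b c) :
    fixProd x η * fixProd y η * fixProd (x * y) η * fixProd z η * fixProd (x * z) η *
      fixProd (y * z) η * fixProd (x * y * z) η = η ^ 4 * fixProd 1 η ^ 3 := by
  classical
  have sq : ∀ {w : triField a b c} {n : ℕ}, (w : ℝ) = √(n : ℝ) → w ^ 2 = n := by
    intro w n h
    apply Subtype.ext
    change (w : ℝ) ^ 2 = ((n : triField a b c) : ℝ)
    rw [h, Real.sq_sqrt (Nat.cast_nonneg n)]
    simp
  have ne : ∀ {w : triField a b c} {n : ℕ}, n ≠ 0 → (w : ℝ) = √(n : ℝ) → w ≠ 0 := by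
    rintro w n hn h rfl
    have := sq h
    simp only [ne_eq, OfNat.ofNat_ne_zero, not_false_eq_true, zero_pow] at this
    exact hn (by exact_mod_cast this.symm)
  have neg_iff : ∀ w : triField a b c, -w = w ↔ w = 0 := fun w =>
    ⟨fun h => by linear_combination (-1 / 2) * h, by rintro rfl; simp⟩
  have hx0 := ne ha hx
  have hy0 := ne hb hy
  have hz0 := ne hc hz
  have rhs : η ^ 4 * fixProd 1 η ^ 3 = ∏ g : triField a b c ≃ₐ[ℚ] triField a b c,
      (if g = 1 then g η ^ 4 else 1) * g η ^ 3 := by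
    rw [Finset.prod_mul_distrib, Finset.prod_ite_eq' Finset.univ 1, Finset.prod_pow]
    simp [fixProd]
  rw [rhs]
  simp only [fixProd, ← Finset.prod_mul_distrib]
  refine Finset.prod_congr rfl fun g _ => ?_
  by_cases hg : g = 1
  · subst hg
    simp
    ring
  · have hne : ¬ (g x = x ∧ g y = y ∧ g z = z) := fun h =>
      hg (aut_eq_of_eq (g' := 1) hx hy hz h.1 h.2.1 h.2.2)
    rcases aut_apply_eq_or g (sq hx) with h1 | h1 <;> rcases aut_apply_eq_or g (sq hy) with h2 | h2
      <;> rcases aut_apply_eq_or g (sq hz) with h3 | h3 <;>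
      simp [hg, h1, h2, h3, hx0, hy0, hz0, neg_iff] at hne ⊢ <;> ring

end Galois

end RealUnits

end

noncomputable section

namespace RealUnits

/-! ### Fourth powers of units. -/

section PowFour

attribute [local instance] algebraRat

variable {a b c : ℕ}

theorem le_of_sqrt_mem {d : ℕ} {K : IntermediateField ℚ ℝ} (h : √(d : ℝ) ∈ K) :
    quadField d ≤ K := by
  refine IntermediateField.adjoin_le_iff.2 ?_
  rintro _ rfl
  exact h

theorem sqrt_left_mem_triField : √(a : ℝ) ∈ triField a b c :=
  (le_sup_left.trans le_sup_left : quadField a ≤ _) (sqrt_mem_quadField a)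

theorem sqrt_mid_mem_triField : √(b : ℝ) ∈ triField a b c :=
  (le_sup_right.trans le_sup_left : quadField b ≤ _) (sqrt_mem_quadField b)

theorem sqrt_right_mem_triField : √(c : ℝ) ∈ triField a b c :=
  (le_sup_right : quadField c ≤ _) (sqrt_mem_quadField c)

theorem sqrt_natCast_mul (m n : ℕ) : √((m * n : ℕ) : ℝ) = √(m : ℝ) * √(n : ℝ) := by
  rw [Nat.cast_mul, Real.sqrt_mul (Nat.cast_nonneg m)]

theorem sqrt_mul_mem {K : IntermediateField ℚ ℝ} {m n : ℕ} (hm : √(m : ℝ) ∈ K)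
    (hn : √(n : ℝ) ∈ K) : √((m * n : ℕ) : ℝ) ∈ K := by
  rw [sqrt_natCast_mul]; exact mul_mem hm hn

/-- The fourth power of a unit of `ℚ(√a, √b, √c)` is, up to sign, a product of units of the
quadratic subfields. -/
theorem pow_four_mem (ha : ¬ IsSquare a) (hb : ¬ IsSquare b) (hc : ¬ IsSquare c)
    {H : Subgroup ℝˣ} (h1 : -1 ∈ H) (hH : ∀ d ∈ [a, b, a * b, c, a * c, b * c, a * b * c],
      unitGroup (quadField d) ≤ H) {u : ℝˣ} (hu : u ∈ unitGroup (triField a b c)) :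
    u ^ 4 ∈ H := by
  have := finiteDimensional_triField ha hb hc
  have := isGalois_triField ha hb hc
  have ne : ∀ {n : ℕ}, ¬ IsSquare n → n ≠ 0 := by
    rintro n h rfl; exact h IsSquare.zero
  set K := triField a b c with hK
  have ha' : √(a : ℝ) ∈ K := sqrt_left_mem_triField
  have hb' : √(b : ℝ) ∈ K := sqrt_mid_mem_triField
  have hc' : √(c : ℝ) ∈ K := sqrt_right_mem_triField
  set η : K := ⟨u, (mem_unitGroup_iff.1 hu).1⟩ with hη
  have key : ∀ (d : ℕ) (x : K), (x : ℝ) = √(d : ℝ) →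
      d ∈ [a, b, a * b, c, a * c, b * c, a * b * c] →
      ∃ v ∈ H, ((fixProd x η : K) : ℝ) = (v : ℝˣ) := by
    intro d x hx hd
    obtain ⟨v, hv, hv'⟩ := fixProd_mem_unitGroup (M := quadField d) (K := K)
      (le_of_sqrt_mem (hx ▸ x.2)) (x := x) (η := η) (hx ▸ sqrt_mem_quadField d) hu rfl
    exact ⟨v, hH d hd hv, hv'⟩
  set x : K := ⟨_, ha'⟩
  set y : K := ⟨_, hb'⟩
  set z : K := ⟨_, hc'⟩
  have id := fixProd_identity (x := x) (y := y) (z := z) rfl rfl rfl (ne ha) (ne hb) (ne hc) η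
  obtain ⟨v1, m1, e1⟩ := key a x rfl (by simp)
  obtain ⟨v2, m2, e2⟩ := key b y rfl (by simp)
  obtain ⟨v3, m3, e3⟩ := key (a * b) (x * y) (by rw [sqrt_natCast_mul]; rfl) (by simp)
  obtain ⟨v4, m4, e4⟩ := key c z rfl (by simp)
  obtain ⟨v5, m5, e5⟩ := key (a * c) (x * z) (by rw [sqrt_natCast_mul]; rfl) (by simp)
  obtain ⟨v6, m6, e6⟩ := key (b * c) (y * z) (by rw [sqrt_natCast_mul]; rfl) (by simp)
  obtain ⟨v7, m7, e7⟩ := key (a * b * c) (x * y * z)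
    (by rw [sqrt_natCast_mul, sqrt_natCast_mul]; rfl) (by simp)
  obtain ⟨v0, m0, e0⟩ := fixProd_mem_unitGroup (M := ⊥) (K := K) bot_le (x := 1) (η := η)
    (one_mem _) hu rfl
  have m0' : v0 ∈ H := by
    rcases eq_one_or_of_mem_unitGroup_bot m0 with rfl | rfl
    · exact one_mem H
    · exact h1
  have id2 : v1 * v2 * v3 * v4 * v5 * v6 * v7 = u ^ 4 * v0 ^ 3 := by
    apply Units.ext
    have id3 := congrArg (fun t : K => (t : ℝ)) id
    simp only [IntermediateField.coe_mul, IntermediateField.coe_pow, e0, e1, e2, e3, e4, e5, e6,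
      e7] at id3
    push_cast
    exact id3
  have : u ^ 4 = v1 * v2 * v3 * v4 * v5 * v6 * v7 * (v0 ^ 3)⁻¹ := by rw [id2]; simp
  rw [this]
  exact mul_mem (mul_mem (mul_mem (mul_mem (mul_mem (mul_mem (mul_mem m1 m2) m3) m4) m5) m6) m7)
    (inv_mem (pow_mem m0' 3))

end PowFour

/-! ### Norms up to sign for a single automorphism. -/

section AbsNorm

attribute [local instance] algebraRat

variable {K : IntermediateField ℚ ℝ}

/-- The absolute value of `x * σ x`. -/
def absNorm (σ : K ≃ₐ[ℚ] K) (x : K) : ℝ := |(x : ℝ) * (σ x : ℝ)|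

theorem absNorm_mul (σ : K ≃ₐ[ℚ] K) (x y : K) :
    absNorm σ (x * y) = absNorm σ x * absNorm σ y := by
  simp only [absNorm, map_mul, IntermediateField.coe_mul, ← abs_mul]
  congr 1; ring

theorem absNorm_pow (σ : K ≃ₐ[ℚ] K) (x : K) (n : ℕ) : absNorm σ (x ^ n) = absNorm σ x ^ n := by
  simp only [absNorm, map_pow, IntermediateField.coe_pow, ← mul_pow, abs_pow]

theorem absNorm_of_fixed {d : ℕ} (hd : Admissible d) {σ : K ≃ₐ[ℚ] K} {x E : K}
    (hx : (x : ℝ) = √(d : ℝ)) (hE : (E : ℝ) = fundUnit d) (h : σ x = x) :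
    absNorm σ E = (fundUnit d : ℝ) ^ 2 := by
  obtain ⟨m, n, hmn⟩ := mem_quadField_iff.1 (mem_unitGroup_iff.1 (fundUnit_mem hd)).1
  have hE' : E = algebraMap ℚ K m + algebraMap ℚ K n * x := by
    apply Subtype.ext
    rw [hE, hmn, ← hx]; rfl
  have : σ E = E := by
    rw [hE', map_add, map_mul, AlgEquiv.commutes, AlgEquiv.commutes, h]
  rw [absNorm, this, hE, ← sq, abs_of_nonneg (sq_nonneg _)]

/-- The norm of a fundamental unit, for an automorphism that moves `√d`. -/
theorem mul_apply_of_moved {d : ℕ} {σ : K ≃ₐ[ℚ] K} {x E : K} {m n : ℤ}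
    (hx : (x : ℝ) = √(d : ℝ)) (hE : (E : ℝ) = m + n * √(d : ℝ)) (h : σ x = -x) :
    (E : ℝ) * (σ E : ℝ) = ((m ^ 2 - d * n ^ 2 : ℤ) : ℝ) := by
  have hs := Real.sq_sqrt (Nat.cast_nonneg (α := ℝ) d)
  have hE' : E = algebraMap ℚ K m + algebraMap ℚ K n * x := by
    apply Subtype.ext
    rw [hE, ← hx]
    change _ = ((m : ℚ) : ℝ) + ((n : ℚ) : ℝ) * (x : ℝ)
    push_cast; rfl
  have h1 : σ E = algebraMap ℚ K m + algebraMap ℚ K n * (-x) := by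
    rw [hE', map_add, map_mul, AlgEquiv.commutes, AlgEquiv.commutes, h]
  have h2 : (σ E : ℝ) = m - n * √(d : ℝ) := by
    rw [h1, ← hx]
    change ((m : ℚ) : ℝ) + ((n : ℚ) : ℝ) * (-(x : ℝ)) = _
    push_cast; ring
  rw [h2, hE]
  push_cast
  linear_combination -(n : ℝ) ^ 2 * hs

theorem absNorm_of_moved {d : ℕ} (hd : Admissible d) {σ : K ≃ₐ[ℚ] K} {x E : K}
    (hx : (x : ℝ) = √(d : ℝ)) (hE : (E : ℝ) = fundUnit d) (h : σ x = -x) :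
    absNorm σ E = 1 := by
  obtain ⟨m, n, hmn, hn⟩ := exists_int_of_mem_unitGroup hd.squarefree hd.not_isSquare
      hd.mod_ne (fundUnit_mem hd)
  rw [absNorm, mul_apply_of_moved hx (hE.trans hmn) h]
  rcases hn with hn | hn <;> simp [hn]

/-- Relation `x² = y` determines `x σ(x)` only up to sign; working with absolute values makes this
harmless. -/
theorem absNorm_sqrt {σ : K ≃ₐ[ℚ] K} {x y : K} {t : ℝ} (ht : 0 ≤ t) (h : x ^ 2 = y)
    (hy : absNorm σ y = t ^ 2) : absNorm σ x = t := by
  rw [← h, absNorm_pow] at hy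
  exact (pow_left_inj₀ (abs_nonneg _) ht two_ne_zero).1 hy

/-- If `x = y²` in `K`, then `absNorm σ x` is a square in any field that contains the fixed
elements of the involution `σ`. -/
theorem exists_sq_eq_absNorm {σ : K ≃ₐ[ℚ] K} (hσ : ∀ x, σ (σ x) = x) {M : IntermediateField ℚ ℝ}
    (hM : ∀ x, σ x = x → (x : ℝ) ∈ M) {x y : K} (h : y ^ 2 = x) :
    ∃ w ∈ M, w ^ 2 = absNorm σ x := by
  refine ⟨((y * σ y : K) : ℝ), hM _ (by rw [map_mul, hσ, mul_comm]), ?_⟩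
  rw [← h, absNorm_pow, absNorm, sq_abs]
  rfl

/-- If only `1` and `σ` fix both square roots, every automorphism over the field they generate fixes
whatever `σ` fixes. -/
theorem mem_of_fixed [FiniteDimensional ℚ K] [IsGalois ℚ K] {σ : K ≃ₐ[ℚ] K} {x y : K} {d e : ℕ}
    (hx : (x : ℝ) = √(d : ℝ)) (hy : (y : ℝ) = √(e : ℝ))
    (h : ∀ g : K ≃ₐ[ℚ] K, g x = x → g y = y → g = 1 ∨ g = σ) {w : K} (hw : σ w = w) :
    (w : ℝ) ∈ quadField d ⊔ quadField e := by
  by_contra hn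
  obtain ⟨g, hg, hne⟩ := exists_aut_ne (M := quadField d ⊔ quadField e)
    (sup_le (le_of_sqrt_mem (hx ▸ x.2)) (le_of_sqrt_mem (hy ▸ y.2))) hn
  rcases h g (hg x (hx ▸ le_sup_left (a := quadField d) (sqrt_mem_quadField d)))
    (hg y (hy ▸ le_sup_right (a := quadField d) (sqrt_mem_quadField e))) with rfl | rfl
  · exact hne rfl
  · exact hne hw

end AbsNorm

/-! ### Kummer theory for monomials in `2, q, r, s`. -/

section Kummer

/-- The number `2^i q^j r^k s^l`. -/
def mono (q r s i j k l : ℕ) : ℕ := 2 ^ i * q ^ j * r ^ k * s ^ l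

variable {e : ℤ} {q r s : ℕ} [Fact q.Prime] [Fact r.Prime] [Fact s.Prime]

/-- A natural number that is a rational square is a square of a natural number, so its exponents at
the four distinct primes are even. -/
theorem PrimeTriple.even_of_sq_eq_mono (h : PrimeTriple e q r s) {i j k l : ℕ} {y : ℝ}
    (hy : y ∈ (⊥ : IntermediateField ℚ ℝ)) (hy2 : y ^ 2 = mono q r s i j k l) :
    Even i ∧ Even j ∧ Even k ∧ Even l := by
  obtain ⟨t, rfl⟩ := IntermediateField.mem_bot.1 hy
  have h1 : IsSquare ((mono q r s i j k l : ℕ) : ℚ) := ⟨t, by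
    rw [← sq]
    have : ((t ^ 2 : ℚ) : ℝ) = ((mono q r s i j k l : ℚ) : ℝ) := by push_cast; exact hy2.symm ▸ rfl
    exact_mod_cast this.symm⟩
  rw [Rat.isSquare_natCast_iff] at h1
  obtain ⟨m, hm⟩ := h1
  have p2 := Nat.prime_two.pos.ne'
  have pq := h.prime_q.pos.ne'
  have pr := h.prime_r.pos.ne'
  have ps := h.prime_s.pos.ne'
  have hm0 : m ≠ 0 := by
    rintro rfl
    simp [mono, pq, pr, ps] at hm
  have hf : (mono q r s i j k l).factorization = m.factorization + m.factorization := by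
    rw [hm, Nat.factorization_mul hm0 hm0]
  rw [mono, Nat.factorization_mul (by positivity) (by positivity),
    Nat.factorization_mul (by positivity) (by positivity),
    Nat.factorization_mul (by positivity) (by positivity), Nat.prime_two.factorization_pow,
    h.prime_q.factorization_pow, h.prime_r.factorization_pow, h.prime_s.factorization_pow] at hf
  have n1 := h.two_ne_q
  have n2 := h.two_ne_r
  have n3 := h.two_ne_s
  have n4 := h.qr
  have n5 := h.qs
  have n6 := h.rs
  have f2 := DFunLike.congr_fun hf 2
  have fq := DFunLike.congr_fun hf q
  have fr := DFunLike.congr_fun hf r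
  have fs := DFunLike.congr_fun hf s
  simp [n1, n2, n3, n4, n5, n6, n1.symm, n2.symm, n3.symm, n4.symm, n5.symm,
    n6.symm] at f2 fq fr fs
  exact ⟨⟨_, f2⟩, ⟨_, fq⟩, ⟨_, fr⟩, ⟨_, fs⟩⟩

/-- Peels off one generator `√a` at the cost of a factor `a^i` in the radicand; iterating it
descends to `ℚ`. -/
theorem exists_pow_mul_sq {F : IntermediateField ℚ ℝ} {a D : ℕ} {z : ℝ}
    (hz : z ∈ F ⊔ quadField a) (hz2 : z ^ 2 = D) :
    ∃ i : ℕ, i ≤ 1 ∧ ∃ y ∈ F, y ^ 2 = ((a ^ i * D : ℕ) : ℝ) := by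
  rcases exists_sq_eq_of_mem_sup_quadField hz (hz2 ▸ natCast_mem F D) with ⟨y, hy, h⟩ | ⟨y, hy, h⟩
  · exact ⟨0, zero_le_one, y, hy, by rw [h, hz2]; simp⟩
  · exact ⟨1, le_rfl, y, hy, by rw [h, hz2]; simp⟩

theorem mono_pow_mul (q r s i j k l i' j' k' l' n : ℕ) :
    mono q r s i j k l ^ n * mono q r s i' j' k' l' =
      mono q r s (i * n + i') (j * n + j') (k * n + k') (l * n + l') := by
  simp only [mono, mul_pow, ← pow_mul, pow_add]; ring

theorem mono_mul (q r s i j k l i' j' k' l' : ℕ) :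
    mono q r s i j k l * mono q r s i' j' k' l' =
      mono q r s (i + i') (j + j') (k + k') (l + l') := by
  simp only [mono, pow_add]; ring

/-- Kummer theory for `ℚ(√a, √b)`, where `a` and `b` are monomials in `2, q, r, s`. -/
theorem PrimeTriple.even_of_mem_sup (h : PrimeTriple e q r s)
    {i j k l i' j' k' l' i'' j'' k'' l'' : ℕ} {z : ℝ}
    (hz : z ∈ quadField (mono q r s i j k l) ⊔ quadField (mono q r s i' j' k' l'))
    (hz2 : z ^ 2 = mono q r s i'' j'' k'' l'') :
    ∃ m n : ℕ, Even (i * m + (i' * n + i'')) ∧ Even (j * m + (j' * n + j'')) ∧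
      Even (k * m + (k' * n + k'')) ∧ Even (l * m + (l' * n + l'')) := by
  obtain ⟨n, -, y, hy, hy2⟩ := exists_pow_mul_sq hz hz2
  rw [mono_pow_mul] at hy2
  rw [← bot_sup_eq (quadField _)] at hy
  obtain ⟨m, -, x, hx, hx2⟩ := exists_pow_mul_sq hy hy2
  rw [mono_pow_mul] at hx2
  exact ⟨m, n, h.even_of_sq_eq_mono hx hx2⟩

end Kummer

end RealUnits

end

noncomputable section

namespace RealUnits

section Kummer

theorem mono_two (q r s : ℕ) : mono q r s 1 0 0 0 = 2 := by simp [mono]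
theorem mono_q (q r s : ℕ) : mono q r s 0 1 0 0 = q := by simp [mono]
theorem mono_s (q r s : ℕ) : mono q r s 0 0 0 1 = s := by simp [mono]
theorem mono_rs (q r s : ℕ) : mono q r s 0 0 1 1 = r * s := by simp [mono]

variable {e : ℤ} {q r s : ℕ} [Fact q.Prime] [Fact r.Prime] [Fact s.Prime]

/-- Kummer theory for `ℚ(√2, √q, √(rs))`. -/
theorem PrimeTriple.even_of_mem_triField (h : PrimeTriple e q r s) {i j k l : ℕ} {z : ℝ}
    (hz : z ∈ triField 2 q (r * s)) (hz2 : z ^ 2 = mono q r s i j k l) :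
    ∃ m₁ m₂ m₃ : ℕ, Even (m₁ + i) ∧ Even (m₂ + j) ∧ Even (m₃ + k) ∧ Even (m₃ + l) := by
  rw [triField, ← mono_two q r s, ← mono_rs q r s] at hz
  nth_rewrite 2 [← mono_q q r s] at hz
  obtain ⟨n₁, -, y₁, hy₁, h₁⟩ := exists_pow_mul_sq hz hz2
  rw [mono_pow_mul] at h₁
  obtain ⟨n₂, -, y₂, hy₂, h₂⟩ := exists_pow_mul_sq hy₁ h₁
  rw [mono_pow_mul] at h₂
  rw [← bot_sup_eq (quadField _)] at hy₂
  obtain ⟨n₃, -, y₃, hy₃, h₃⟩ := exists_pow_mul_sq hy₂ h₂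
  rw [mono_pow_mul] at h₃
  refine ⟨n₃, n₂, n₁, ?_⟩
  simpa using h.even_of_sq_eq_mono hy₃ h₃

end Kummer

/-! ### Automorphisms as sign patterns. -/

section Signs

attribute [local instance] algebraRat

/-- The first generator `√a` of `ℚ(√a, √b, √c)`. -/
def gen₁ (a b c : ℕ) : triField a b c := ⟨√(a : ℝ), sqrt_left_mem_triField⟩
/-- The second generator `√b`. -/
def gen₂ (a b c : ℕ) : triField a b c := ⟨√(b : ℝ), sqrt_mid_mem_triField⟩
/-- The third generator `√c`. -/
def gen₃ (a b c : ℕ) : triField a b c := ⟨√(c : ℝ), sqrt_right_mem_triField⟩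

variable {a b c : ℕ}

/-- `σ` acts on `√a, √b, √c` by the signs `i, j, k`. -/
structure ActsBy (σ : triField a b c ≃ₐ[ℚ] triField a b c) (i j k : ℤˣ) : Prop where
  fst : σ (gen₁ a b c) = ((i : ℤ) : triField a b c) * gen₁ a b c
  snd : σ (gen₂ a b c) = ((j : ℤ) : triField a b c) * gen₂ a b c
  trd : σ (gen₃ a b c) = ((k : ℤ) : triField a b c) * gen₃ a b c

theorem ActsBy.mul {σ τ : triField a b c ≃ₐ[ℚ] triField a b c} {i j k i' j' k' : ℤˣ}
    (h : ActsBy σ i j k) (h' : ActsBy τ i' j' k') :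
    ActsBy (σ * τ) (i * i') (j * j') (k * k') := by
  refine ⟨?_, ?_, ?_⟩
  · rw [AlgEquiv.mul_apply, h'.fst, map_mul, map_intCast, h.fst]; push_cast; ring
  · rw [AlgEquiv.mul_apply, h'.snd, map_mul, map_intCast, h.snd]; push_cast; ring
  · rw [AlgEquiv.mul_apply, h'.trd, map_mul, map_intCast, h.trd]; push_cast; ring

theorem ActsBy.ext {σ τ : triField a b c ≃ₐ[ℚ] triField a b c} {i j k : ℤˣ}
    (h : ActsBy σ i j k) (h' : ActsBy τ i j k) : σ = τ :=
  aut_eq_of_eq (x := gen₁ a b c) (y := gen₂ a b c) (z := gen₃ a b c) rfl rfl rfl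
    (by rw [h.fst, h'.fst]) (by rw [h.snd, h'.snd]) (by rw [h.trd, h'.trd])

theorem ActsBy.one : ActsBy (1 : triField a b c ≃ₐ[ℚ] triField a b c) 1 1 1 :=
  ⟨by simp, by simp, by simp⟩

theorem sq_eq_natCast_of_sqrt {K : IntermediateField ℚ ℝ} {w : K} {n : ℕ}
    (h : (w : ℝ) = √(n : ℝ)) : w ^ 2 = n := by
  apply Subtype.ext
  change (w : ℝ) ^ 2 = ((n : K) : ℝ)
  rw [h, Real.sq_sqrt (Nat.cast_nonneg n)]
  simp

theorem ActsBy.involutive {σ : triField a b c ≃ₐ[ℚ] triField a b c} {i j k : ℤˣ}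
    (h : ActsBy σ i j k) (x : triField a b c) : σ (σ x) = x := by
  have h2 := h.mul h
  rw [Int.units_mul_self, Int.units_mul_self, Int.units_mul_self] at h2
  have := h2.ext ActsBy.one
  rw [← AlgEquiv.mul_apply, this, AlgEquiv.one_apply]

theorem exists_actsBy (g : triField a b c ≃ₐ[ℚ] triField a b c) : ∃ i j k, ActsBy g i j k := by
  have key : ∀ {x : triField a b c} {n : ℕ}, (x : ℝ) = √(n : ℝ) →
      ∃ i : ℤˣ, g x = ((i : ℤ) : triField a b c) * x := by
    intro x n hx
    rcases aut_apply_eq_or g (sq_eq_natCast_of_sqrt hx) with h | h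
    · exact ⟨1, by simpa using h⟩
    · exact ⟨-1, by simpa using h⟩
  obtain ⟨i, hi⟩ := key (x := gen₁ a b c) rfl
  obtain ⟨j, hj⟩ := key (x := gen₂ a b c) rfl
  obtain ⟨k, hk⟩ := key (x := gen₃ a b c) rfl
  exact ⟨i, j, k, hi, hj, hk⟩

/-- The product of generators `√a^l √b^m √c^n`. -/
def genMonomial (a b c l m n : ℕ) : triField a b c :=
  gen₁ a b c ^ l * gen₂ a b c ^ m * gen₃ a b c ^ n

theorem ActsBy.apply_genMonomial {σ : triField a b c ≃ₐ[ℚ] triField a b c} {i j k : ℤˣ}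
    (h : ActsBy σ i j k) (l m n : ℕ) :
    σ (genMonomial a b c l m n) =
      ((i ^ l * j ^ m * k ^ n : ℤˣ) : ℤ) * genMonomial a b c l m n := by
  rw [genMonomial, map_mul, map_mul, map_pow, map_pow, map_pow, h.fst, h.snd, h.trd]
  push_cast
  ring

theorem coe_genMonomial (a b c l m n : ℕ) :
    ((genMonomial a b c l m n : triField a b c) : ℝ) = √((a ^ l * b ^ m * c ^ n : ℕ) : ℝ) := by
  have hp : ∀ x k : ℕ, √((x ^ k : ℕ) : ℝ) = √(x : ℝ) ^ k := by
    intro x k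
    induction k with
    | zero => simp
    | succ k ih => rw [pow_succ, sqrt_natCast_mul, ih, pow_succ]
  rw [sqrt_natCast_mul, sqrt_natCast_mul, hp, hp, hp]
  rfl

theorem genMonomial_ne_zero (ha : a ≠ 0) (hb : b ≠ 0) (hc : c ≠ 0) (l m n : ℕ) :
    genMonomial a b c l m n ≠ 0 := by
  intro h0
  have h1 := coe_genMonomial a b c l m n
  rw [h0] at h1
  have h2 : 0 < √((a ^ l * b ^ m * c ^ n : ℕ) : ℝ) := by
    apply Real.sqrt_pos.2
    have : 0 < a ^ l * b ^ m * c ^ n := by positivity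
    exact_mod_cast this
  rw [← h1] at h2
  exact lt_irrefl _ h2

theorem exists_flip (ha : ¬ IsSquare a) (hb : ¬ IsSquare b) (hc : ¬ IsSquare c)
    {M : IntermediateField ℚ ℝ} (hM : M ≤ triField a b c) {x : triField a b c}
    (hx : (x : ℝ) ∉ M) :
    ∃ g i j k, ActsBy g i j k ∧ (∀ y : triField a b c, (y : ℝ) ∈ M → g y = y) ∧
      g x ≠ x := by
  have := finiteDimensional_triField ha hb hc
  have := isGalois_triField ha hb hc
  obtain ⟨g, h1, h2⟩ := exists_aut_ne hM hx
  obtain ⟨i, j, k, h⟩ := exists_actsBy g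
  exact ⟨g, i, j, k, h, h1, h2⟩

theorem sign_eq_one_of_fixed {K : IntermediateField ℚ ℝ} {x : K} (hx : x ≠ 0) {i : ℤˣ}
    (h : ((i : ℤ) : K) * x = x) : i = 1 := by
  rcases Int.units_eq_one_or i with rfl | rfl
  · rfl
  · exfalso; apply hx
    simp at h
    linear_combination (-1 / 2) * h

/-- Each hypothesis yields, by the Galois correspondence, an automorphism flipping one generator and
fixing the other two; their products realize every pattern. -/
theorem exists_actsBy_of_notMem (ha : ¬ IsSquare a) (hb : ¬ IsSquare b) (hc : ¬ IsSquare c)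
    (h₁ : √(a : ℝ) ∉ quadField b ⊔ quadField c) (h₂ : √(b : ℝ) ∉ quadField a ⊔ quadField c)
    (h₃ : √(c : ℝ) ∉ quadField a ⊔ quadField b) (i j k : ℤˣ) :
    ∃ g : triField a b c ≃ₐ[ℚ] triField a b c, ActsBy g i j k := by
  have ne : ∀ {n : ℕ}, ¬ IsSquare n → n ≠ 0 := by
    rintro n h rfl; exact h IsSquare.zero
  have n₁ : gen₁ a b c ≠ 0 := by
    simpa [genMonomial] using genMonomial_ne_zero (ne ha) (ne hb) (ne hc) 1 0 0
  have n₂ : gen₂ a b c ≠ 0 := by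
    simpa [genMonomial] using genMonomial_ne_zero (ne ha) (ne hb) (ne hc) 0 1 0
  have n₃ : gen₃ a b c ≠ 0 := by
    simpa [genMonomial] using genMonomial_ne_zero (ne ha) (ne hb) (ne hc) 0 0 1
  have neg : ∀ {i : ℤˣ} {x : triField a b c}, ((i : ℤ) : triField a b c) * x ≠ x → i = -1 := by
    intro i x h
    rcases Int.units_eq_one_or i with rfl | rfl
    · simp at h
    · rfl
  have la : quadField a ≤ triField a b c := le_of_sqrt_mem sqrt_left_mem_triField
  have lb : quadField b ≤ triField a b c := le_of_sqrt_mem sqrt_mid_mem_triField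
  have lc : quadField c ≤ triField a b c := le_of_sqrt_mem sqrt_right_mem_triField
  have f₁ : ∃ g : triField a b c ≃ₐ[ℚ] triField a b c, ActsBy g (-1) 1 1 := by
    obtain ⟨g, i, j, k, hg, hf, hn⟩ := exists_flip ha hb hc (sup_le lb lc) (x := gen₁ a b c) h₁
    have e₂ := hf (gen₂ a b c) (le_sup_left (a := quadField b) (sqrt_mem_quadField b))
    have e₃ := hf (gen₃ a b c) (le_sup_right (a := quadField b) (sqrt_mem_quadField c))
    rw [hg.snd] at e₂
    rw [hg.trd] at e₃
    rw [hg.fst] at hn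
    obtain rfl := sign_eq_one_of_fixed n₂ e₂
    obtain rfl := sign_eq_one_of_fixed n₃ e₃
    obtain rfl := neg hn
    exact ⟨g, hg⟩
  have f₂ : ∃ g : triField a b c ≃ₐ[ℚ] triField a b c, ActsBy g 1 (-1) 1 := by
    obtain ⟨g, i, j, k, hg, hf, hn⟩ := exists_flip ha hb hc (sup_le la lc) (x := gen₂ a b c) h₂
    have e₁ := hf (gen₁ a b c) (le_sup_left (a := quadField a) (sqrt_mem_quadField a))
    have e₃ := hf (gen₃ a b c) (le_sup_right (a := quadField a) (sqrt_mem_quadField c))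
    rw [hg.fst] at e₁
    rw [hg.trd] at e₃
    rw [hg.snd] at hn
    obtain rfl := sign_eq_one_of_fixed n₁ e₁
    obtain rfl := sign_eq_one_of_fixed n₃ e₃
    obtain rfl := neg hn
    exact ⟨g, hg⟩
  have f₃ : ∃ g : triField a b c ≃ₐ[ℚ] triField a b c, ActsBy g 1 1 (-1) := by
    obtain ⟨g, i, j, k, hg, hf, hn⟩ := exists_flip ha hb hc (sup_le la lb) (x := gen₃ a b c) h₃
    have e₁ := hf (gen₁ a b c) (le_sup_left (a := quadField a) (sqrt_mem_quadField a))
    have e₂ := hf (gen₂ a b c) (le_sup_right (a := quadField a) (sqrt_mem_quadField b))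
    rw [hg.fst] at e₁
    rw [hg.snd] at e₂
    rw [hg.trd] at hn
    obtain rfl := sign_eq_one_of_fixed n₁ e₁
    obtain rfl := sign_eq_one_of_fixed n₂ e₂
    obtain rfl := neg hn
    exact ⟨g, hg⟩
  obtain ⟨g₁, hg₁⟩ := f₁
  obtain ⟨g₂, hg₂⟩ := f₂
  obtain ⟨g₃, hg₃⟩ := f₃
  rcases Int.units_eq_one_or i with rfl | rfl <;> rcases Int.units_eq_one_or j with rfl | rfl <;>
    rcases Int.units_eq_one_or k with rfl | rfl
  · exact ⟨1, ActsBy.one⟩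
  · exact ⟨g₃, hg₃⟩
  · exact ⟨g₂, hg₂⟩
  · exact ⟨g₂ * g₃, by simpa using hg₂.mul hg₃⟩
  · exact ⟨g₁, hg₁⟩
  · exact ⟨g₁ * g₃, by simpa using hg₁.mul hg₃⟩
  · exact ⟨g₁ * g₂, by simpa using hg₁.mul hg₂⟩
  · exact ⟨g₁ * g₂ * g₃, by simpa using (hg₁.mul hg₂).mul hg₃⟩

end Signs

end RealUnits

end

noncomputable section

namespace RealUnits

/-! ### From a square relation to parity conditions. -/

section Saturation

attribute [local instance] algebraRat

/-- `x` lies in the class of `m` modulo squares of `M`. -/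
def IsClass (M : IntermediateField ℚ ℝ) (x : ℝ) (m : ℕ) : Prop := ∃ w ∈ M, w ^ 2 = m * x

theorem mono_prod {ι : Type*} (S : Finset ι) (q r s : ℕ) (I J K L t : ι → ℕ) :
    ∏ x ∈ S, mono q r s (I x) (J x) (K x) (L x) ^ t x =
      mono q r s (∑ x ∈ S, I x * t x) (∑ x ∈ S, J x * t x) (∑ x ∈ S, K x * t x)
        (∑ x ∈ S, L x * t x) := by
  simp only [mono, mul_pow, ← pow_mul, Finset.prod_mul_distrib, Finset.prod_pow_eq_pow_sum]

variable {e : ℤ} {q r s : ℕ}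

/-- The exponents `l, m, n` write `√d` as a monomial in the generators, so the signs decide whether
`σ` fixes `ε_d`, or moves `√d` and makes `ε_d σ(ε_d) = ±1`. -/
theorem absNorm_fundUnit_eq {d : ℕ} (hd : Admissible d) {l m n : ℕ}
    (hd' : d = 2 ^ l * q ^ m * (r * s) ^ n) {σ : triField 2 q (r * s) ≃ₐ[ℚ] triField 2 q (r * s)}
    {i j k : ℤˣ} (hσ : ActsBy σ i j k) {E : triField 2 q (r * s)} (hE : (E : ℝ) = fundUnit d) :
    absNorm σ E = if i ^ l * j ^ m * k ^ n = 1 then (fundUnit d : ℝ) ^ 2 else 1 := by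
  have hx : ((genMonomial 2 q (r * s) l m n : triField 2 q (r * s)) : ℝ) = √(d : ℝ) := by
    rw [coe_genMonomial, hd']
  have hs := hσ.apply_genMonomial l m n
  split_ifs with h
  · exact absNorm_of_fixed hd hx hE (by rw [hs, h]; simp)
  · have h' := (Int.units_eq_one_or (i ^ l * j ^ m * k ^ n)).resolve_left h
    exact absNorm_of_moved hd hx hE (by rw [hs, h']; simp)

theorem absNorm_sqrt_fundUnit_eq {d : ℕ} (hd : Admissible d) {l m n : ℕ}
    (hd' : d = 2 ^ l * q ^ m * (r * s) ^ n) {σ : triField 2 q (r * s) ≃ₐ[ℚ] triField 2 q (r * s)}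
    {i j k : ℤˣ} (hσ : ActsBy σ i j k) {U : triField 2 q (r * s)} (hU : (U : ℝ) ^ 2 = fundUnit d) :
    absNorm σ U = if i ^ l * j ^ m * k ^ n = 1 then (fundUnit d : ℝ) else 1 := by
  refine absNorm_sqrt ?_ (y := U ^ 2) rfl ?_
  · split_ifs
    · exact (fundUnit_pos hd).le
    · exact zero_le_one
  · rw [absNorm_fundUnit_eq hd hd' hσ (E := U ^ 2) (by rw [← hU]; rfl)]
    split_ifs <;> simp

theorem isClass_one (M : IntermediateField ℚ ℝ) (q r s : ℕ) :
    IsClass M 1 (mono q r s 0 0 0 0) := ⟨1, one_mem M, by simp [mono]⟩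

theorem isClass_absNorm_fundUnit {d : ℕ} (hd : Admissible d) {l m n : ℕ}
    (hd' : d = 2 ^ l * q ^ m * (r * s) ^ n) {σ : triField 2 q (r * s) ≃ₐ[ℚ] triField 2 q (r * s)}
    {i j k : ℤˣ} (hσ : ActsBy σ i j k) {E : triField 2 q (r * s)} (hE : (E : ℝ) = fundUnit d)
    {M : IntermediateField ℚ ℝ} (hM : i ^ l * j ^ m * k ^ n = 1 → quadField d ≤ M) :
    IsClass M (absNorm σ E) (mono q r s 0 0 0 0) := by
  rw [absNorm_fundUnit_eq hd hd' hσ hE]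
  split_ifs with h
  · exact ⟨fundUnit d, hM h (mem_unitGroup_iff.1 (fundUnit_mem hd)).1, by simp [mono]⟩
  · exact isClass_one M q r s

theorem isClass_absNorm_of_moved {d : ℕ} (hd : Admissible d) {l m n : ℕ}
    (hd' : d = 2 ^ l * q ^ m * (r * s) ^ n) {σ : triField 2 q (r * s) ≃ₐ[ℚ] triField 2 q (r * s)}
    {i j k : ℤˣ} (hσ : ActsBy σ i j k) {U : triField 2 q (r * s)} (hU : (U : ℝ) ^ 2 = fundUnit d)
    (M : IntermediateField ℚ ℝ) (h : i ^ l * j ^ m * k ^ n ≠ 1) :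
    IsClass M (absNorm σ U) (mono q r s 0 0 0 0) := by
  rw [absNorm_sqrt_fundUnit_eq hd hd' hσ hU, if_neg h]
  exact isClass_one M q r s

theorem HasClass.isClass {d m : ℕ} (h : HasClass d m) {M : IntermediateField ℚ ℝ}
    (hM : quadField d ≤ M) : IsClass M (fundUnit d) m := by
  obtain ⟨w, hw, hw2⟩ := h
  exact ⟨w, hM hw, hw2.symm⟩

theorem isClass_absNorm_of_fixed {d c : ℕ} (hd : Admissible d) {l m n : ℕ}
    (hd' : d = 2 ^ l * q ^ m * (r * s) ^ n) {σ : triField 2 q (r * s) ≃ₐ[ℚ] triField 2 q (r * s)}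
    {i j k : ℤˣ} (hσ : ActsBy σ i j k) {U : triField 2 q (r * s)} (hU : (U : ℝ) ^ 2 = fundUnit d)
    {M : IntermediateField ℚ ℝ} (h : i ^ l * j ^ m * k ^ n = 1) (hM : quadField d ≤ M)
    (hc : HasClass d c) : IsClass M (absNorm σ U) c := by
  rw [absNorm_sqrt_fundUnit_eq hd hd' hσ hU, if_pos h]
  exact hc.isClass hM

variable [Fact q.Prime] [Fact r.Prime] [Fact s.Prime]

namespace PrimeTriple

theorem exists_aut (h : PrimeTriple e q r s) (i j k : ℤˣ) :
    ∃ g : triField 2 q (r * s) ≃ₐ[ℚ] triField 2 q (r * s), ActsBy g i j k := by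
  have hs := fun d : ℕ => Real.sq_sqrt (Nat.cast_nonneg (α := ℝ) d)
  refine exists_actsBy_of_notMem admissible_two.not_isSquare h.admissible_q.not_isSquare
    h.admissible_rs.not_isSquare ?_ ?_ ?_ i j k
  · intro hm
    have h2 : √((2 : ℕ) : ℝ) ^ 2 = (mono q r s 1 0 0 0 : ℕ) := by rw [mono_two]; exact hs 2
    rw [← mono_rs q r s] at hm
    nth_rewrite 1 [← mono_q q r s] at hm
    obtain ⟨u, v, h1, -⟩ := h.even_of_mem_sup hm h2
    simp at h1
  · intro hm
    have h2 := hs q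
    rw [← mono_rs q r s, ← mono_two q r s] at hm
    nth_rewrite 2 [← mono_q q r s] at h2
    obtain ⟨u, v, -, h1, -⟩ := h.even_of_mem_sup hm h2
    simp at h1
  · intro hm
    have h2 := hs (r * s)
    nth_rewrite 1 [← mono_q q r s] at hm
    rw [← mono_two q r s] at hm
    nth_rewrite 2 [← mono_rs q r s] at h2
    obtain ⟨u, v, -, -, h1, -⟩ := h.even_of_mem_sup hm h2
    simp at h1

/-- Apply `x ↦ |x σ(x)|` to `η² = ∏ U x ^ t x`. The left side becomes a square in `M = ℚ(√A, √B)`,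
which contains the fixed field of `σ`, and each factor on the right may be replaced by its class. So
a monomial in `2, q, r, s` is a square in `M`, and Kummer theory gives the parities. The
multiplicities `u, v` account for `√A, √B`; `r` and `s` share the exponents `n, n'` because they
enter `A` and `B` only through `rs`. A unit with exponent `0` needs no known class. -/
theorem norm_step (h : PrimeTriple e q r s)
    {σ : triField 2 q (r * s) ≃ₐ[ℚ] triField 2 q (r * s)} {i₀ j₀ k₀ : ℤˣ}
    (hσ : ActsBy σ i₀ j₀ k₀) {A B l m n l' m' n' : ℕ} (hA : A = 2 ^ l * q ^ m * (r * s) ^ n)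
    (hB : B = 2 ^ l' * q ^ m' * (r * s) ^ n')
    (hsig : ∀ i j k : ℤˣ, i ^ l * j ^ m * k ^ n = 1 → i ^ l' * j ^ m' * k ^ n' = 1 →
      (i = 1 ∧ j = 1 ∧ k = 1) ∨ (i = i₀ ∧ j = j₀ ∧ k = k₀))
    {U : Fin 7 → triField 2 q (r * s)} {t : Fin 7 → ℕ} {η : triField 2 q (r * s)}
    (hU : ∀ x, U x ≠ 0) (hη : η ^ 2 = ∏ x, U x ^ t x) (I J K L : Fin 7 → ℕ)
    (hN : ∀ x, t x = 0 ∨ IsClass (quadField A ⊔ quadField B) (absNorm σ (U x))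
      (mono q r s (I x) (J x) (K x) (L x))) :
    ∃ u v : ℕ, Even (l * u + (l' * v + ∑ x, I x * t x)) ∧
      Even (m * u + (m' * v + ∑ x, J x * t x)) ∧
      Even (n * u + (n' * v + ∑ x, K x * t x)) ∧ Even (n * u + (n' * v + ∑ x, L x * t x)) := by
  have s2 := admissible_two.not_isSquare
  have sq' := h.admissible_q.not_isSquare
  have srs := h.admissible_rs.not_isSquare
  have := finiteDimensional_triField s2 sq' srs
  have := isGalois_triField s2 sq' srs
  set M := quadField A ⊔ quadField B with hM
  have p2 : (2 : ℕ) ≠ 0 := two_ne_zero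
  have pq := h.prime_q.pos.ne'
  have prs : r * s ≠ 0 := mul_ne_zero h.prime_r.pos.ne' h.prime_s.pos.ne'
  -- The assumption on signs says that only `1` and `σ` fix both `√A` and `√B`.
  have hfix : ∀ w : triField 2 q (r * s), σ w = w → (w : ℝ) ∈ M := by
    intro w hw
    refine mem_of_fixed (x := genMonomial 2 q (r * s) l m n)
      (y := genMonomial 2 q (r * s) l' m' n') (by rw [coe_genMonomial, hA])
      (by rw [coe_genMonomial, hB]) (fun g h1 h2 => ?_) hw
    obtain ⟨i, j, k, hg⟩ := exists_actsBy g
    rw [hg.apply_genMonomial] at h1 h2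
    rcases hsig i j k (sign_eq_one_of_fixed (genMonomial_ne_zero p2 pq prs _ _ _) h1)
      (sign_eq_one_of_fixed (genMonomial_ne_zero p2 pq prs _ _ _) h2) with
      ⟨rfl, rfl, rfl⟩ | ⟨rfl, rfl, rfl⟩
    · exact .inl (hg.ext ActsBy.one)
    · exact .inr (hg.ext hσ)
  obtain ⟨κ, hκ, hκ2⟩ := exists_sq_eq_absNorm hσ.involutive hfix hη
  have hprod : absNorm σ (∏ x, U x ^ t x) = ∏ x, absNorm σ (U x) ^ t x := by
    have : ∀ S : Finset (Fin 7), absNorm σ (∏ x ∈ S, U x ^ t x) =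
        ∏ x ∈ S, absNorm σ (U x) ^ t x := by
      intro S
      induction S using Finset.induction_on with
      | empty => simp [absNorm]
      | insert a S ha ih =>
        rw [Finset.prod_insert ha, Finset.prod_insert ha, absNorm_mul, absNorm_pow, ih]
    exact this _
  have hw : ∀ x, ∃ w ∈ M, w ^ 2 = ((mono q r s (I x) (J x) (K x) (L x) : ℕ) : ℝ) ^ t x *
      absNorm σ (U x) ^ t x := by
    intro x
    rcases hN x with h0 | ⟨w, hw, hw2⟩
    · exact ⟨1, one_mem M, by simp [h0]⟩
    · exact ⟨w ^ t x, pow_mem hw _, by rw [← pow_mul, mul_comm, pow_mul, hw2, mul_pow]⟩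
  choose w hwM hw2 using hw
  have hpos : ∏ x, absNorm σ (U x) ^ t x ≠ 0 := by
    refine Finset.prod_ne_zero_iff.2 fun x _ => pow_ne_zero _ ?_
    rw [absNorm, abs_ne_zero]
    refine mul_ne_zero ?_ ?_
    · exact_mod_cast hU x
    · have : σ (U x) ≠ 0 := by simpa using hU x
      exact_mod_cast this
  rw [hprod] at hκ2
  -- Dividing by `κ`, a square root of the norm of the product, leaves only the monomial under the
  -- square.
  have hz : ((∏ x, w x) / κ) ^ 2 = mono q r s (∑ x, I x * t x) (∑ x, J x * t x)
      (∑ x, K x * t x) (∑ x, L x * t x) := by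
    rw [div_pow, hκ2, ← Finset.prod_pow, Finset.prod_congr rfl fun x _ => hw2 x,
      Finset.prod_mul_distrib, mul_div_assoc, div_self hpos, mul_one, ← mono_prod]
    push_cast
    rfl
  have hzM : (∏ x, w x) / κ ∈ M := div_mem (prod_mem fun x _ => hwM x) hκ
  have e1 : A = mono q r s l m n n := by rw [hA, mono, mul_pow]; ring
  have e2 : B = mono q r s l' m' n' n' := by rw [hB, mono, mul_pow]; ring
  rw [hM, e1, e2] at hzM
  exact h.even_of_mem_sup hzM hz

end PrimeTriple

end Saturation

end RealUnits

end

noncomputable section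

namespace RealUnits

/-! ### Vanishing of the seven exponents. -/

section Saturated

attribute [local instance] algebraRat

variable {e : ℤ} {ν ρ q r s : ℕ}

/-- The primes `q, r, s` together with the square classes of `ε_{νqrs}` and `ε_{ρqrs}`. -/
structure Setting (e : ℤ) (ν ρ q r s : ℕ) [Fact q.Prime] [Fact r.Prime] [Fact s.Prime] :
    Prop where
  triple : PrimeTriple e q r s
  cases : (ν = 1 ∧ ρ = 2) ∨ (ν = 2 ∧ ρ = 1)
  class_ρ : HasClass (ρ * q * r * s) (r * s)
  class_ν : ∃ i j k l, HasClass (ν * q * r * s) (mono q r s i j k l) ∧ Odd (k + l)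

/-- `U` consists of `ε₂, ε_{rs}` and square roots of
`ε_q, ε_{2q}, ε_{2rs}, ε_{rs} ε_{νqrs}, ε_{ρqrs}`. -/
structure UnitSystem (ν ρ q r s : ℕ) (U : Fin 7 → triField 2 q (r * s)) : Prop where
  h0 : (U 0 : ℝ) = fundUnit 2
  h1 : (U 1 : ℝ) = fundUnit (r * s)
  h2 : (U 2 : ℝ) ^ 2 = fundUnit q
  h3 : (U 3 : ℝ) ^ 2 = fundUnit (2 * q)
  h4 : (U 4 : ℝ) ^ 2 = fundUnit (2 * r * s)
  h5 : (U 5 : ℝ) ^ 2 = fundUnit (r * s) * fundUnit (ν * q * r * s)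
  h6 : (U 6 : ℝ) ^ 2 = fundUnit (ρ * q * r * s)

theorem UnitSystem.ne_zero {U : Fin 7 → triField 2 q (r * s)} (hU : UnitSystem ν ρ q r s U)
    (x : Fin 7) : U x ≠ 0 := by
  have key : ∀ {w : triField 2 q (r * s)} {u : ℝˣ}, (w : ℝ) ^ 2 = u → w ≠ 0 := by
    rintro _ u h rfl
    exact u.ne_zero (by rw [← h]; simp)
  have key' : ∀ {w : triField 2 q (r * s)} {u : ℝˣ}, (w : ℝ) = u → w ≠ 0 := by
    rintro _ u h rfl
    exact u.ne_zero (by rw [← h]; simp)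
  fin_cases x
  · exact key' hU.h0
  · exact key' hU.h1
  · exact key hU.h2
  · exact key hU.h3
  · exact key hU.h4
  · exact key (u := fundUnit (r * s) * fundUnit (ν * q * r * s)) (by push_cast; exact hU.h5)
  · exact key hU.h6

theorem quadField_mul_le {d m n : ℕ} (h : d = m * n) : quadField d ≤ quadField m ⊔ quadField n := by
  subst h
  exact le_of_sqrt_mem (sqrt_mul_mem (le_sup_left (a := quadField m) (sqrt_mem_quadField m))
    (le_sup_right (a := quadField m) (sqrt_mem_quadField n)))

theorem quadField_le_left {d m n : ℕ} (h : d = m) : quadField d ≤ quadField m ⊔ quadField n :=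
  h ▸ le_sup_left

theorem quadField_le_right {d m n : ℕ} (h : d = n) : quadField d ≤ quadField m ⊔ quadField n :=
  h ▸ le_sup_right

variable [Fact q.Prime] [Fact r.Prime] [Fact s.Prime]

theorem Setting.admissible_ν (S : Setting e ν ρ q r s) : Admissible (ν * q * r * s) := by
  rcases S.cases with ⟨rfl, -⟩ | ⟨rfl, -⟩
  · exact S.triple.admissible_qrs
  · exact S.triple.admissible_two_qrs

theorem Setting.admissible_ρ (S : Setting e ν ρ q r s) : Admissible (ρ * q * r * s) := by
  rcases S.cases with ⟨-, rfl⟩ | ⟨-, rfl⟩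
  · exact S.triple.admissible_two_qrs
  · exact S.triple.admissible_qrs

/-- Here `σ` fixes `ε_{rs}` and moves `√d`, so the norm of `√(ε_{rs} ε_d)` is `ε_{rs}` up to sign,
which has class `s`. -/
theorem isClass_absNorm_mul (h : PrimeTriple e q r s) {d : ℕ} (hd : Admissible d) {l m n : ℕ}
    (hd' : d = 2 ^ l * q ^ m * (r * s) ^ n) {σ : triField 2 q (r * s) ≃ₐ[ℚ] triField 2 q (r * s)}
    {i j k : ℤˣ} (hσ : ActsBy σ i j k) {U : triField 2 q (r * s)}
    (hU : (U : ℝ) ^ 2 = fundUnit (r * s) * fundUnit d)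
    {M : IntermediateField ℚ ℝ} (hM : quadField (r * s) ≤ M) (h1 : k = 1)
    (h2 : i ^ l * j ^ m * k ^ n ≠ 1) : IsClass M (absNorm σ U) (mono q r s 0 0 0 1) := by
  have hmem : ((fundUnit (r * s) : ℝˣ) : ℝ) ∈ triField 2 q (r * s) :=
    le_of_sqrt_mem (sqrt_right_mem_triField (a := 2) (b := q))
      (mem_unitGroup_iff.1 (fundUnit_mem h.admissible_rs)).1
  have hmem' : ((fundUnit d : ℝˣ) : ℝ) ∈ triField 2 q (r * s) := by
    have : quadField d ≤ triField 2 q (r * s) := le_of_sqrt_mem (by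
      rw [hd', ← coe_genMonomial]; exact Subtype.coe_prop _)
    exact this (mem_unitGroup_iff.1 (fundUnit_mem hd)).1
  have hN : absNorm σ U = fundUnit (r * s) := by
    refine absNorm_sqrt (fundUnit_pos h.admissible_rs).le (y := ⟨_, hmem⟩ * ⟨_, hmem'⟩)
      (Subtype.ext hU) ?_
    rw [absNorm_mul, absNorm_fundUnit_eq h.admissible_rs (l := 0) (m := 0) (n := 1) (by simp) hσ
      rfl, absNorm_fundUnit_eq hd hd' hσ rfl, if_neg h2, if_pos (by simp [h1]), mul_one]
  rw [hN, mono_s]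
  exact h.hasClass_rs.isClass hM

/-- Over `ℚ(√(2q), √(rs))` the surviving classes are `2` for `√ε_{2q}`, `s` for `√(ε_{rs} ε_{qrs})`
and `rs` for `√ε_{2qrs}`. A square class generated by `2q` and `rs` has equal parities at `r, s` and
at `2, q`, so `t 5` and `t 3` vanish. Then over `ℚ(√q, √(rs))` only the class `2` of `√ε_q` remains.
-/
theorem exponents_of_one_two (S : Setting e 1 2 q r s) {U : Fin 7 → triField 2 q (r * s)}
    (hU : UnitSystem 1 2 q r s U) {t : Fin 7 → ℕ} (ht : ∀ x, t x < 2)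
    {η : triField 2 q (r * s)} (hη : η ^ 2 = ∏ x, U x ^ t x) : t 5 = 0 ∧ t 3 = 0 ∧ t 2 = 0 := by
  have h := S.triple
  have A : t 5 = 0 ∧ t 3 = 0 := by
    obtain ⟨σ, hσ⟩ := h.exists_aut (-1) (-1) 1
    obtain ⟨u, v, e1, e2, e3, e4⟩ := h.norm_step hσ (A := 2 * q) (B := r * s) (l := 1) (m := 1)
      (n := 0) (l' := 0) (m' := 0) (n' := 1) (by simp) (by simp) (by decide) hU.ne_zero hη
      ![0, 0, 0, 1, 0, 0, 0] ![0, 0, 0, 0, 0, 0, 0] ![0, 0, 0, 0, 0, 0, 1] ![0, 0, 0, 0, 0, 1, 1]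
      (by
        intro x
        right
        fin_cases x
        · exact isClass_absNorm_fundUnit admissible_two (l := 1) (m := 0) (n := 0) (by simp) hσ
            hU.h0 (fun h => absurd h (by decide))
        · exact isClass_absNorm_fundUnit h.admissible_rs (l := 0) (m := 0) (n := 1) (by simp) hσ
            hU.h1 (fun _ => quadField_le_right rfl)
        · exact isClass_absNorm_of_moved h.admissible_q (l := 0) (m := 1) (n := 0) (by simp) hσ
            hU.h2 _ (by decide)
        · exact isClass_absNorm_of_fixed h.admissible_two_q (l := 1) (m := 1) (n := 0) (by simp) hσ
            hU.h3 (by decide) (quadField_le_left rfl) ((mono_two q r s).symm ▸ h.hasClass_two_q)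
        · exact isClass_absNorm_of_moved h.admissible_two_rs (l := 1) (m := 0) (n := 1)
            (by simp [mul_assoc]) hσ hU.h4 _ (by decide)
        · exact isClass_absNorm_mul h S.admissible_ν (l := 0) (m := 1) (n := 1)
            (by simp [mul_assoc]) hσ hU.h5 (quadField_le_right rfl) rfl (by decide)
        · exact isClass_absNorm_of_fixed S.admissible_ρ (l := 1) (m := 1) (n := 1)
            (by simp [mul_assoc]) hσ hU.h6 (by decide) (quadField_mul_le (by ring))
            ((mono_rs q r s).symm ▸ S.class_ρ))
    simp [Fin.sum_univ_seven, Nat.even_iff] at e1 e2 e3 e4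
    have := ht 5
    have := ht 3
    omega
  obtain ⟨t5, t3⟩ := A
  refine ⟨t5, t3, ?_⟩
  obtain ⟨σ, hσ⟩ := h.exists_aut (-1) 1 1
  obtain ⟨u, v, e1, e2, e3, e4⟩ := h.norm_step hσ (A := q) (B := r * s) (l := 0) (m := 1)
    (n := 0) (l' := 0) (m' := 0) (n' := 1) (by simp) (by simp) (by decide) hU.ne_zero hη
    ![0, 0, 1, 0, 0, 0, 0] ![0, 0, 0, 0, 0, 0, 0] ![0, 0, 0, 0, 0, 0, 0] ![0, 0, 0, 0, 0, 0, 0]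
    (by
      intro x
      fin_cases x
      · exact .inr (isClass_absNorm_fundUnit admissible_two (l := 1) (m := 0) (n := 0) (by simp) hσ
          hU.h0 (fun h => absurd h (by decide)))
      · exact .inr (isClass_absNorm_fundUnit h.admissible_rs (l := 0) (m := 0) (n := 1) (by simp) hσ
          hU.h1 (fun _ => quadField_le_right rfl))
      · exact .inr (isClass_absNorm_of_fixed h.admissible_q (l := 0) (m := 1) (n := 0) (by simp) hσ
          hU.h2 (by decide) (quadField_le_left rfl) ((mono_two q r s).symm ▸ h.hasClass_q))
      · exact .inl t3
      · exact .inr (isClass_absNorm_of_moved h.admissible_two_rs (l := 1) (m := 0) (n := 1)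
          (by simp [mul_assoc]) hσ hU.h4 _ (by decide))
      · exact .inl t5
      · exact .inr (isClass_absNorm_of_moved S.admissible_ρ (l := 1) (m := 1) (n := 1)
          (by simp [mul_assoc]) hσ hU.h6 _ (by decide)))
  simp [Fin.sum_univ_seven, Nat.even_iff] at e1 e2 e3 e4
  have := ht 2
  omega

/-- The two involutions are used in the opposite order: now `√(2qrs)` belongs to `ε_{νqrs}`, and it
must be moved when `t 5` is tested, which the flip of `√2` alone achieves. -/
theorem exponents_of_two_one (S : Setting e 2 1 q r s) {U : Fin 7 → triField 2 q (r * s)}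
    (hU : UnitSystem 2 1 q r s U) {t : Fin 7 → ℕ} (ht : ∀ x, t x < 2)
    {η : triField 2 q (r * s)} (hη : η ^ 2 = ∏ x, U x ^ t x) : t 5 = 0 ∧ t 3 = 0 ∧ t 2 = 0 := by
  have h := S.triple
  have A : t 5 = 0 ∧ t 2 = 0 := by
    obtain ⟨σ, hσ⟩ := h.exists_aut (-1) 1 1
    obtain ⟨u, v, e1, e2, e3, e4⟩ := h.norm_step hσ (A := q) (B := r * s) (l := 0) (m := 1)
      (n := 0) (l' := 0) (m' := 0) (n' := 1) (by simp) (by simp) (by decide) hU.ne_zero hη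
      ![0, 0, 1, 0, 0, 0, 0] ![0, 0, 0, 0, 0, 0, 0] ![0, 0, 0, 0, 0, 0, 1] ![0, 0, 0, 0, 0, 1, 1]
      (by
        intro x
        right
        fin_cases x
        · exact isClass_absNorm_fundUnit admissible_two (l := 1) (m := 0) (n := 0) (by simp) hσ
            hU.h0 (fun h => absurd h (by decide))
        · exact isClass_absNorm_fundUnit h.admissible_rs (l := 0) (m := 0) (n := 1) (by simp) hσ
            hU.h1 (fun _ => quadField_le_right rfl)
        · exact isClass_absNorm_of_fixed h.admissible_q (l := 0) (m := 1) (n := 0) (by simp) hσ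
            hU.h2 (by decide) (quadField_le_left rfl) ((mono_two q r s).symm ▸ h.hasClass_q)
        · exact isClass_absNorm_of_moved h.admissible_two_q (l := 1) (m := 1) (n := 0) (by simp) hσ
            hU.h3 _ (by decide)
        · exact isClass_absNorm_of_moved h.admissible_two_rs (l := 1) (m := 0) (n := 1)
            (by simp [mul_assoc]) hσ hU.h4 _ (by decide)
        · exact isClass_absNorm_mul h S.admissible_ν (l := 1) (m := 1) (n := 1)
            (by simp [mul_assoc]) hσ hU.h5 (quadField_le_right rfl) rfl (by decide)
        · exact isClass_absNorm_of_fixed S.admissible_ρ (l := 0) (m := 1) (n := 1)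
            (by simp [mul_assoc]) hσ hU.h6 (by decide) (quadField_mul_le (by ring))
            ((mono_rs q r s).symm ▸ S.class_ρ))
    simp [Fin.sum_univ_seven, Nat.even_iff] at e1 e2 e3 e4
    have := ht 5
    have := ht 2
    omega
  obtain ⟨t5, t2⟩ := A
  refine ⟨t5, ?_, t2⟩
  obtain ⟨σ, hσ⟩ := h.exists_aut (-1) (-1) 1
  obtain ⟨u, v, e1, e2, e3, e4⟩ := h.norm_step hσ (A := 2 * q) (B := r * s) (l := 1) (m := 1)
    (n := 0) (l' := 0) (m' := 0) (n' := 1) (by simp) (by simp) (by decide) hU.ne_zero hη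
    ![0, 0, 0, 1, 0, 0, 0] ![0, 0, 0, 0, 0, 0, 0] ![0, 0, 0, 0, 0, 0, 0] ![0, 0, 0, 0, 0, 0, 0]
    (by
      intro x
      fin_cases x
      · exact .inr (isClass_absNorm_fundUnit admissible_two (l := 1) (m := 0) (n := 0) (by simp) hσ
          hU.h0 (fun h => absurd h (by decide)))
      · exact .inr (isClass_absNorm_fundUnit h.admissible_rs (l := 0) (m := 0) (n := 1) (by simp) hσ
          hU.h1 (fun _ => quadField_le_right rfl))
      · exact .inl t2
      · exact .inr (isClass_absNorm_of_fixed h.admissible_two_q (l := 1) (m := 1) (n := 0) (by simp)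
          hσ hU.h3 (by decide) (quadField_le_left rfl)
          ((mono_two q r s).symm ▸ h.hasClass_two_q))
      · exact .inr (isClass_absNorm_of_moved h.admissible_two_rs (l := 1) (m := 0) (n := 1)
          (by simp [mul_assoc]) hσ hU.h4 _ (by decide))
      · exact .inl t5
      · exact .inr (isClass_absNorm_of_moved S.admissible_ρ (l := 0) (m := 1) (n := 1)
          (by simp [mul_assoc]) hσ hU.h6 _ (by decide)))
  simp [Fin.sum_univ_seven, Nat.even_iff] at e1 e2 e3 e4
  have := ht 3
  omega

/-- Over `ℚ(√2, √(qrs))` only the class `rs` of `√ε_{ρqrs}` remains, and matching it would need the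
factor `qrs`, hence an odd exponent at `q`. -/
theorem last_exponent_eq_zero (S : Setting e ν ρ q r s) {U : Fin 7 → triField 2 q (r * s)}
    (hU : UnitSystem ν ρ q r s U) {t : Fin 7 → ℕ} (ht : ∀ x, t x < 2)
    {η : triField 2 q (r * s)} (hη : η ^ 2 = ∏ x, U x ^ t x) (t5 : t 5 = 0) : t 6 = 0 := by
  have h := S.triple
  obtain ⟨l, hl⟩ : ∃ l, ρ = 2 ^ l := by
    rcases S.cases with ⟨-, rfl⟩ | ⟨-, rfl⟩
    · exact ⟨1, rfl⟩
    · exact ⟨0, rfl⟩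
  have hρ : ρ * q * r * s = 2 ^ l * q ^ 1 * (r * s) ^ 1 := by rw [hl]; ring
  obtain ⟨σ, hσ⟩ := h.exists_aut 1 (-1) (-1)
  have hle : quadField (ρ * q * r * s) ≤ quadField 2 ⊔ quadField (1 * q * r * s) := by
    rcases S.cases with ⟨-, rfl⟩ | ⟨-, rfl⟩
    · exact quadField_mul_le (by ring)
    · exact quadField_le_right rfl
  obtain ⟨u, v, e1, e2, e3, e4⟩ := h.norm_step hσ (A := 2) (B := 1 * q * r * s) (l := 1)
    (m := 0) (n := 0) (l' := 0) (m' := 1) (n' := 1) (by simp) (by ring) (by decide) hU.ne_zero hη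
    ![0, 0, 0, 0, 0, 0, 0] ![0, 0, 0, 0, 0, 0, 0] ![0, 0, 0, 0, 0, 0, 1] ![0, 0, 0, 0, 0, 0, 1]
    (by
      intro x
      fin_cases x
      · exact .inr (isClass_absNorm_fundUnit admissible_two (l := 1) (m := 0) (n := 0) (by simp) hσ
          hU.h0 (fun _ => quadField_le_left rfl))
      · exact .inr (isClass_absNorm_fundUnit h.admissible_rs (l := 0) (m := 0) (n := 1) (by simp) hσ
          hU.h1 (fun h => absurd h (by decide)))
      · exact .inr (isClass_absNorm_of_moved h.admissible_q (l := 0) (m := 1) (n := 0) (by simp) hσ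
          hU.h2 _ (by decide))
      · exact .inr (isClass_absNorm_of_moved h.admissible_two_q (l := 1) (m := 1) (n := 0) (by simp)
          hσ hU.h3 _ (by decide))
      · exact .inr (isClass_absNorm_of_moved h.admissible_two_rs (l := 1) (m := 0) (n := 1)
          (by simp [mul_assoc]) hσ hU.h4 _ (by decide))
      · exact .inl t5
      · exact .inr (isClass_absNorm_of_fixed S.admissible_ρ hρ hσ hU.h6 (by simp) hle
          ((mono_rs q r s).symm ▸ S.class_ρ)))
  simp [Fin.sum_univ_seven, Nat.even_iff] at e1 e2 e3 e4
  have := ht 6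
  omega

/-- Over `ℚ(√q, √(2rs))` the class `rs` of `√ε_{2rs}` could only be matched by `2rs`, which leaves
an odd exponent at `2`. -/
theorem fourth_exponent_eq_zero (S : Setting e ν ρ q r s) {U : Fin 7 → triField 2 q (r * s)}
    (hU : UnitSystem ν ρ q r s U) {t : Fin 7 → ℕ} (ht : ∀ x, t x < 2)
    {η : triField 2 q (r * s)} (hη : η ^ 2 = ∏ x, U x ^ t x) (t2 : t 2 = 0) (t5 : t 5 = 0)
    (t6 : t 6 = 0) : t 4 = 0 := by
  have h := S.triple
  obtain ⟨σ, hσ⟩ := h.exists_aut (-1) 1 (-1)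
  obtain ⟨u, v, e1, e2, e3, e4⟩ := h.norm_step hσ (A := q) (B := 2 * r * s) (l := 0)
    (m := 1) (n := 0) (l' := 1) (m' := 0) (n' := 1) (by simp) (by ring) (by decide) hU.ne_zero hη
    ![0, 0, 0, 0, 0, 0, 0] ![0, 0, 0, 0, 0, 0, 0] ![0, 0, 0, 0, 1, 0, 0] ![0, 0, 0, 0, 1, 0, 0]
    (by
      intro x
      fin_cases x
      · exact .inr (isClass_absNorm_fundUnit admissible_two (l := 1) (m := 0) (n := 0) (by simp) hσ
          hU.h0 (fun h => absurd h (by decide)))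
      · exact .inr (isClass_absNorm_fundUnit h.admissible_rs (l := 0) (m := 0) (n := 1) (by simp) hσ
          hU.h1 (fun h => absurd h (by decide)))
      · exact .inl t2
      · exact .inr (isClass_absNorm_of_moved h.admissible_two_q (l := 1) (m := 1) (n := 0) (by simp)
          hσ hU.h3 _ (by decide))
      · exact .inr (isClass_absNorm_of_fixed h.admissible_two_rs (l := 1) (m := 0) (n := 1)
          (by simp [mul_assoc]) hσ hU.h4 (by decide) (quadField_le_right rfl)
          ((mono_rs q r s).symm ▸ h.hasClass_two_rs))
      · exact .inl t5
      · exact .inl t6)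
  simp [Fin.sum_univ_seven, Nat.even_iff] at e1 e2 e3 e4
  have := ht 4
  omega

/-- No nontrivial product of the units in the system with exponents `0, 1` is a square. -/
theorem exponents_eq_zero (S : Setting e ν ρ q r s) {U : Fin 7 → triField 2 q (r * s)}
    (hU : UnitSystem ν ρ q r s U) {t : Fin 7 → ℕ} (ht : ∀ x, t x < 2)
    {η : triField 2 q (r * s)} (hη : η ^ 2 = ∏ x, U x ^ t x) (x : Fin 7) : t x = 0 := by
  have h := S.triple
  have A : t 5 = 0 ∧ t 3 = 0 ∧ t 2 = 0 := by
    rcases S.cases with ⟨rfl, rfl⟩ | ⟨rfl, rfl⟩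
    · exact exponents_of_one_two S hU ht hη
    · exact exponents_of_two_one S hU ht hη
  obtain ⟨t5, t3, t2⟩ := A
  have t6 := last_exponent_eq_zero S hU ht hη t5
  have t4 := fourth_exponent_eq_zero S hU ht hη t2 t5 t6
  have hη' : η ^ 2 = U 0 ^ t 0 * U 1 ^ t 1 := by
    rw [hη, Fin.prod_univ_seven, t2, t3, t4, t5, t6]; simp
  -- Flipping `√2` sends `η² = ε₂ ε_{rs}^{t₁}` to a square equal to `-1` times a positive square.
  have t0 : t 0 = 0 := by
    by_contra hne
    have h01 : t 0 = 1 := by have := ht 0; omega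
    rw [h01, pow_one] at hη'
    obtain ⟨σ, hσ⟩ := h.exists_aut (-1) 1 1
    obtain ⟨m, n, hmn, hnorm⟩ := fundUnit_two_coords
    have hm := mul_apply_of_moved (d := 2) (σ := σ) (x := gen₁ 2 q (r * s)) (E := U 0) (m := m)
      (n := n) rfl (by rw [hU.h0, hmn]; simp) (by rw [hσ.fst]; simp)
    have hfix : σ (U 1) = U 1 := by
      obtain ⟨c, d, hcd⟩ := mem_quadField_iff.1
        (mem_unitGroup_iff.1 (fundUnit_mem h.admissible_rs)).1
      have hE' : U 1 = algebraMap ℚ (triField 2 q (r * s)) c +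
          algebraMap ℚ (triField 2 q (r * s)) d * gen₃ 2 q (r * s) := by
        apply Subtype.ext
        rw [hU.h1, hcd]; rfl
      rw [hE', map_add, map_mul, AlgEquiv.commutes, AlgEquiv.commutes, hσ.trd]
      simp
    have h2 : (η * σ η) ^ 2 = (U 0 * σ (U 0)) * (U 1 ^ t 1) ^ 2 := by
      rw [mul_pow, ← map_pow, hη', map_mul, map_pow, hfix]; ring
    have h3 := congrArg (fun w : triField 2 q (r * s) => (w : ℝ)) h2
    simp only [IntermediateField.coe_mul, IntermediateField.coe_pow, hm] at h3
    rw [show m ^ 2 - ((2 : ℕ) : ℤ) * n ^ 2 = -1 by exact_mod_cast hnorm] at h3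
    have h4 : (0 : ℝ) < (((U 1 : triField 2 q (r * s)) : ℝ) ^ t 1) ^ 2 := by
      have : ((U 1 : triField 2 q (r * s)) : ℝ) ≠ 0 := by
        rw [hU.h1]; exact (fundUnit _).ne_zero
      positivity
    have h5 := sq_nonneg ((η : ℝ) * (σ η : ℝ))
    push_cast at h3
    linarith
  -- If `ε_{rs}` were a square in the field, its class `s` would give `√s` there, but `r` and `s`
  -- only occur together.
  have t1 : t 1 = 0 := by
    by_contra hne
    have h11 : t 1 = 1 := by have := ht 1; omega
    rw [t0, h11, pow_zero, pow_one, one_mul] at hη'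
    obtain ⟨w, hw, hw2⟩ := h.hasClass_rs
    have hη2 : (η : ℝ) ^ 2 = fundUnit (r * s) := by
      rw [← hU.h1, ← hη']; rfl
    have hz : (w / η) ^ 2 = mono q r s 0 0 0 1 := by
      rw [div_pow, ← hw2, hη2, mul_div_assoc, div_self (fundUnit _).ne_zero, mono_s, mul_one]
    have hzK : w / η ∈ triField 2 q (r * s) :=
      div_mem (le_of_sqrt_mem (sqrt_right_mem_triField (a := 2) (b := q)) hw) η.2
    obtain ⟨m₁, m₂, m₃, -, -, e3, e4⟩ := h.even_of_mem_triField hzK hz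
    rw [Nat.even_iff] at e3 e4
    omega
  fin_cases x <;> assumption

end Saturated

end RealUnits

end

noncomputable section

namespace RealUnits

/-! ### Classification of the quadratic subfields. -/

section QuadraticSubfields

/-- Completing the square gives `(2x + b)² = D`, nonnegative since the field is real; multiplying
the root by the denominator of `D` makes its square a natural number. -/
theorem exists_sq_natCast_of_finrank {F : IntermediateField ℚ ℝ}
    (hF : Module.finrank ℚ F = 2) : ∃ y ∈ F, y ∉ (⊥ : IntermediateField ℚ ℝ) ∧
      ∃ N : ℕ, y ^ 2 = N := by
  have hbot : F ≠ ⊥ := by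
    rintro rfl
    rw [IntermediateField.finrank_bot] at hF
    norm_num at hF
  obtain ⟨x, hx, hxb⟩ : ∃ x ∈ F, x ∉ (⊥ : IntermediateField ℚ ℝ) := by
    by_contra! h
    exact hbot (le_bot_iff.1 h)
  have : FiniteDimensional ℚ F := FiniteDimensional.of_finrank_pos (by rw [hF]; norm_num)
  have hzint : IsIntegral ℚ (⟨x, hx⟩ : F) := IsIntegral.of_finite ℚ _
  have hdeg : (minpoly ℚ (⟨x, hx⟩ : F)).natDegree = 2 := by
    apply le_antisymm
    · rw [← hF]; exact minpoly.natDegree_le _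
    · rw [minpoly.two_le_natDegree_iff hzint]
      rintro ⟨t, ht⟩
      exact hxb (IntermediateField.mem_bot.2 ⟨t, congrArg Subtype.val ht⟩)
  set P := minpoly ℚ (⟨x, hx⟩ : F) with hP
  have hmon : P.coeff 2 = 1 := by
    have := minpoly.monic hzint
    rw [Polynomial.Monic, Polynomial.leadingCoeff, ← hP, hdeg] at this
    exact this
  have hroot := minpoly.aeval ℚ (⟨x, hx⟩ : F)
  rw [← hP, Polynomial.aeval_eq_sum_range, hdeg] at hroot
  have hrel : x ^ 2 + P.coeff 1 * x + P.coeff 0 = 0 := by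
    have h1 := congrArg (fun w : F => (w : ℝ)) hroot
    simp only [Finset.sum_range_succ, Finset.sum_range_zero, hmon, Algebra.smul_def] at h1
    have h2 : (0 : ℝ) + (P.coeff 0 : ℝ) * x ^ 0 + (P.coeff 1 : ℝ) * x ^ 1 + ((1 : ℚ) : ℝ) * x ^ 2
      = 0 := h1
    push_cast at h2
    linear_combination h2
  set b := P.coeff 1
  set c := P.coeff 0
  set D : ℚ := b ^ 2 - 4 * c with hD
  have hy2 : (2 * x + b) ^ 2 = (D : ℝ) := by
    rw [hD]; push_cast; linear_combination 4 * hrel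
  have hD0 : 0 ≤ D := by
    have : (0 : ℝ) ≤ D := by rw [← hy2]; positivity
    exact_mod_cast this
  have hden : (D.den : ℚ) ≠ 0 := by exact_mod_cast D.den_nz
  refine ⟨(D.den : ℝ) * (2 * x + b), ?_, ?_, D.num.natAbs * D.den, ?_⟩
  · exact mul_mem (natCast_mem F _) (add_mem (mul_mem (ofNat_mem F 2) hx) (F.algebraMap_mem b))
  · intro hm
    apply hxb
    have hdR : (D.den : ℝ) ≠ 0 := by exact_mod_cast D.den_nz
    have : x = ((D.den : ℝ) * (2 * x + b) / D.den - b) / 2 := by field_simp; ring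
    rw [this]
    exact div_mem (sub_mem (div_mem hm (natCast_mem _ _))
      ((⊥ : IntermediateField ℚ ℝ).algebraMap_mem b)) (ofNat_mem _ 2)
  · rw [mul_pow, hy2]
    have h1 : (D.den : ℚ) ^ 2 * D = ((D.num.natAbs * D.den : ℕ) : ℚ) := by
      have h2 : (D.num.natAbs : ℚ) = D.num := by
        have := congrArg (Int.cast : ℤ → ℚ) (Int.natAbs_of_nonneg (Rat.num_nonneg.2 hD0))
        rwa [Int.cast_natCast] at this
      rw [Nat.cast_mul, h2]
      nth_rewrite 2 [← Rat.num_div_den D]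
      field_simp
    exact_mod_cast congrArg (fun t : ℚ => (t : ℝ)) h1

theorem eq_quadField_of_sqrt_mem {F : IntermediateField ℚ ℝ} (hF : Module.finrank ℚ F = 2) {d : ℕ}
    (hd : ¬ IsSquare d) (h : √(d : ℝ) ∈ F) : F = quadField d := by
  have : FiniteDimensional ℚ F := FiniteDimensional.of_finrank_pos (by rw [hF]; norm_num)
  exact (IntermediateField.eq_of_le_of_finrank_eq (le_of_sqrt_mem h)
    (by rw [finrank_quadField hd, hF])).symm

/-- A quadratic subfield of `ℚ(√a, √b, √c)` is generated by a square root of a product of some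
of `a, b, c`. -/
theorem sqrt_mem_of_finrank {a b c : ℕ} {F : IntermediateField ℚ ℝ} (hFK : F ≤ triField a b c) (hF : Module.finrank ℚ F = 2) :
    ∃ d ∈ [a, b, a * b, c, a * c, b * c, a * b * c], √(d : ℝ) ∈ F := by
  obtain ⟨y, hy, hyb, N, hN⟩ := exists_sq_natCast_of_finrank hF
  have hyK := hFK hy
  rw [triField] at hyK
  obtain ⟨n₁, l₁, y₁, hy₁, h₁⟩ := exists_pow_mul_sq hyK hN
  obtain ⟨n₂, l₂, y₂, hy₂, h₂⟩ := exists_pow_mul_sq hy₁ h₁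
  rw [← bot_sup_eq (quadField _)] at hy₂
  obtain ⟨n₃, l₃, y₃, hy₃, h₃⟩ := exists_pow_mul_sq hy₂ h₂
  have hy0 : y ≠ 0 := by rintro rfl; exact hyb (zero_mem _)
  -- The quotient of the rational number `y₃` by `y` is `±√d`, so `√d` is in `F`.
  have hmem : ∀ d : ℕ, a ^ n₃ * (b ^ n₂ * (c ^ n₁ * N)) = d * N → √(d : ℝ) ∈ F := by
    intro d hd
    have h4 : (y₃ / y) ^ 2 = √(d : ℝ) ^ 2 := by
      rw [Real.sq_sqrt (Nat.cast_nonneg d), div_pow, h₃, hd, hN]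
      have : (N : ℝ) ≠ 0 := by rw [← hN]; positivity
      push_cast
      field_simp
    have h5 : y₃ / y ∈ F := div_mem ((bot_le : ⊥ ≤ F) hy₃) hy
    rcases sq_eq_sq_iff_eq_or_eq_neg.1 h4 with h6 | h6
    · exact h6 ▸ h5
    · rw [← neg_neg √(d : ℝ), ← h6]; exact neg_mem h5
  interval_cases n₁ <;> interval_cases n₂ <;> interval_cases n₃
  -- With all three exponents zero, `y = ±y₃` would be rational.
  · exfalso
    apply hyb
    have h4 : y₃ ^ 2 = y ^ 2 := by rw [h₃, hN]; simp
    rcases sq_eq_sq_iff_eq_or_eq_neg.1 h4 with h6 | h6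
    · exact h6 ▸ hy₃
    · rw [← neg_neg y, ← h6]; exact neg_mem hy₃
  · exact ⟨a, by simp, hmem a (by ring)⟩
  · exact ⟨b, by simp, hmem b (by ring)⟩
  · exact ⟨a * b, by simp, hmem (a * b) (by ring)⟩
  · exact ⟨c, by simp, hmem c (by ring)⟩
  · exact ⟨a * c, by simp, hmem (a * c) (by ring)⟩
  · exact ⟨b * c, by simp, hmem (b * c) (by ring)⟩
  · exact ⟨a * b * c, by simp, hmem (a * b * c) (by ring)⟩

end QuadraticSubfields

/-! ### Groups generated by `-1` and positive real units. -/

section SignedProducts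

variable {n : ℕ}

/-- The homomorphism `(e, p) ↦ e ∏ uᵢ^pᵢ`. -/
def signedHom (u : Fin n → ℝˣ) : ℤˣ × Multiplicative (Fin n → ℤ) →* ℝˣ where
  toFun x := Units.map (Int.castRingHom ℝ : ℤ →* ℝ) x.1 * ∏ i, u i ^ x.2.toAdd i
  map_one' := by simp
  map_mul' x y := by
    simp only [Prod.fst_mul, map_mul, Prod.snd_mul, toAdd_mul, Pi.add_apply, zpow_add,
      Finset.prod_mul_distrib]
    exact mul_mul_mul_comm _ _ _ _

theorem signedHom_apply (u : Fin n → ℝˣ) (e : ℤˣ) (p : Fin n → ℤ) :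
    signedHom u (e, .ofAdd p) = Units.map (Int.castRingHom ℝ : ℤ →* ℝ) e * ∏ i, u i ^ p i := rfl

theorem map_intCast_neg_one : Units.map (Int.castRingHom ℝ : ℤ →* ℝ) (-1) = -1 := by
  apply Units.ext; simp

theorem closure_eq_range_signedHom (u : Fin n → ℝˣ) :
    Subgroup.closure (insert (-1) (Set.range u)) = (signedHom u).range := by
  apply le_antisymm
  · rw [Subgroup.closure_le]
    rintro x (rfl | ⟨i, rfl⟩)
    · exact ⟨(-1, .ofAdd 0), by rw [signedHom_apply, map_intCast_neg_one]; simp⟩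
    · refine ⟨(1, .ofAdd (Pi.single i 1)), ?_⟩
      rw [signedHom_apply, Finset.prod_eq_single i]
      · simp
      · intro j _ hj; simp [hj]
      · simp
  · rintro _ ⟨⟨e, p⟩, rfl⟩
    refine mul_mem ?_ (prod_mem fun i _ => zpow_mem (Subgroup.subset_closure (by simp)) _)
    rcases Int.units_eq_one_or e with rfl | rfl
    · simp
    · change Units.map (Int.castRingHom ℝ : ℤ →* ℝ) (-1) ∈ _
      rw [map_intCast_neg_one]
      exact Subgroup.subset_closure (by simp)

theorem eq_one_or_neg_one_of_isOfFinOrder {x : ℝˣ} (h : IsOfFinOrder x) : x = 1 ∨ x = -1 := by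
  obtain ⟨m, hm, hx⟩ := h.exists_pow_eq_one
  have h1 : (x : ℝ) ^ m = 1 := by rw [← Units.val_pow_eq_pow_val, hx]; rfl
  have h2 : |(x : ℝ)| = 1 := by
    have : |(x : ℝ)| ^ m = 1 := by rw [← abs_pow, h1, abs_one]
    exact (pow_eq_one_iff_of_nonneg (abs_nonneg _) hm.ne').1 this
  rcases eq_or_eq_neg_of_abs_eq h2 with h3 | h3
  · left; exact Units.ext h3
  · right; exact Units.ext (by rw [h3]; simp)

theorem prod_zpow_pos {u : Fin n → ℝˣ} (hu : ∀ i, 0 < (u i : ℝ)) (p : Fin n → ℤ) :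
    0 < ((∏ i, u i ^ p i : ℝˣ) : ℝ) := by
  rw [Units.coe_prod]
  refine Finset.prod_pos fun i _ => ?_
  rw [Units.val_zpow_eq_zpow_val]
  exact zpow_pos (hu i) _

/-- If products of the `uᵢ` are squares in `k` only for even exponents, then the `uᵢ` are
multiplicatively independent. -/
theorem injective_signedHom {u : Fin n → ℝˣ} (hu : ∀ i, 0 < (u i : ℝ))
    (hsat : ∀ p : Fin n → ℤ, ∏ i, u i ^ p i = 1 → ∀ i, Even (p i)) :
    Function.Injective (signedHom u) := by
  rw [injective_iff_map_eq_one]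
  rintro ⟨e, p⟩ h
  -- Halving the even exponents of a relation gives a relation again, since a positive number with
  -- square `1` is `1`. So the exponents are divisible by every power of `2`.
  have hdvd : ∀ (k : ℕ) (p : Fin n → ℤ), ∏ i, u i ^ p i = 1 → ∀ i, (2 : ℤ) ^ k ∣ p i := by
    intro k
    induction k with
    | zero => intro p _ i; simp
    | succ k ih =>
      intro p hp i
      choose p' hp' using hsat p hp
      have h1 : ∏ i, u i ^ p' i = 1 := by
        have h2 : (∏ i, u i ^ p' i) ^ 2 = 1 := by
          rw [← hp, ← Finset.prod_pow]
          refine Finset.prod_congr rfl fun i _ => ?_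
          rw [hp' i, zpow_add, sq]
        have h3 := prod_zpow_pos hu p'
        apply Units.ext
        have h4 : ((∏ i, u i ^ p' i : ℝˣ) : ℝ) ^ 2 = 1 := by
          rw [← Units.val_pow_eq_pow_val, h2]; rfl
        exact (pow_eq_one_iff_of_nonneg h3.le two_ne_zero).1 h4
      obtain ⟨m, hm⟩ := ih p' h1 i
      exact ⟨m, by rw [hp' i, hm]; ring⟩
  have hpos := prod_zpow_pos hu p.toAdd
  have h' : Units.map (Int.castRingHom ℝ : ℤ →* ℝ) e * ∏ i, u i ^ p.toAdd i = 1 := h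
  rcases Int.units_eq_one_or e with rfl | rfl
  · rw [map_one, one_mul] at h'
    have hp : p.toAdd = 0 := by
      funext i
      by_contra hne
      have h1 := hdvd (p.toAdd i).natAbs _ h' i
      have h2 := Int.natAbs_dvd_natAbs.2 h1
      have h3 := Nat.le_of_dvd (Int.natAbs_pos.2 hne) h2
      rw [Int.natAbs_pow] at h3
      exact absurd h3 (not_le.2 Nat.lt_two_pow_self)
    exact Prod.ext rfl hp
  · exfalso
    rw [map_intCast_neg_one] at h'
    have h1 := congrArg (Units.val) h'
    simp only [Units.val_neg, Units.val_one, neg_one_mul] at h1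
    linarith

/-- A subgroup generated by `-1` and positive `uᵢ` that is closed under square roots in `k`. -/
theorem mem_range_of_sq_mem {u : Fin n → ℝˣ} (hu : ∀ i, 0 < (u i : ℝ)) {k : IntermediateField ℚ ℝ}
    (hsat : ∀ v ∈ unitGroup k, ∀ p : Fin n → ℤ, ∏ i, u i ^ p i = v ^ 2 → ∀ i, Even (p i))
    {v : ℝˣ} (hv : v ∈ unitGroup k) (h : v ^ 2 ∈ (signedHom u).range) :
    v ∈ (signedHom u).range := by
  obtain ⟨⟨e, p⟩, hp⟩ := h
  have hp' : Units.map (Int.castRingHom ℝ : ℤ →* ℝ) e * ∏ i, u i ^ p.toAdd i = v ^ 2 := hp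
  have hpos := prod_zpow_pos hu p.toAdd
  rcases Int.units_eq_one_or e with rfl | rfl
  · rw [map_one, one_mul] at hp'
    choose p' hpp using hsat v hv _ hp'
    have h2 : v ^ 2 = (∏ i, u i ^ p' i) ^ 2 := by
      rw [← hp', ← Finset.prod_pow]
      refine Finset.prod_congr rfl fun i _ => ?_
      rw [hpp i, zpow_add, sq]
    have h2' : (v : ℝ) ^ 2 = ((∏ i, u i ^ p' i : ℝˣ) : ℝ) ^ 2 := by
      rw [← Units.val_pow_eq_pow_val, h2, Units.val_pow_eq_pow_val]
    have h3 : v = ∏ i, u i ^ p' i ∨ v = -∏ i, u i ^ p' i := by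
      rcases sq_eq_sq_iff_eq_or_eq_neg.1 h2' with h3 | h3
      · exact .inl (Units.ext h3)
      · exact .inr (Units.ext (by rw [h3, Units.val_neg]))
    rcases h3 with h3 | h3
    · exact ⟨(1, .ofAdd p'), by rw [signedHom_apply, map_one, one_mul, h3]⟩
    · exact ⟨(-1, .ofAdd p'), by rw [signedHom_apply, map_intCast_neg_one, h3, neg_one_mul]⟩
  -- A negative number is not a square in `ℝ`.
  · exfalso
    rw [map_intCast_neg_one] at hp'
    have h1 := congrArg (Units.val) hp'
    simp only [neg_one_mul, Units.val_neg, Units.val_pow_eq_pow_val] at h1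
    have := sq_nonneg (v : ℝ)
    linarith

theorem isFundamentalSystem_of_range {u : Fin n → ℝˣ} {k : IntermediateField ℚ ℝ}
    (hinj : Function.Injective (signedHom u)) (hr : unitGroup k = (signedHom u).range)
    (hmem : ∀ i, u i ∈ unitGroup k) : IsFundamentalSystem k u := by
  refine ⟨hmem, fun x hx => ?_⟩
  rw [hr] at hx
  obtain ⟨⟨e, p⟩, rfl⟩ := hx
  refine ⟨(Units.map (Int.castRingHom ℝ : ℤ →* ℝ) e, p.toAdd), ⟨?_, ?_, rfl⟩, ?_⟩
  · rcases Int.units_eq_one_or e with rfl | rfl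
    · simp
    · change Units.map (Int.castRingHom ℝ : ℤ →* ℝ) (-1) ∈ _
      rw [map_intCast_neg_one]
      exact neg_one_mem_unitGroup k
  · exact MonoidHom.isOfFinOrder _ (isOfFinOrder_of_finite e)
  · rintro ⟨ζ, p'⟩ ⟨-, hfin, heq⟩
    have key : ∀ e' : ℤˣ, ζ = Units.map (Int.castRingHom ℝ : ℤ →* ℝ) e' →
        (ζ, p') = (Units.map (Int.castRingHom ℝ : ℤ →* ℝ) e, p.toAdd) := by
      rintro e' rfl
      have h1 := hinj (a₁ := (e, p)) (a₂ := (e', .ofAdd p')) heq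
      rw [Prod.mk.injEq] at h1
      rw [h1.1, h1.2]; rfl
    rcases eq_one_or_neg_one_of_isOfFinOrder hfin with h1 | h1 <;> simp only at h1
    · exact key 1 (by rw [h1, map_one])
    · exact key (-1) (by rw [h1, map_intCast_neg_one])

end SignedProducts

end RealUnits

end

noncomputable section

namespace RealUnits

/-! ### The index of the subgroup of even exponents. -/

section Index

/-- The parities of the last five exponents. -/
def parityHom : ℤˣ × Multiplicative (Fin 7 → ℤ) →* Multiplicative (Fin 5 → ZMod 2) where
  toFun x := .ofAdd fun i => ((x.2.toAdd (Fin.natAdd 2 i) : ℤ) : ZMod 2)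
  map_one' := by
    apply Multiplicative.toAdd.injective
    funext i
    simp
  map_mul' x y := by
    apply Multiplicative.toAdd.injective
    funext i
    simp

theorem mem_ker_parityHom {e : ℤˣ} {p : Fin 7 → ℤ} :
    (e, Multiplicative.ofAdd p) ∈ parityHom.ker ↔ ∀ i : Fin 5, Even (p (Fin.natAdd 2 i)) := by
  rw [MonoidHom.mem_ker]
  constructor
  · intro h i
    have h1 := congrFun (congrArg Multiplicative.toAdd h) i
    exact (ZMod.intCast_eq_zero_iff_even).1 h1
  · intro h
    apply Multiplicative.toAdd.injective
    funext i
    exact (ZMod.intCast_eq_zero_iff_even).2 (h i)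

theorem parityHom_surjective : Function.Surjective parityHom := by
  intro f
  refine ⟨(1, .ofAdd fun j : Fin (2 + 5) => Fin.addCases (motive := fun _ => ℤ) (fun _ => 0)
    (fun i => ((f.toAdd i).val : ℤ)) j), ?_⟩
  apply Multiplicative.toAdd.injective
  funext i
  change (((Fin.addCases (motive := fun _ => ℤ) (fun _ : Fin 2 => 0)
    (fun i => ((f.toAdd i).val : ℤ)) (Fin.natAdd 2 i)) : ℤ) : ZMod 2) = f.toAdd i
  rw [Fin.addCases_right]
  simp

/-- By injectivity the index can be computed on exponents, where the quotient is `(ℤ/2)⁵`. -/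
theorem relIndex_map_ker_parityHom {u : Fin 7 → ℝˣ} (hinj : Function.Injective (signedHom u)) :
    (parityHom.ker.map (signedHom u)).relIndex (signedHom u).range = 2 ^ 5 := by
  rw [← Subgroup.index_comap, Subgroup.comap_map_eq_self_of_injective hinj, Subgroup.index_ker,
    MonoidHom.range_eq_top.2 parityHom_surjective, Subgroup.card_top]
  simp

end Index

/-! ### Square roots lying in the field. -/

section SquareRoots

/-- From `w² = m x` one gets `√x = |w| / √m`. -/
theorem sqrt_mem_of_isClass {K : IntermediateField ℚ ℝ} {x : ℝ} {m : ℕ} (h : IsClass K x m)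
    (hm : m ≠ 0) (hmK : √(m : ℝ) ∈ K) : √x ∈ K := by
  obtain ⟨w, hw, hw2⟩ := h
  have hm' : (m : ℝ) ≠ 0 := by exact_mod_cast hm
  have hx : x = w ^ 2 / m := by rw [hw2]; field_simp
  rw [hx, Real.sqrt_div (sq_nonneg w), Real.sqrt_sq_eq_abs]
  refine div_mem ?_ hmK
  rcases abs_choice w with h | h <;> rw [h]
  · exact hw
  · exact neg_mem hw

theorem IsClass.mul {K : IntermediateField ℚ ℝ} {x y : ℝ} {m n : ℕ} (h : IsClass K x m)
    (h' : IsClass K y n) : IsClass K (x * y) (m * n) := by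
  obtain ⟨w, hw, hw2⟩ := h
  obtain ⟨w', hw', hw2'⟩ := h'
  exact ⟨w * w', mul_mem hw hw', by rw [mul_pow, hw2, hw2']; push_cast; ring⟩

theorem sqrt_pow_mem {K : IntermediateField ℚ ℝ} {m : ℕ} (h : √(m : ℝ) ∈ K) (n : ℕ) :
    √((m ^ n : ℕ) : ℝ) ∈ K := by
  induction n with
  | zero => simp
  | succ n ih => rw [pow_succ]; exact sqrt_mul_mem ih h

theorem sqrt_pow_mem_of_even (K : IntermediateField ℚ ℝ) (m : ℕ) {n : ℕ} (hn : Even n) :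
    √((m ^ n : ℕ) : ℝ) ∈ K := by
  obtain ⟨k, rfl⟩ := hn
  have : ((m ^ (k + k) : ℕ) : ℝ) = ((m ^ k : ℕ) : ℝ) ^ 2 := by push_cast; ring
  rw [this, Real.sqrt_sq (Nat.cast_nonneg _)]
  exact natCast_mem K _

/-- The field contains `√2`, `√q` and `√(rs)`; equal parities of `k` and `l` allow `r` and `s` to be
paired. -/
theorem sqrt_mono_mem {q r s i j k l : ℕ} (h : Even (k + l)) :
    √((mono q r s i j k l : ℕ) : ℝ) ∈ triField 2 q (r * s) := by
  have h1 : √((2 ^ i * q ^ j : ℕ) : ℝ) ∈ triField 2 q (r * s) :=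
    sqrt_mul_mem (sqrt_pow_mem sqrt_left_mem_triField i) (sqrt_pow_mem sqrt_mid_mem_triField j)
  rw [mono, mul_assoc]
  refine sqrt_mul_mem h1 ?_
  rcases Nat.even_or_odd k with hk | hk
  · exact sqrt_mul_mem (sqrt_pow_mem_of_even _ r hk)
      (sqrt_pow_mem_of_even _ s ((Nat.even_add.1 h).1 hk))
  · have hl : Odd l := by
      rw [Nat.even_add] at h
      rw [← Nat.not_even_iff_odd] at hk ⊢
      exact fun h' => hk (h.2 h')
    obtain ⟨k', rfl⟩ := hk
    obtain ⟨l', rfl⟩ := hl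
    have : r ^ (2 * k' + 1) * s ^ (2 * l' + 1) = r ^ (2 * k') * s ^ (2 * l') * (r * s) := by ring
    rw [this]
    exact sqrt_mul_mem (sqrt_mul_mem (sqrt_pow_mem_of_even _ r (even_two_mul k'))
      (sqrt_pow_mem_of_even _ s (even_two_mul l'))) sqrt_right_mem_triField

end SquareRoots

/-! ### The unit group and its index. -/

section Main

variable {e : ℤ} {ν ρ q r s : ℕ}

/-- The seven units `ε₂, ε_{rs}, √ε_q, √ε_{2q}, √ε_{2rs}, √(ε_{rs} ε_{νqrs}), √ε_{ρqrs}`. -/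
structure RealUnitSystem (ν ρ q r s : ℕ) (u : Fin 7 → ℝˣ) : Prop where
  h0 : u 0 = fundUnit 2
  h1 : u 1 = fundUnit (r * s)
  h2 : (u 2 : ℝ) = √(fundUnit q : ℝ)
  h3 : (u 3 : ℝ) = √(fundUnit (2 * q) : ℝ)
  h4 : (u 4 : ℝ) = √(fundUnit (2 * r * s) : ℝ)
  h5 : (u 5 : ℝ) = √((fundUnit (r * s) : ℝ) * (fundUnit (ν * q * r * s) : ℝ))
  h6 : (u 6 : ℝ) = √(fundUnit (ρ * q * r * s) : ℝ)

variable [Fact q.Prime] [Fact r.Prime] [Fact s.Prime]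

theorem Setting.quadField_le (S : Setting e ν ρ q r s) {d : ℕ}
    (hd : d ∈ [2, q, 2 * q, r * s, 2 * r * s, ν * q * r * s, ρ * q * r * s]) :
    quadField d ≤ triField 2 q (r * s) := by
  have k2 : √((2 : ℕ) : ℝ) ∈ triField 2 q (r * s) := sqrt_left_mem_triField
  have kq : √(q : ℝ) ∈ triField 2 q (r * s) := sqrt_mid_mem_triField
  have krs : √((r * s : ℕ) : ℝ) ∈ triField 2 q (r * s) := sqrt_right_mem_triField
  have key : ∀ n : ℕ, n = 1 ∨ n = 2 → √((n * q * r * s : ℕ) : ℝ) ∈ triField 2 q (r * s) := by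
    rintro n (rfl | rfl)
    · rw [one_mul, mul_assoc]; exact sqrt_mul_mem kq krs
    · rw [mul_assoc]; exact sqrt_mul_mem (sqrt_mul_mem k2 kq) krs
  refine le_of_sqrt_mem ?_
  simp only [List.mem_cons, List.not_mem_nil, or_false] at hd
  rcases hd with rfl | rfl | rfl | rfl | rfl | rfl | rfl
  · exact k2
  · exact kq
  · exact sqrt_mul_mem k2 kq
  · exact krs
  · rw [mul_assoc]; exact sqrt_mul_mem k2 krs
  · exact key ν (by rcases S.cases with h | h <;> simp [h.1])
  · exact key ρ (by rcases S.cases with h | h <;> simp [h.2])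

/-- The seven quadratic subfields, in the form in which they arise from the generators. -/
theorem Setting.mem_list (S : Setting e ν ρ q r s) {d : ℕ}
    (hd : d ∈ [2, q, 2 * q, r * s, 2 * (r * s), q * (r * s), 2 * q * (r * s)]) :
    d ∈ [2, q, 2 * q, r * s, 2 * r * s, ν * q * r * s, ρ * q * r * s] := by
  simp only [List.mem_cons, List.not_mem_nil, or_false] at hd ⊢
  rcases S.cases with ⟨rfl, rfl⟩ | ⟨rfl, rfl⟩
  all_goals
    simp only [one_mul, mul_assoc] at hd ⊢
    tauto

theorem Setting.admissible (S : Setting e ν ρ q r s) {d : ℕ}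
    (hd : d ∈ [2, q, 2 * q, r * s, 2 * r * s, ν * q * r * s, ρ * q * r * s]) : Admissible d := by
  simp only [List.mem_cons, List.not_mem_nil, or_false] at hd
  rcases hd with rfl | rfl | rfl | rfl | rfl | rfl | rfl
  · exact admissible_two
  · exact S.triple.admissible_q
  · exact S.triple.admissible_two_q
  · exact S.triple.admissible_rs
  · exact S.triple.admissible_two_rs
  · exact S.admissible_ν
  · exact S.admissible_ρ

theorem Setting.exists_realUnitSystem (S : Setting e ν ρ q r s) :
    ∃ u, RealUnitSystem ν ρ q r s u := by
  have sq : ∀ {x : ℝ}, 0 < x → √x ≠ 0 := fun h => (Real.sqrt_pos.2 h).ne'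
  have p1 := fundUnit_pos S.triple.admissible_rs
  exact ⟨![fundUnit 2, fundUnit (r * s),
    Units.mk0 _ (sq (fundUnit_pos S.triple.admissible_q)),
    Units.mk0 _ (sq (fundUnit_pos S.triple.admissible_two_q)),
    Units.mk0 _ (sq (fundUnit_pos S.triple.admissible_two_rs)),
    Units.mk0 _ (sq (mul_pos p1 (fundUnit_pos S.admissible_ν))),
    Units.mk0 _ (sq (fundUnit_pos S.admissible_ρ))], rfl, rfl, rfl, rfl, rfl, rfl, rfl⟩

variable {u : Fin 7 → ℝˣ}

namespace RealUnitSystem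

theorem sq_two (S : Setting e ν ρ q r s) (hu : RealUnitSystem ν ρ q r s u) :
    u 2 ^ 2 = fundUnit q :=
  Units.ext (by
    rw [Units.val_pow_eq_pow_val, hu.h2, Real.sq_sqrt (fundUnit_pos S.triple.admissible_q).le])

theorem sq_three (S : Setting e ν ρ q r s) (hu : RealUnitSystem ν ρ q r s u) :
    u 3 ^ 2 = fundUnit (2 * q) :=
  Units.ext (by
    rw [Units.val_pow_eq_pow_val, hu.h3, Real.sq_sqrt (fundUnit_pos S.triple.admissible_two_q).le])

theorem sq_four (S : Setting e ν ρ q r s) (hu : RealUnitSystem ν ρ q r s u) :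
    u 4 ^ 2 = fundUnit (2 * r * s) :=
  Units.ext (by
    rw [Units.val_pow_eq_pow_val, hu.h4, Real.sq_sqrt (fundUnit_pos S.triple.admissible_two_rs).le])

theorem sq_five (S : Setting e ν ρ q r s) (hu : RealUnitSystem ν ρ q r s u) :
    u 5 ^ 2 = fundUnit (r * s) * fundUnit (ν * q * r * s) :=
  Units.ext (by
    rw [Units.val_pow_eq_pow_val, hu.h5, Real.sq_sqrt (mul_pos
      (fundUnit_pos S.triple.admissible_rs) (fundUnit_pos S.admissible_ν)).le, Units.val_mul])

theorem sq_six (S : Setting e ν ρ q r s) (hu : RealUnitSystem ν ρ q r s u) :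
    u 6 ^ 2 = fundUnit (ρ * q * r * s) :=
  Units.ext (by
    rw [Units.val_pow_eq_pow_val, hu.h6, Real.sq_sqrt (fundUnit_pos S.admissible_ρ).le])

theorem pos (S : Setting e ν ρ q r s) (hu : RealUnitSystem ν ρ q r s u) (i : Fin 7) :
    0 < (u i : ℝ) := by
  have h := S.triple
  fin_cases i
  · change 0 < (u 0 : ℝ); rw [hu.h0]; exact fundUnit_pos admissible_two
  · change 0 < (u 1 : ℝ); rw [hu.h1]; exact fundUnit_pos h.admissible_rs
  · change 0 < (u 2 : ℝ); rw [hu.h2]; exact Real.sqrt_pos.2 (fundUnit_pos h.admissible_q)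
  · change 0 < (u 3 : ℝ); rw [hu.h3]; exact Real.sqrt_pos.2 (fundUnit_pos h.admissible_two_q)
  · change 0 < (u 4 : ℝ); rw [hu.h4]; exact Real.sqrt_pos.2 (fundUnit_pos h.admissible_two_rs)
  · change 0 < (u 5 : ℝ); rw [hu.h5]
    exact Real.sqrt_pos.2 (mul_pos (fundUnit_pos h.admissible_rs) (fundUnit_pos S.admissible_ν))
  · change 0 < (u 6 : ℝ); rw [hu.h6]; exact Real.sqrt_pos.2 (fundUnit_pos S.admissible_ρ)

/-- The classes `2` and `rs` have square roots in the field. For `u 5`, the class `s` of `ε_{rs}`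
times that of `ε_{νqrs}` has even total degree in `r, s`. -/
theorem mem (S : Setting e ν ρ q r s) (hu : RealUnitSystem ν ρ q r s u) (i : Fin 7) :
    u i ∈ unitGroup (triField 2 q (r * s)) := by
  have h := S.triple
  have pq := h.prime_q.pos.ne'
  have pr := h.prime_r.pos.ne'
  have ps := h.prime_s.pos.ne'
  have prs : r * s ≠ 0 := mul_ne_zero pr ps
  have k2 : √((2 : ℕ) : ℝ) ∈ triField 2 q (r * s) := sqrt_left_mem_triField
  have krs : √((r * s : ℕ) : ℝ) ∈ triField 2 q (r * s) := sqrt_right_mem_triField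
  fin_cases i
  · change u 0 ∈ _; rw [hu.h0]
    exact unitGroup_mono (S.quadField_le (by simp)) (fundUnit_mem admissible_two)
  · change u 1 ∈ _; rw [hu.h1]
    exact unitGroup_mono (S.quadField_le (by simp)) (fundUnit_mem h.admissible_rs)
  · refine mem_unitGroup_of_sq_mem ?_ (l := quadField q)
      ((hu.sq_two S).symm ▸ fundUnit_mem h.admissible_q)
    change (u 2 : ℝ) ∈ _; rw [hu.h2]
    exact sqrt_mem_of_isClass (h.hasClass_q.isClass (S.quadField_le (by simp))) two_ne_zero k2
  · refine mem_unitGroup_of_sq_mem ?_ (l := quadField (2 * q))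
      ((hu.sq_three S).symm ▸ fundUnit_mem h.admissible_two_q)
    change (u 3 : ℝ) ∈ _; rw [hu.h3]
    exact sqrt_mem_of_isClass (h.hasClass_two_q.isClass (S.quadField_le (by simp))) two_ne_zero k2
  · refine mem_unitGroup_of_sq_mem ?_ (l := quadField (2 * r * s))
      ((hu.sq_four S).symm ▸ fundUnit_mem h.admissible_two_rs)
    change (u 4 : ℝ) ∈ _; rw [hu.h4]
    exact sqrt_mem_of_isClass (h.hasClass_two_rs.isClass (S.quadField_le (by simp))) prs krs
  · refine mem_unitGroup_of_sq_mem ?_ (l := triField 2 q (r * s)) ((hu.sq_five S).symm ▸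
      mul_mem (unitGroup_mono (S.quadField_le (by simp)) (fundUnit_mem h.admissible_rs))
        (unitGroup_mono (S.quadField_le (by simp)) (fundUnit_mem S.admissible_ν)))
    change (u 5 : ℝ) ∈ _; rw [hu.h5]
    obtain ⟨i, j, k, l, hcl, hodd⟩ := S.class_ν
    have c1 : HasClass (r * s) (mono q r s 0 0 0 1) := (mono_s q r s).symm ▸ h.hasClass_rs
    have c2 := (c1.isClass (S.quadField_le (by simp))).mul (hcl.isClass (S.quadField_le (by simp)))
    rw [mono_mul] at c2
    refine sqrt_mem_of_isClass c2 (by simp only [mono]; positivity) (sqrt_mono_mem ?_)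
    rw [Nat.odd_iff] at hodd
    rw [Nat.even_iff]
    omega
  · refine mem_unitGroup_of_sq_mem ?_ (l := quadField (ρ * q * r * s))
      ((hu.sq_six S).symm ▸ fundUnit_mem S.admissible_ρ)
    change (u 6 : ℝ) ∈ _; rw [hu.h6]
    exact sqrt_mem_of_isClass (S.class_ρ.isClass (S.quadField_le (by simp))) prs krs

/-- A product of the seven units is a square in the field only if all exponents are even. -/
theorem even_of_prod_eq_sq (S : Setting e ν ρ q r s) (hu : RealUnitSystem ν ρ q r s u) {v : ℝˣ}
    (hv : v ∈ unitGroup (triField 2 q (r * s))) {p : Fin 7 → ℤ} (hp : ∏ i, u i ^ p i = v ^ 2)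
    (i : Fin 7) : Even (p i) := by
  -- Write each exponent as twice its quotient plus a remainder; the quotients are absorbed into
  -- `v`, leaving exponents `0, 1`.
  set K := triField 2 q (r * s) with hK
  set w : ℝˣ := v * ∏ i, u i ^ (-(p i / 2)) with hw
  have hwK : w ∈ unitGroup K := mul_mem hv (prod_mem fun i _ => zpow_mem (hu.mem S i) _)
  set t : Fin 7 → ℕ := fun i => (p i % 2).toNat with ht
  have htp : ∀ i, p i = 2 * (p i / 2) + t i := by
    intro i
    have : (t i : ℤ) = p i % 2 := Int.toNat_of_nonneg (Int.emod_nonneg _ two_ne_zero)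
    rw [this]; omega
  have hw2 : w ^ 2 = ∏ i, u i ^ t i := by
    rw [hw, mul_pow, ← hp, ← Finset.prod_pow, ← Finset.prod_mul_distrib]
    refine Finset.prod_congr rfl fun i _ => ?_
    rw [← zpow_natCast, ← zpow_natCast, ← zpow_mul, ← zpow_add]
    congr 1
    have := htp i
    push_cast
    omega
  set U : Fin 7 → K := fun i => ⟨u i, (mem_unitGroup_iff.1 (hu.mem S i)).1⟩ with hU
  have hsys : UnitSystem ν ρ q r s U := by
    refine ⟨?_, ?_, ?_, ?_, ?_, ?_, ?_⟩
    · change (u 0 : ℝ) = _; rw [hu.h0]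
    · change (u 1 : ℝ) = _; rw [hu.h1]
    · change (u 2 : ℝ) ^ 2 = _; rw [← Units.val_pow_eq_pow_val, hu.sq_two S]
    · change (u 3 : ℝ) ^ 2 = _; rw [← Units.val_pow_eq_pow_val, hu.sq_three S]
    · change (u 4 : ℝ) ^ 2 = _; rw [← Units.val_pow_eq_pow_val, hu.sq_four S]
    · change (u 5 : ℝ) ^ 2 = _; rw [← Units.val_pow_eq_pow_val, hu.sq_five S, Units.val_mul]
    · change (u 6 : ℝ) ^ 2 = _; rw [← Units.val_pow_eq_pow_val, hu.sq_six S]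
  have h0 := exponents_eq_zero S hsys (t := t)
    (fun i => by simp only [ht]; omega)
    (η := ⟨w, (mem_unitGroup_iff.1 hwK).1⟩) (by
      apply Subtype.ext
      have h1 := congrArg Units.val hw2
      rw [Units.val_pow_eq_pow_val, Units.coe_prod] at h1
      rw [IntermediateField.coe_pow, IntermediateField.coe_prod]
      simp only [Units.val_pow_eq_pow_val] at h1
      simpa [hU] using h1) i
  rw [htp i, h0]
  simp

theorem injective (S : Setting e ν ρ q r s) (hu : RealUnitSystem ν ρ q r s u) :
    Function.Injective (signedHom u) :=
  injective_signedHom (hu.pos S) fun p hp =>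
    hu.even_of_prod_eq_sq S (one_mem _) (v := 1) (by rw [hp, one_pow])

theorem fundUnit_mem_map (S : Setting e ν ρ q r s) (hu : RealUnitSystem ν ρ q r s u) {d : ℕ}
    (hd : d ∈ [2, q, 2 * q, r * s, 2 * r * s, ν * q * r * s, ρ * q * r * s]) :
    fundUnit d ∈ parityHom.ker.map (signedHom u) := by
  have key : ∀ p : Fin 7 → ℤ, (∀ i : Fin 5, Even (p (Fin.natAdd 2 i))) →
      ∏ i, u i ^ p i ∈ parityHom.ker.map (signedHom u) := fun p hp =>
    ⟨(1, .ofAdd p), mem_ker_parityHom.2 hp, by rw [signedHom_apply, map_one, one_mul]⟩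
  have s2 := hu.sq_two S
  have s3 := hu.sq_three S
  have s4 := hu.sq_four S
  have s5 := hu.sq_five S
  have s6 := hu.sq_six S
  simp only [List.mem_cons, List.not_mem_nil, or_false] at hd
  rcases hd with rfl | rfl | rfl | rfl | rfl | rfl | rfl
  · rw [← hu.h0]
    simpa [Fin.prod_univ_seven] using key ![1, 0, 0, 0, 0, 0, 0] (by decide)
  · rw [← s2]
    simpa [Fin.prod_univ_seven] using key ![0, 0, 2, 0, 0, 0, 0] (by decide)
  · rw [← s3]
    simpa [Fin.prod_univ_seven] using key ![0, 0, 0, 2, 0, 0, 0] (by decide)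
  · rw [← hu.h1]
    simpa [Fin.prod_univ_seven] using key ![0, 1, 0, 0, 0, 0, 0] (by decide)
  · rw [← s4]
    simpa [Fin.prod_univ_seven] using key ![0, 0, 0, 0, 2, 0, 0] (by decide)
  -- The factor `ε_{rs}` in `u 5 ^ 2` is removed by `u 1`, whose exponent carries no parity
  -- condition.
  · have : fundUnit (ν * q * r * s) = (u 1)⁻¹ * u 5 ^ 2 := by rw [s5, hu.h1]; simp
    rw [this]
    simpa [Fin.prod_univ_seven] using key ![0, -1, 0, 0, 0, 2, 0] (by decide)
  · rw [← s6]
    simpa [Fin.prod_univ_seven] using key ![0, 0, 0, 0, 0, 0, 2] (by decide)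

theorem unitGroup_quadField_le (S : Setting e ν ρ q r s) (hu : RealUnitSystem ν ρ q r s u) {d : ℕ}
    (hd : d ∈ [2, q, 2 * q, r * s, 2 * r * s, ν * q * r * s, ρ * q * r * s]) :
    unitGroup (quadField d) ≤ parityHom.ker.map (signedHom u) := by
  intro v hv
  have h1 : (-1 : ℝˣ) ∈ parityHom.ker.map (signedHom u) :=
    ⟨(-1, .ofAdd 0), mem_ker_parityHom.2 (by simp), by
      rw [signedHom_apply, map_intCast_neg_one]; simp⟩
  obtain ⟨n, rfl | rfl⟩ := exists_zpow_of_mem_unitGroup (S.admissible hd) hv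
  · exact zpow_mem (hu.fundUnit_mem_map S hd) n
  · exact mul_mem h1 (zpow_mem (hu.fundUnit_mem_map S hd) n)

/-- The fourth power of a unit is in the range, and the range is closed under square roots in the
field; two extractions suffice. -/
theorem unitGroup_eq_range (S : Setting e ν ρ q r s) (hu : RealUnitSystem ν ρ q r s u) :
    unitGroup (triField 2 q (r * s)) = (signedHom u).range := by
  have h := S.triple
  apply le_antisymm
  · intro v hv
    have h1 : (-1 : ℝˣ) ∈ (signedHom u).range :=
      ⟨(-1, .ofAdd 0), by rw [signedHom_apply, map_intCast_neg_one]; simp⟩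
    have h4 : v ^ 4 ∈ (signedHom u).range := pow_four_mem admissible_two.not_isSquare
      h.admissible_q.not_isSquare h.admissible_rs.not_isSquare h1
      (fun d hd => (hu.unitGroup_quadField_le S (S.mem_list hd)).trans (Subgroup.map_le_range _ _))
      hv
    have key : ∀ {w : ℝˣ}, w ∈ unitGroup (triField 2 q (r * s)) → w ^ 2 ∈ (signedHom u).range →
        w ∈ (signedHom u).range := fun hw hw2 =>
      mem_range_of_sq_mem (hu.pos S)
        (fun v hv p hp => hu.even_of_prod_eq_sq S hv hp) hw hw2
    refine key hv (key (pow_mem hv 2) ?_)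
    rwa [← pow_mul]
  · rw [← closure_eq_range_signedHom, Subgroup.closure_le]
    rintro x (rfl | ⟨i, rfl⟩)
    · exact neg_one_mem_unitGroup _
    · exact hu.mem S i

/-- Every quadratic subfield is one of the seven `ℚ(√d)`, whose units are `±ε_d^n`. Conversely the
squares `u i ^ 2` for `i ≥ 2` are products of fundamental units, so even exponents there suffice. -/
theorem iSup_unitGroup_eq (S : Setting e ν ρ q r s) (hu : RealUnitSystem ν ρ q r s u) :
    (⨆ F ∈ {F : IntermediateField ℚ ℝ | F ≤ triField 2 q (r * s) ∧ Module.finrank ℚ F = 2},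
      unitGroup F) = parityHom.ker.map (signedHom u) := by
  apply le_antisymm
  · refine iSup₂_le ?_
    rintro F ⟨hFK, hF⟩
    obtain ⟨d, hd, hdF⟩ := sqrt_mem_of_finrank hFK hF
    have hd' := S.mem_list hd
    rw [eq_quadField_of_sqrt_mem hF (S.admissible hd').not_isSquare hdF]
    exact hu.unitGroup_quadField_le S hd'
  · set H := ⨆ F ∈ {F : IntermediateField ℚ ℝ | F ≤ triField 2 q (r * s) ∧
      Module.finrank ℚ F = 2}, unitGroup F with hH
    have hle : ∀ {d : ℕ}, d ∈ [2, q, 2 * q, r * s, 2 * r * s, ν * q * r * s, ρ * q * r * s] →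
        unitGroup (quadField d) ≤ H := fun {d} hd =>
      le_iSup₂_of_le (f := fun F (_ : F ∈ {F : IntermediateField ℚ ℝ |
        F ≤ triField 2 q (r * s) ∧ Module.finrank ℚ F = 2}) => unitGroup F) (quadField d)
        ⟨S.quadField_le hd, finrank_quadField (S.admissible hd).not_isSquare⟩ le_rfl
    have hfu : ∀ {d : ℕ}, d ∈ [2, q, 2 * q, r * s, 2 * r * s, ν * q * r * s, ρ * q * r * s] →
        fundUnit d ∈ H := fun {d} hd => hle hd (fundUnit_mem (S.admissible hd))
    rintro _ ⟨⟨e, p⟩, hp, rfl⟩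
    have hp' := (mem_ker_parityHom (e := e) (p := p.toAdd)).1 hp
    refine mul_mem ?_ (prod_mem fun i _ => ?_)
    · have h1 : (-1 : ℝˣ) ∈ H := hle (d := 2) (by simp) (neg_one_mem_unitGroup _)
      rcases Int.units_eq_one_or e with rfl | rfl
      · simp
      · change Units.map (Int.castRingHom ℝ : ℤ →* ℝ) (-1) ∈ _
        rwa [map_intCast_neg_one]
    · have even : ∀ {x : ℝˣ} {m : ℤ}, x ^ 2 ∈ H → Even m → x ^ m ∈ H := by
        rintro x _ hx ⟨k, rfl⟩
        rw [← two_mul, zpow_mul]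
        exact zpow_mem (by exact_mod_cast hx) k
      fin_cases i
      · exact zpow_mem (hu.h0 ▸ hfu (by simp)) _
      · exact zpow_mem (hu.h1 ▸ hfu (by simp)) _
      · exact even ((hu.sq_two S).symm ▸ hfu (by simp)) (hp' 0)
      · exact even ((hu.sq_three S).symm ▸ hfu (by simp)) (hp' 1)
      · exact even ((hu.sq_four S).symm ▸ hfu (by simp)) (hp' 2)
      · exact even ((hu.sq_five S).symm ▸ mul_mem (hfu (by simp)) (hfu (by simp))) (hp' 3)
      · exact even ((hu.sq_six S).symm ▸ hfu (by simp)) (hp' 4)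

theorem unitIndex_eq (S : Setting e ν ρ q r s) (hu : RealUnitSystem ν ρ q r s u) :
    unitIndex (triField 2 q (r * s)) = 2 ^ 5 := by
  rw [unitIndex, hu.iSup_unitGroup_eq S, hu.unitGroup_eq_range S]
  exact relIndex_map_ker_parityHom (hu.injective S)

end RealUnitSystem

theorem triField_eq_adjoin (a b c : ℕ) :
    triField a b c = IntermediateField.adjoin ℚ {√(a : ℝ), √(b : ℝ), √(c : ℝ)} := by
  rw [triField, quadField, quadField, quadField, ← IntermediateField.adjoin_union,
    ← IntermediateField.adjoin_union]
  congr 1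
  ext x
  simp
  tauto

theorem cyclotomicLayer_eq_triField {ν : ℕ} (hν : ν = 1 ∨ ν = 2) (q r s : ℕ) :
    cyclotomicLayer (fieldK ν q r s) 1 = triField 2 q (r * s) := by
  have hcos : 2 * Real.cos (2 * Real.pi / 2 ^ (1 + 2)) = √((2 : ℕ) : ℝ) := by
    rw [show 2 * Real.pi / 2 ^ (1 + 2) = Real.pi / 4 by ring, Real.cos_pi_div_four]
    push_cast; ring
  rw [cyclotomicLayer, hcos, fieldK]
  change _ ⊔ quadField 2 = _
  have k2 : √((2 : ℕ) : ℝ) ∈ triField 2 q (r * s) := sqrt_left_mem_triField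
  have kq : √(q : ℝ) ∈ triField 2 q (r * s) := sqrt_mid_mem_triField
  have krs : √((r * s : ℕ) : ℝ) ∈ triField 2 q (r * s) := sqrt_right_mem_triField
  apply le_antisymm
  · refine sup_le (IntermediateField.adjoin_le_iff.2 ?_) (le_of_sqrt_mem k2)
    rintro _ (rfl | rfl)
    · rcases hν with rfl | rfl
      · rw [one_mul]; exact kq
      · exact sqrt_mul_mem k2 kq
    · exact krs
  · set L := IntermediateField.adjoin ℚ {√((ν * q : ℕ) : ℝ), √((r * s : ℕ) : ℝ)} ⊔ quadField 2
    have l2 : √((2 : ℕ) : ℝ) ∈ L := (le_sup_right : quadField 2 ≤ L) (sqrt_mem_quadField 2)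
    have lsub : ∀ x ∈ ({√((ν * q : ℕ) : ℝ), √((r * s : ℕ) : ℝ)} : Set ℝ), x ∈ L := fun x hx =>
      (le_sup_left : IntermediateField.adjoin ℚ _ ≤ L) (IntermediateField.subset_adjoin ℚ _ hx)
    have lν := lsub √((ν * q : ℕ) : ℝ) (by simp)
    have lrs := lsub √((r * s : ℕ) : ℝ) (by simp)
    have lq : √(q : ℝ) ∈ L := by
      rcases hν with rfl | rfl
      · rwa [one_mul] at lν
      · have : √(q : ℝ) = √((2 * q : ℕ) : ℝ) / √((2 : ℕ) : ℝ) := by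
          rw [sqrt_natCast_mul]; field_simp
        rw [this]
        exact div_mem lν l2
    exact sup_le (sup_le (le_of_sqrt_mem l2) (le_of_sqrt_mem lq)) (le_of_sqrt_mem lrs)

end Main

end RealUnits

end

theorem mainTheorem6 (ν ρ q r s : ℕ)
    [Fact q.Prime] [Fact r.Prime] [Fact s.Prime]
    (hν : ν = 1 ∨ ν = 2) (hρ : ρ = 1 ∨ ρ = 2) (hρν : ρ ≠ ν)
    (hq : q % 8 = 7) (hr : r % 8 = 3) (hs : s % 8 = 3)
    (hqr : q ≠ r) (hqs : q ≠ s) (hrs : r ≠ s)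
    (hLqs : legendreSym s (q : ℤ) = (-1) ^ (if ν = 2 then 1 else 0))
    (hLqr : legendreSym r (q : ℤ) = (-1) ^ (if ν = 2 then 1 else 0))
    (hLsr : legendreSym r (s : ℤ) = 1)
    (a b : ℤ)
    (hab : (RealUnits.fundUnit (ν * q * r * s) : ℝ)
      = (a : ℝ) + (b : ℝ) * √((ν * q * r * s : ℕ) : ℝ))
    (hsq : ¬ ∃ m : ℕ, 2 ^ (if ν = 2 then 1 else 0) * (q : ℤ) * (a - 1) = (m : ℤ) ^ 2) :
    RealUnits.cyclotomicLayer (RealUnits.fieldK ν q r s) 1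
        = IntermediateField.adjoin ℚ {√(2 : ℝ), √(q : ℝ), √((r * s : ℕ) : ℝ)} ∧
    (∃ u : Fin 7 → ℝˣ,
      (u 0 = RealUnits.fundUnit 2 ∧
        u 1 = RealUnits.fundUnit (r * s) ∧
        (u 2 : ℝ) = √(RealUnits.fundUnit q : ℝ) ∧
        (u 3 : ℝ) = √(RealUnits.fundUnit (2 * q) : ℝ) ∧
        (u 4 : ℝ) = √(RealUnits.fundUnit (2 * r * s) : ℝ) ∧
        (u 5 : ℝ) = √((RealUnits.fundUnit (r * s) : ℝ)
          * (RealUnits.fundUnit (ν * q * r * s) : ℝ)) ∧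
        (u 6 : ℝ) = √(RealUnits.fundUnit (ρ * q * r * s) : ℝ)) ∧
      RealUnits.IsFundamentalSystem
        (RealUnits.cyclotomicLayer (RealUnits.fieldK ν q r s) 1) u ∧
      RealUnits.unitGroup (RealUnits.cyclotomicLayer (RealUnits.fieldK ν q r s) 1)
        = Subgroup.closure (insert (-1) (Set.range u))) ∧
    RealUnits.unitIndex (RealUnits.cyclotomicLayer (RealUnits.fieldK ν q r s) 1) = 2 ^ 5 := by
  -- The common Legendre symbol `e` is `1` for `ν = 1` and `-1` for `ν = 2`; the two classes swap
  -- roles accordingly.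
  obtain ⟨e, S⟩ : ∃ e : ℤ, RealUnits.Setting e ν ρ q r s := by
    rcases hν with rfl | rfl
    · have hρ2 : ρ = 2 := hρ.resolve_left hρν
      subst hρ2
      simp only [OfNat.one_ne_ofNat, if_false, pow_zero, one_mul] at hLqs hLqr hsq
      have T : RealUnits.PrimeTriple 1 q r s := ⟨hq, hr, hs, hqr, hqs, hrs, hLqr, hLqs, hLsr⟩
      exact ⟨1, T, .inl ⟨rfl, rfl⟩, T.hasClass_two_qrs_of_pos, T.hasClass_qrs_of_pos hab hsq⟩
    · have hρ1 : ρ = 1 := hρ.resolve_right hρν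
      subst hρ1
      simp only [if_true, pow_one] at hLqs hLqr hsq
      have T : RealUnits.PrimeTriple (-1) q r s := ⟨hq, hr, hs, hqr, hqs, hrs, hLqr, hLqs, hLsr⟩
      exact ⟨-1, T, .inr ⟨rfl, rfl⟩, T.hasClass_qrs_of_neg, T.hasClass_two_qrs_of_neg hab hsq⟩
  obtain ⟨u, hu⟩ := S.exists_realUnitSystem
  rw [RealUnits.cyclotomicLayer_eq_triField hν]
  refine ⟨?_, ⟨u, ⟨hu.h0, hu.h1, hu.h2, hu.h3, hu.h4, hu.h5, hu.h6⟩, ?_, ?_⟩, hu.unitIndex_eq S⟩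
  · rw [RealUnits.triField_eq_adjoin, Nat.cast_ofNat]
  · exact RealUnits.isFundamentalSystem_of_range (hu.injective S) (hu.unitGroup_eq_range S)
      (hu.mem S)
  · rw [hu.unitGroup_eq_range S, RealUnits.closure_eq_range_signedHom]
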